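/- **Setting.** Fix an infinite set $\mathsf{Chan}$ of channel (resource) names and a set $\mathsf{Own}$ of owners. A type is a pair $R=(k_u,k_p)\in\mathbb N^2$ (cost of using, cost of providing). Identifiers $\eta$ are channel names or variables, and they are the only values. The *code terms* and *systems* of the calculus Picost are $$T,U::=\eta?(x).T\mid \eta!\langle \eta'\rangle.T\mid \mathsf{if}\ \eta=\eta'\ \mathsf{then}\ T\ \mathsf{else}\ U\mid(\mathsf{new}\,r{:}R)T\mid T\,|\,U\mid \mathsf{rec}\,X.T\mid X\mid\mathsf{stop},$$ $$M,N::=[P]_o\mid M\,|\,N\mid(\mathsf{new}\,r{:}R)M\mid 0 ,$$ taken up to renaming of bound variables and without free variables ($P,Q$ range over closed code); $\mathrm{fn}$ denotes the free channel names. Bound names are always taken different from the free names in use. A *cost environment* $\Gamma$ consists of partial maps $\Gamma^u,\Gamma^p:\mathsf{Chan}\rightharpoonup\mathbb N$ with the same finite domain $\mathrm{dom}\,\Gamma$, a partial map $\Gamma^o:\mathsf{Own}\rightharpoonup\mathbb N\cup\{\infty\}$ (funds) and a record $\Gamma^{rec}\in\mathbb Z$. For $a\notin\mathrm{dom}\,\Gamma$,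 $\Gamma,a{:}R$ adds $a$ with the costs $R$. The pair $\Gamma\rhd M$ is a *configuration* if $\mathrm{fn}(M)\subseteq\mathrm{dom}\,\Gamma$. *Charging.* $\Gamma\xrightarrow{(u,a,p)}\Delta$ holds if $\Gamma^o(u)\ge\Gamma^u(a)$, $\Gamma^o(p)\ge\Gamma^p(a)$ (all four being defined) and $\Delta$ arises from $\Gamma$ by decreasing the funds of $u$ by $\Gamma^u(a)$, then increasing those of $p$ by $\Gamma^u(a)-\Gamma^p(a)$, and adding $\Gamma^u(a)-\Gamma^p(a)$ to the record. *Transfer.* $\Gamma\xrightarrow{(u,k,p)}\Delta$ holds if $\Gamma^o(u)\ge k$ and $\Gamma^o(p)$ is defined, and $\Delta$ arises from $\Gamma$ by moving $k$ from the funds of $u$ to those of $p$ (no change of the funds if $u=p$) and adding $k$ to the record; it has the effect of using a resource of type $(k,0)$. *Structural equivalence* $\equiv$ is the least equivalence on systems preserved by $|$ and $\mathsf{new}$ such that $|$ is commutative and associative with unit $0$, $[\mathsf{stop}]_o\equiv0$, $(\mathsf{new}\,r{:}R)(M|N)\equiv M|(\mathsf{new}\,r{:}R)N$ if $r\notin\mathrm{fn}(M)$,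 $(\mathsf{new}\,r{:}R)(\mathsf{new}\,r'{:}R')M\equiv(\mathsf{new}\,r'{:}R')(\mathsf{new}\,r{:}R)M$ for $r\ne r'$, and $(\mathsf{new}\,r{:}R)0\equiv0$. *Actions* $\Gamma\rhd M\xrightarrow{\lambda}\Delta\rhd N$, where $\lambda$ is $\tau$, an input $(u,(\tilde r{:}\tilde R)a?b,p)$ or an output $(u,(\tilde r{:}\tilde R)a!b,p)$, with user $u$, provider $p$, and $\tilde r{:}\tilde R$ either empty or $b{:}R$ (then $b$ is bound in $\lambda$). They are generated as follows. - If $\Gamma\xrightarrow{(u,a,o)}\Delta$: $\Gamma\rhd[a?(x).P]_o\xrightarrow{(u,a?b,o)}\Delta\rhd[P\{b/x\}]_o$ for $b\in\mathrm{dom}\,\Gamma$, and $\Gamma\rhd[a?(x).P]_o\xrightarrow{(u,(b:R)a?b,o)}\Delta,b{:}R\rhd[P\{b/x\}]_o$ for every $R$ and $b\notin\mathrm{dom}\,\Gamma\cup\mathrm{fn}(P)$. - If $\Gamma\xrightarrow{(o,a,p)}\Delta$: $\Gamma\rhd[a!\langle b\rangle.P]_o\xrightarrow{(o,a!b,p)}\Delta\rhd[P]_o$.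 - If $\Gamma,b{:}R\rhd M\xrightarrow{(u,a!b,p)}\Gamma'\rhd M'$ and $a\ne b$, then $\Gamma\rhd(\mathsf{new}\,b{:}R)M\xrightarrow{(u,(b:R)a!b,p)}\Gamma'\rhd M'$. - If $\Gamma\rhd M\xrightarrow{(u,(\tilde r:\tilde R)a?b,p)}\Delta,\tilde r{:}\tilde R\rhd M'$ and $\Gamma\rhd N\xrightarrow{(u,(\tilde r:\tilde R)a!b,p)}\Delta,\tilde r{:}\tilde R\rhd N'$, then $\Gamma\rhd M|N\xrightarrow{\tau}\Delta\rhd(\mathsf{new}\,\tilde r{:}\tilde R)(M'|N')$, and symmetrically. - With unchanged $\Gamma$ and label $\tau$: $[P|Q]_o\to[P]_o|[Q]_o$; $[(\mathsf{new}\,r{:}R)P]_o\to(\mathsf{new}\,r{:}R)[P]_o$; $[\mathsf{rec}\,X.T]_o\to[T\{\mathsf{rec}\,X.T/X\}]_o$; $[\mathsf{if}\ a=b\ \mathsf{then}\ P\ \mathsf{else}\ Q]_o\to[P]_o$ if $a=b$, and $\to[Q]_o$ if $a\neq b$. - Actions of $M$ are inherited by $M|N$ and $N|M$ if no bound name of $\lambda$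 is in $\mathrm{fn}(N)$; and if $\Gamma,b{:}R\rhd M\xrightarrow{\lambda}\Gamma',b{:}R\rhd M'$ and $b$ does not occur in $\lambda$, then $\Gamma\rhd(\mathsf{new}\,b{:}R)M\xrightarrow{\lambda}\Gamma'\rhd(\mathsf{new}\,b{:}R)M'$. *Reductions* $\Gamma\rhd M\mapsto\Delta\rhd N$ are generated by $\Gamma\rhd[a!\langle b\rangle.Q]_u|[a?(x).P]_p\mapsto\Delta\rhd[Q]_u|[P\{b/x\}]_p$ if $\Gamma\xrightarrow{(u,a,p)}\Delta$, by the $\tau$-rules with unchanged $\Gamma$ above, and by closure under $\equiv$, under $|$, and under $\mathsf{new}$ (from $\Gamma,b{:}R\rhd M\mapsto\Delta,b{:}R\rhd N$ infer $\Gamma\rhd(\mathsf{new}\,b{:}R)M\mapsto\Delta\rhd(\mathsf{new}\,b{:}R)N$). *Barbs:* $\Gamma\rhd M\Downarrow a!$ if $\Gamma\rhd M\mapsto^*\Delta\rhd(\mathsf{new}\,\tilde c)([a!\langle b\rangle.P]_o|N')$ with $a\notin\tilde c$ and $\Delta\xrightarrow{(o,a,p)}\Delta'$ for some $p,\Delta'$.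 *Abstract actions.* Let $O\subseteq\mathsf{Own}$. The abstract labels $\mu$ other than $\tau$ are the inputs $(u,(\tilde r{:}\tilde R)a?b)$, the outputs $((\tilde r)a!b,p)$ and the fund transfers $\mathsf{ext}(u,k,p)$ with $k\in\mathbb N$; here $\tilde r$ is empty or $\tilde r=b$, and $\tilde r$ is empty for fund transfers. Put $\Gamma\rhd M\xrightarrow{\mu}_{O,w}\Delta\rhd N$ if $w=\Delta^{rec}-\Gamma^{rec}$ and: for $\mu=\tau$, $\Gamma\rhd M\xrightarrow{\tau}\Delta\rhd N$; for an input, $u\in O$ and $\Gamma\rhd M\xrightarrow{(u,(\tilde r:\tilde R)a?b,p)}\Delta\rhd N$ for some $p$; for an output, $p\in O$ and $\Gamma\rhd M\xrightarrow{(u,(\tilde r:\tilde R)a!b,p)}\Delta\rhd N$ for some $u,\tilde R$; for a transfer, $u,p\in O$, $N=M$ and $\Gamma\xrightarrow{(u,k,p)}\Delta$. The weak action $\stackrel{\mu}{\Longrightarrow}_w$ is one action $\mu$ preceded and followed by any number of $\tau$-actions (so $\stackrel{\tau}{\Longrightarrow}_w$ has at least one $\tau$), $w$ being the sum of the weights.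 **Theorem (Definability).** Let $O\subseteq\mathsf{Own}$ and let $\mu$ be an abstract input, output or fund-transfer label, with bound names $\tilde r$. Let $\mathsf{succ},\mathsf{fail},\mathsf{req}$ be distinct names not in $\tilde r$, and for $\Gamma$ with $\mathsf{succ},\mathsf{fail},\mathsf{req}\notin\mathrm{dom}\,\Gamma$ let $\Gamma^t$ be $\Gamma$ extended by these three names, each of type $(0,0)$. Then for every finite $F\subseteq\mathsf{Chan}$ there are a system $T^F_\mu$, in which only owners from $O$ occur and whose free names are among $F$, the free names of $\mu$ and $\mathsf{succ},\mathsf{fail},\mathsf{req}$, and an owner $o$, such that for every configuration $\Gamma\rhd M$ with $\mathrm{dom}\,\Gamma\subseteq F$, $\Gamma^t$ defined and $\tilde r\cap\mathrm{dom}\,\Gamma=\emptyset$, the following holds. (i) If $\Gamma\rhd M\stackrel{\mu}{\Longrightarrow}_w\Delta,\tilde r{:}\tilde R\rhd N$ (in particular if this is a single action $\mu$), then $o\in O$, $\Delta^t$ is defined and, for some $M'$, $$\Gamma^t\rhd M\,|\,T^F_\mu\stackrel{\tau}{\Longrightarrow}_w\Delta^t\rhd M',\qquad M'\equiv(\mathsf{new}\,\tilde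 r{:}\tilde R)([\mathsf{succ}!\langle\tilde r\rangle]_o\,|\,N),$$ where $\Delta^t\rhd M'\Downarrow\mathsf{succ}!$ and $\Delta^t\rhd M'\not\Downarrow\mathsf{fail}!$. (ii) Conversely, if $\Gamma^t\rhd M\,|\,T^F_\mu\stackrel{\tau}{\Longrightarrow}_wE\rhd M'$ where $E\rhd M'\Downarrow\mathsf{succ}!$ and $E\rhd M'\not\Downarrow\mathsf{fail}!$, then $o\in O$ and there are $\Delta,\tilde R,N$ with $E=\Delta^t$, $M'\equiv(\mathsf{new}\,\tilde r{:}\tilde R)([\mathsf{succ}!\langle\tilde r\rangle]_o\,|\,N)$ and $\Gamma\rhd M\stackrel{\mu}{\Longrightarrow}_w\Delta,\tilde r{:}\tilde R\rhd N$. (Communication is unary; when $\tilde r$ is empty, $\mathsf{succ}!\langle\tilde r\rangle$ sends the name $\mathsf{succ}$ as a dummy value.) -/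

import Mathlib

namespace Picost

universe u v

/-- The type `(k_u, k_p)` of a resource: the cost of using it and the cost of providing it. -/
structure ResType where
  use : ℕ
  prov : ℕ

/-! ### Syntax

Terms are taken up to renaming of bound variables: bound identifiers and bound recursion variables
are de Bruijn indices, free channel names are elements of `Chan`. -/

/-- Identifiers: a channel name, or one of the `n` identifiers bound by the enclosing binders. -/
inductive Ident (Chan : Type u) (n : ℕ) : Type u
  | chan (c : Chan) : Ident Chan n
  | var (i : Fin n) : Ident Chan n

namespace Ident

variable {Chan : Type u} {n n' : ℕ}

def shift : Ident Chan n → Ident Chan (n + 1)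
  | chan c => chan c
  | var i => var i.succ

/-- A map of identifiers, carried under one more binder. -/
def lift (f : Ident Chan n → Ident Chan n') : Ident Chan (n + 1) → Ident Chan (n' + 1)
  | chan c => shift (f (chan c))
  | var i => Fin.cases (var 0) (fun j => shift (f (var j))) i

/-- Replace the single bound identifier by the name `b`. -/
def inst (b : Chan) : Ident Chan 1 → Ident Chan 0
  | chan c => chan c
  | var _ => chan b

/-- Bind the name `b`. -/
def bind [DecidableEq Chan] (b : Chan) : Ident Chan 0 → Ident Chan 1
  | chan c => if c = b then var 0 else chan c
  | var i => i.elim0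

def names : Ident Chan n → Finset Chan
  | chan c => {c}
  | var _ => ∅

end Ident

/-- Code terms, with `n` identifiers and `m` recursion variables in scope. Values are identifiers. -/
inductive Proc (Chan : Type u) : ℕ → ℕ → Type u
  /-- `stop` -/
  | nil {n m : ℕ} : Proc Chan n m
  /-- `a?(x).T` -/
  | inp {n m : ℕ} (a : Ident Chan n) (T : Proc Chan (n + 1) m) : Proc Chan n m
  /-- `a!⟨w⟩.T` -/
  | out {n m : ℕ} (a w : Ident Chan n) (T : Proc Chan n m) : Proc Chan n m
  /-- `if w = w' then T else U` -/
  | cond {n m : ℕ} (w w' : Ident Chan n) (T U : Proc Chan n m) : Proc Chan n m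
  /-- `(new r : R) T` -/
  | new {n m : ℕ} (R : ResType) (T : Proc Chan (n + 1) m) : Proc Chan n m
  /-- `T | U` -/
  | par {n m : ℕ} (T U : Proc Chan n m) : Proc Chan n m
  /-- `rec X. T` -/
  | fix {n m : ℕ} (T : Proc Chan n (m + 1)) : Proc Chan n m
  /-- a recursion variable -/
  | rvar {n m : ℕ} (X : Fin m) : Proc Chan n m

namespace Proc

variable {Chan : Type u}

/-- Capture-avoiding replacement of identifiers. -/
def map : {n n' m : ℕ} → (Ident Chan n → Ident Chan n') → Proc Chan n m → Proc Chan n' m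
  | _, _, _, _, nil => nil
  | _, _, _, f, inp a T => inp (f a) (map (Ident.lift f) T)
  | _, _, _, f, out a w T => out (f a) (f w) (map f T)
  | _, _, _, f, cond w w' T U => cond (f w) (f w') (map f T) (map f U)
  | _, _, _, f, new R T => new R (map (Ident.lift f) T)
  | _, _, _, f, par T U => par (map f T) (map f U)
  | _, _, _, f, fix T => fix (map f T)
  | _, _, _, _, rvar X => rvar X

/-- Renaming of recursion variables. -/
def renRec : {n m m' : ℕ} → (Fin m → Fin m') → Proc Chan n m → Proc Chan n m'
  | _, _, _, _, nil => nil
  | _, _, _, f, inp a T => inp a (renRec f T)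
  | _, _, _, f, out a w T => out a w (renRec f T)
  | _, _, _, f, cond w w' T U => cond w w' (renRec f T) (renRec f U)
  | _, _, _, f, new R T => new R (renRec f T)
  | _, _, _, f, par T U => par (renRec f T) (renRec f U)
  | _, _, _, f, fix T => fix (renRec (Fin.cases 0 (fun i => (f i).succ)) T)
  | _, _, _, f, rvar X => rvar (f X)

/-- Capture-avoiding substitution of code for recursion variables. -/
def substRec : {n m m' : ℕ} → (Fin m → Proc Chan n m') → Proc Chan n m → Proc Chan n m'
  | _, _, _, _, nil => nil
  | _, _, _, s, inp a T => inp a (substRec (fun i => (s i).map Ident.shift) T)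
  | _, _, _, s, out a w T => out a w (substRec s T)
  | _, _, _, s, cond w w' T U => cond w w' (substRec s T) (substRec s U)
  | _, _, _, s, new R T => new R (substRec (fun i => (s i).map Ident.shift) T)
  | _, _, _, s, par T U => par (substRec s T) (substRec s U)
  | _, _, _, s, fix T => fix (substRec (Fin.cases (rvar 0) (fun i => (s i).renRec Fin.succ)) T)
  | _, _, _, s, rvar X => s X

/-- `T{rec X. T / X}` for a term whose only free recursion variable is `X`. -/
def unfold {n : ℕ} (T : Proc Chan n 1) : Proc Chan n 0 :=
  substRec (fun _ => fix T) T

/-- `P{b/x}` for a term whose only free variable is `x`. -/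
def inst (b : Chan) (P : Proc Chan 1 0) : Proc Chan 0 0 :=
  P.map (Ident.inst b)

/-- The channel names that occur free. -/
def fn [DecidableEq Chan] : {n m : ℕ} → Proc Chan n m → Finset Chan
  | _, _, nil => ∅
  | _, _, inp a T => a.names ∪ fn T
  | _, _, out a w T => a.names ∪ w.names ∪ fn T
  | _, _, cond w w' T U => w.names ∪ w'.names ∪ fn T ∪ fn U
  | _, _, new _ T => fn T
  | _, _, par T U => fn T ∪ fn U
  | _, _, fix T => fn T
  | _, _, rvar _ => ∅

end Proc

/-- Systems, with `n` identifiers in scope. -/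
inductive Sys (Chan : Type u) (Own : Type v) : ℕ → Type (max u v)
  /-- `[T]_o` -/
  | owned {n : ℕ} (o : Own) (T : Proc Chan n 0) : Sys Chan Own n
  /-- `M | N` -/
  | par {n : ℕ} (M N : Sys Chan Own n) : Sys Chan Own n
  /-- `(new r : R) M` -/
  | new {n : ℕ} (R : ResType) (M : Sys Chan Own (n + 1)) : Sys Chan Own n
  /-- `0` -/
  | zero {n : ℕ} : Sys Chan Own n

namespace Sys

variable {Chan : Type u} {Own : Type v}

def map : {n n' : ℕ} → (Ident Chan n → Ident Chan n') → Sys Chan Own n → Sys Chan Own n'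
  | _, _, f, owned o T => owned o (T.map f)
  | _, _, f, par M N => par (map f M) (map f N)
  | _, _, f, new R M => new R (map (Ident.lift f) M)
  | _, _, _, zero => zero

/-- `M{b/r}`, for the body `M` of a restriction of `r`. -/
def inst (b : Chan) (M : Sys Chan Own 1) : Sys Chan Own 0 :=
  M.map (Ident.inst b)

/-- `(new b : R) M`, binding the name `b`. -/
def nu [DecidableEq Chan] (b : Chan) (R : ResType) (M : Sys Chan Own 0) : Sys Chan Own 0 :=
  new R (M.map (Ident.bind b))

/-- `(new b₁ : R₁) ⋯ (new bₖ : Rₖ) M` -/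
def nus [DecidableEq Chan] (bs : List (Chan × ResType)) (M : Sys Chan Own 0) : Sys Chan Own 0 :=
  bs.foldr (fun b N => nu b.1 b.2 N) M

/-- The channel names that occur free. -/
def fn [DecidableEq Chan] : {n : ℕ} → Sys Chan Own n → Finset Chan
  | _, owned _ T => T.fn
  | _, par M N => fn M ∪ fn N
  | _, new _ M => fn M
  | _, zero => ∅

/-- The owners under whose responsibility some code of the system runs. -/
def owners : {n : ℕ} → Sys Chan Own n → Set Own
  | _, owned o _ => {o}
  | _, par M N => owners M ∪ owners N
  | _, new _ M => owners M
  | _, zero => ∅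

end Sys

/-! ### Cost environments -/

/-- Cost environments. The partial maps `Γᵘ` and `Γᵖ`, which have the same finite domain, are
given together by `res`. Funds may be infinite; the record of expenditure may be negative. -/
structure CostEnv (Chan : Type u) (Own : Type v) where
  res : Chan → Option ResType
  finite_res : {a | (res a).isSome}.Finite
  funds : Own → Option ℕ∞
  record : ℤ

namespace CostEnv

variable {Chan : Type u} {Own : Type v}

def dom (Γ : CostEnv Chan Own) : Set Chan :=
  {a | (Γ.res a).isSome}

/-- `Γ, a : R`, meaningful when `a` is not in the domain of `Γ`. -/
def extend [DecidableEq Chan] (Γ : CostEnv Chan Own) (a : Chan) (R : ResType) :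
    CostEnv Chan Own where
  res := Function.update Γ.res a (some R)
  finite_res := by
    refine (Γ.finite_res.insert a).subset fun x hx => ?_
    by_cases h : x = a
    · exact Or.inl h
    · right
      simpa [Function.update_of_ne h] using hx
  funds := Γ.funds
  record := Γ.record

/-- `Γ, a₁ : R₁, …, aₖ : Rₖ`, meaningful when `Γ.Fresh [(a₁, R₁), …, (aₖ, Rₖ)]`. -/
def extendAll [DecidableEq Chan] (Γ : CostEnv Chan Own) (bs : List (Chan × ResType)) :
    CostEnv Chan Own :=
  bs.foldl (fun Δ b => Δ.extend b.1 b.2) Γ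

/-- The names in `bs` are distinct and not in the domain of `Γ`. -/
def Fresh (Γ : CostEnv Chan Own) (bs : List (Chan × ResType)) : Prop :=
  (bs.map Prod.fst).Nodup ∧ ∀ b ∈ bs, b.1 ∉ Γ.dom

variable [DecidableEq Own]

/-- Decrease the funds of `u` by `k`, then increase those of `p` by `k - l`; the rest is kept. -/
def moveFunds (f : Own → Option ℕ∞) (u p : Own) (k l : ℕ) : Own → Option ℕ∞ :=
  let f₁ := Function.update f u ((f u).map fun x => x - (k : ℕ∞))
  Function.update f₁ p ((f₁ p).map fun x => x + (k : ℕ∞) - (l : ℕ∞))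

/-- Standard resource charging, `Γ --(u,a,p)--> Δ`: `u` uses `a`, which `p` provides. -/
def Charge (Γ : CostEnv Chan Own) (u : Own) (a : Chan) (p : Own) (Δ : CostEnv Chan Own) : Prop :=
  ∃ R x y, Γ.res a = some R ∧ Γ.funds u = some x ∧ Γ.funds p = some y ∧
    (R.use : ℕ∞) ≤ x ∧ (R.prov : ℕ∞) ≤ y ∧
    Δ = { Γ with
          funds := moveFunds Γ.funds u p R.use R.prov
          record := Γ.record + (R.use : ℤ) - (R.prov : ℤ) }

/-- Fund transfer, `Γ --(u,k,p)--> Δ`: `k` is transferred from `u` to `p` and recorded, exactly as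
by the use of a resource of type `(k, 0)`. -/
def Transfer (Γ : CostEnv Chan Own) (u : Own) (k : ℕ) (p : Own) (Δ : CostEnv Chan Own) : Prop :=
  ∃ x y, Γ.funds u = some x ∧ Γ.funds p = some y ∧ (k : ℕ∞) ≤ x ∧
    Δ = { Γ with
          funds := moveFunds Γ.funds u p k 0
          record := Γ.record + (k : ℤ) }

end CostEnv

section Semantics

variable {Chan : Type u} {Own : Type v} [DecidableEq Chan] [DecidableEq Own]

/-- `Γ ▷ M` is a configuration. -/
def IsConfig (Γ : CostEnv Chan Own) (M : Sys Chan Own 0) : Prop :=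
  ∀ a ∈ M.fn, a ∈ Γ.dom

/-! ### Reduction semantics and observations -/

/-- Structural equivalence. -/
inductive Struct : Sys Chan Own 0 → Sys Chan Own 0 → Prop
  | refl (M) : Struct M M
  | symm {M N} : Struct M N → Struct N M
  | trans {M N O} : Struct M N → Struct N O → Struct M O
  | par {M M' N N'} : Struct M M' → Struct N N' → Struct (.par M N) (.par M' N')
  | nu (r : Chan) (R : ResType) {M N} : Struct M N → Struct (.nu r R M) (.nu r R N)
  | extr (r : Chan) (R : ResType) (M N) : r ∉ M.fn →
      Struct (.nu r R (.par M N)) (.par M (.nu r R N))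
  | com (M N) : Struct (.par M N) (.par N M)
  | assoc (M N O) : Struct (.par (.par M N) O) (.par M (.par N O))
  | zero (M) : Struct (.par M .zero) M
  | nil (o : Own) : Struct (.owned o .nil) .zero
  | flip (r r' : Chan) (R R' : ResType) (M) : r ≠ r' →
      Struct (.nu r R (.nu r' R' M)) (.nu r' R' (.nu r R M))
  | gc (R : ResType) : Struct (.new R .zero) .zero

/-- The reduction relation `Γ ▷ M ↦ Δ ▷ N`. -/
inductive Red : CostEnv Chan Own → Sys Chan Own 0 → CostEnv Chan Own → Sys Chan Own 0 → Prop
  | comm {Γ Δ : CostEnv Chan Own} {u p : Own} {a b : Chan} (Q P) : Γ.Charge u a p Δ →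
      Red Γ (.par (.owned u (.out (.chan a) (.chan b) Q)) (.owned p (.inp (.chan a) P)))
        Δ (.par (.owned u Q) (.owned p (P.inst b)))
  | split (Γ) (o : Own) (P Q) :
      Red Γ (.owned o (.par P Q)) Γ (.par (.owned o P) (.owned o Q))
  | extrude (Γ) (o : Own) (R : ResType) (P) :
      Red Γ (.owned o (.new R P)) Γ (.new R (.owned o P))
  | unwind (Γ) (o : Own) (T) : Red Γ (.owned o (.fix T)) Γ (.owned o T.unfold)
  | eq (Γ) (o : Own) (a : Chan) (P Q) :
      Red Γ (.owned o (.cond (.chan a) (.chan a) P Q)) Γ (.owned o P)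
  | ne (Γ) (o : Own) {a b : Chan} (P Q) : a ≠ b →
      Red Γ (.owned o (.cond (.chan a) (.chan b) P Q)) Γ (.owned o Q)
  | struct {Γ Δ M M' N N'} : Struct M M' → Red Γ M Δ N → Struct N N' → Red Γ M' Δ N'
  | par {Γ Δ M M'} (N) : Red Γ M Δ M' → Red Γ (.par M N) Δ (.par M' N)
  | new {Γ Δ : CostEnv Chan Own} {b : Chan} {R : ResType} {M : Sys Chan Own 1} {N} :
      b ∉ M.fn → b ∉ Γ.dom → b ∉ Δ.dom →
      Red (Γ.extend b R) (M.inst b) (Δ.extend b R) N → Red Γ (.new R M) Δ (.nu b R N)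

/-- The observation `Γ ▷ M ⇓ a!`. -/
def BarbOut (Γ : CostEnv Chan Own) (M : Sys Chan Own 0) (a : Chan) : Prop :=
  ∃ Δ N, Relation.ReflTransGen (fun C D : CostEnv Chan Own × Sys Chan Own 0 =>
      Red C.1 C.2 D.1 D.2) (Γ, M) (Δ, N) ∧
    ∃ (cs : List (Chan × ResType)) (o : Own) (b : Chan) (T : Proc Chan 0 0) (N' : Sys Chan Own 0),
      Struct N (.nus cs (.par (.owned o (.out (.chan a) (.chan b) T)) N')) ∧
      a ∉ cs.map Prod.fst ∧ ∃ p Δ', Δ.Charge o a p Δ'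

/-! ### Labelled transition semantics -/

/-- The vector `r̃ : R̃` of a label whose value is `b`: empty if `b` is a known name, and `b : R`
if `b` is bound in the label with type `R`. -/
def bindings (b : Chan) (t : Option ResType) : List (Chan × ResType) :=
  t.toList.map fun R => (b, R)

end Semantics

/-- Concrete labels. -/
inductive Label (Chan : Type u) (Own : Type v)
  | tau
  /-- `(u, (r̃ : R̃) a?b, p)` with `r̃ : R̃` being `bindings b t` -/
  | inp (u : Own) (t : Option ResType) (a b : Chan) (p : Own)
  /-- `(u, (r̃ : R̃) a!b, p)` with `r̃ : R̃` being `bindings b t` -/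
  | out (u : Own) (t : Option ResType) (a b : Chan) (p : Own)

namespace Label

variable {Chan : Type u} {Own : Type v} [DecidableEq Chan]

/-- All the channel names in a label. -/
def names : Label Chan Own → Finset Chan
  | tau => ∅
  | inp _ _ a b _ => {a, b}
  | out _ _ a b _ => {a, b}

/-- The bound names of a label. -/
def bn : Label Chan Own → List Chan
  | tau => []
  | inp _ t _ b _ => (bindings b t).map Prod.fst
  | out _ t _ b _ => (bindings b t).map Prod.fst

end Label

/-- Abstract labels. -/
inductive ALabel (Chan : Type u) (Own : Type v)
  | tau
  /-- `(u, (r̃ : R̃) a?b)` with `r̃ : R̃` being `bindings b t` -/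
  | inp (u : Own) (t : Option ResType) (a b : Chan)
  /-- `((r̃) a!b, p)` with `r̃` being `b` if `bound = true`, and empty otherwise -/
  | out (bound : Bool) (a b : Chan) (p : Own)
  /-- fund transfer `ext(u, k, p)` -/
  | ext (u : Own) (k : ℕ) (p : Own)

namespace ALabel

variable {Chan : Type u} {Own : Type v} [DecidableEq Chan]

/-- The bound names `r̃` of an abstract label. -/
def bn : ALabel Chan Own → List Chan
  | tau => []
  | inp _ t _ b => (bindings b t).map Prod.fst
  | out bound _ b _ => if bound then [b] else []
  | ext _ _ _ => []

/-- All the channel names in an abstract label. -/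
def names : ALabel Chan Own → Finset Chan
  | tau => ∅
  | inp _ _ a b => {a, b}
  | out _ a b _ => {a, b}
  | ext _ _ _ => ∅

end ALabel

section Actions

variable {Chan : Type u} {Own : Type v} [DecidableEq Chan] [DecidableEq Own]

/-- The action semantics `Γ ▷ M --λ--> Δ ▷ N`. The freshness conditions are the usual ones on bound
names. -/
inductive Step : CostEnv Chan Own → Sys Chan Own 0 → Label Chan Own →
    CostEnv Chan Own → Sys Chan Own 0 → Prop
  | inp {Γ Δ : CostEnv Chan Own} {u o : Own} {a b : Chan} (P) : Γ.Charge u a o Δ → b ∈ Γ.dom →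
      Step Γ (.owned o (.inp (.chan a) P)) (.inp u none a b o) Δ (.owned o (P.inst b))
  | inpFresh {Γ Δ : CostEnv Chan Own} {u o : Own} {a b : Chan} (R : ResType) (P : Proc Chan 1 0) :
      Γ.Charge u a o Δ → b ∉ Γ.dom → b ∉ P.fn →
      Step Γ (.owned o (.inp (.chan a) P)) (.inp u (some R) a b o)
        (Δ.extend b R) (.owned o (P.inst b))
  | out {Γ Δ : CostEnv Chan Own} {o p : Own} {a b : Chan} (P) : Γ.Charge o a p Δ →
      Step Γ (.owned o (.out (.chan a) (.chan b) P)) (.out o none a b p) Δ (.owned o P)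
  | commL {Γ Δ : CostEnv Chan Own} {u p : Own} {t : Option ResType} {a b : Chan} {M M' N N'} :
      Δ.Fresh (bindings b t) →
      Step Γ M (.inp u t a b p) (Δ.extendAll (bindings b t)) M' →
      Step Γ N (.out u t a b p) (Δ.extendAll (bindings b t)) N' →
      Step Γ (.par M N) .tau Δ (.nus (bindings b t) (.par M' N'))
  | commR {Γ Δ : CostEnv Chan Own} {u p : Own} {t : Option ResType} {a b : Chan} {M M' N N'} :
      Δ.Fresh (bindings b t) →
      Step Γ M (.out u t a b p) (Δ.extendAll (bindings b t)) M' →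
      Step Γ N (.inp u t a b p) (Δ.extendAll (bindings b t)) N' →
      Step Γ (.par M N) .tau Δ (.nus (bindings b t) (.par M' N'))
  | opening {Γ Γ' : CostEnv Chan Own} {u p : Own} {a b : Chan} {R : ResType} {M : Sys Chan Own 1}
      {M'} : b ∉ M.fn → b ∉ Γ.dom → a ≠ b →
      Step (Γ.extend b R) (M.inst b) (.out u none a b p) Γ' M' →
      Step Γ (.new R M) (.out u (some R) a b p) Γ' M'
  | extrude (Γ) (o : Own) (R : ResType) (P) :
      Step Γ (.owned o (.new R P)) .tau Γ (.new R (.owned o P))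
  | split (Γ) (o : Own) (P Q) :
      Step Γ (.owned o (.par P Q)) .tau Γ (.par (.owned o P) (.owned o Q))
  | unwind (Γ) (o : Own) (T) : Step Γ (.owned o (.fix T)) .tau Γ (.owned o T.unfold)
  | eq (Γ) (o : Own) (a : Chan) (P Q) :
      Step Γ (.owned o (.cond (.chan a) (.chan a) P Q)) .tau Γ (.owned o P)
  | ne (Γ) (o : Own) {a b : Chan} (P Q) : a ≠ b →
      Step Γ (.owned o (.cond (.chan a) (.chan b) P Q)) .tau Γ (.owned o Q)
  | parL {Γ Γ' M M'} {l : Label Chan Own} (N : Sys Chan Own 0) : (∀ b ∈ l.bn, b ∉ N.fn) →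
      Step Γ M l Γ' M' → Step Γ (.par M N) l Γ' (.par M' N)
  | parR {Γ Γ' M M'} {l : Label Chan Own} (N : Sys Chan Own 0) : (∀ b ∈ l.bn, b ∉ N.fn) →
      Step Γ M l Γ' M' → Step Γ (.par N M) l Γ' (.par N M')
  | new {Γ Γ' : CostEnv Chan Own} {b : Chan} {R : ResType} {l : Label Chan Own}
      {M : Sys Chan Own 1} {M'} : b ∉ M.fn → b ∉ Γ.dom → b ∉ Γ'.dom → b ∉ l.names →
      Step (Γ.extend b R) (M.inst b) l (Γ'.extend b R) M' →
      Step Γ (.new R M) l Γ' (.nu b R M')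

/-- The abstract actions `C --μ-->_w D` relative to the set of owners `O`. -/
inductive AStep (O : Set Own) : CostEnv Chan Own × Sys Chan Own 0 → ALabel Chan Own → ℤ →
    CostEnv Chan Own × Sys Chan Own 0 → Prop
  | tau {Γ Δ M N} : Step Γ M .tau Δ N → AStep O (Γ, M) .tau (Δ.record - Γ.record) (Δ, N)
  | inp {Γ Δ M N} {u p : Own} {t : Option ResType} {a b : Chan} : u ∈ O →
      Step Γ M (.inp u t a b p) Δ N →
      AStep O (Γ, M) (.inp u t a b) (Δ.record - Γ.record) (Δ, N)
  | out {Γ Δ M N} {u p : Own} {t : Option ResType} {a b : Chan} : p ∈ O →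
      Step Γ M (.out u t a b p) Δ N →
      AStep O (Γ, M) (.out t.isSome a b p) (Δ.record - Γ.record) (Δ, N)
  | ext {Γ Δ : CostEnv Chan Own} (M) {u p : Own} {k : ℕ} : u ∈ O → p ∈ O →
      Γ.Transfer u k p Δ →
      AStep O (Γ, M) (.ext u k p) (Δ.record - Γ.record) (Δ, M)

/-- Weak moves `s ==μ==>_w s'` of a weighted labelled transition system with internal action
`tau`. -/
inductive Weak {S A : Type*} (tau : A) (step : S → A → ℤ → S → Prop) : S → A → ℤ → S → Prop
  | base {s μ w s'} : step s μ w s' → Weak tau step s μ w s'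
  | right {s μ w s'' z s'} : Weak tau step s μ w s'' → step s'' tau z s' →
      Weak tau step s μ (w + z) s'
  | left {s μ w s'' z s'} : step s tau w s'' → Weak tau step s'' μ z s' →
      Weak tau step s μ (w + z) s'

/-! ### Definability -/

/-- The cost-free resources `succ`, `fail` and `req`. -/
def testResources (succ fail req : Chan) : List (Chan × ResType) :=
  [(succ, ⟨0, 0⟩), (fail, ⟨0, 0⟩), (req, ⟨0, 0⟩)]

/-- `[succ!⟨r̃⟩]_o`. Communication is unary: when `r̃` is empty the name `succ` is sent as a
dummy value. -/
def success (succ : Chan) (rs : List (Chan × ResType)) (o : Own) : Sys Chan Own 0 :=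
  .owned o (.out (.chan succ) (.chan ((rs.map Prod.fst).headD succ)) .nil)

/-- The abstract label `μ` is definable relative to `O`. -/
def Definable (O : Set Own) (μ : ALabel Chan Own) : Prop :=
  ∀ succ fail req : Chan, [succ, fail, req].Nodup → (∀ r ∈ μ.bn, r ∉ [succ, fail, req]) →
  ∀ F : Finset Chan, ∃ (T : Sys Chan Own 0) (o : Own),
    T.owners ⊆ O ∧
    (∀ a ∈ T.fn, a ∈ F ∨ (a ∈ μ.names ∧ a ∉ μ.bn) ∨ a ∈ [succ, fail, req]) ∧
    ∀ (Γ : CostEnv Chan Own) (M : Sys Chan Own 0),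
      IsConfig Γ M → Γ.dom ⊆ (F : Set Chan) → Γ.Fresh (testResources succ fail req) →
      (∀ r ∈ μ.bn, r ∉ Γ.dom) →
      (∀ (Δ : CostEnv Chan Own) (rs : List (Chan × ResType)) (N : Sys Chan Own 0) (w : ℤ),
        rs.map Prod.fst = μ.bn → Δ.Fresh rs →
        Weak .tau (AStep O) (Γ, M) μ w (Δ.extendAll rs, N) →
        o ∈ O ∧ Δ.Fresh (testResources succ fail req) ∧
        ∃ M' : Sys Chan Own 0,
          Weak .tau (AStep O) (Γ.extendAll (testResources succ fail req), .par M T) .tau w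
            (Δ.extendAll (testResources succ fail req), M') ∧
          Struct M' (.nus rs (.par (success succ rs o) N)) ∧
          BarbOut (Δ.extendAll (testResources succ fail req)) M' succ ∧
          ¬ BarbOut (Δ.extendAll (testResources succ fail req)) M' fail) ∧
      (∀ (E : CostEnv Chan Own) (M' : Sys Chan Own 0) (w : ℤ),
        Weak .tau (AStep O) (Γ.extendAll (testResources succ fail req), .par M T) .tau w (E, M') →
        BarbOut E M' succ → ¬ BarbOut E M' fail →
        o ∈ O ∧ ∃ (Δ : CostEnv Chan Own) (rs : List (Chan × ResType)) (N : Sys Chan Own 0),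
          rs.map Prod.fst = μ.bn ∧ Δ.Fresh rs ∧ Δ.Fresh (testResources succ fail req) ∧
          E = Δ.extendAll (testResources succ fail req) ∧
          Struct M' (.nus rs (.par (success succ rs o) N)) ∧
          Weak .tau (AStep O) (Γ, M) μ w (Δ.extendAll rs, N))

end Actions

end Picost

open Picost

/-!
The test for an abstract action `μ` consists of an output on `fail`, which announces failure, in
parallel with code that performs the action complementary to `μ`, checks the value it has received
(if any), and then consumes the output on `fail` and sends the outcome on `succ`. The names `succ`
and `fail` are free of charge and unknown to the system `M` under test. The complementary action is
* for an output on `a`, the reception of a name on `a`, which is then compared with the name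
  expected, or with all names in `F` if a fresh one is expected;
* for an input on `a`, the transmission on `a` of the name in question, or of a private name;
* for a transfer of `k`, a communication on a private resource of type `(k, 0)`.

By `Step.transfer`, actions are invariant under permutations of names and do not depend on
resources that are not free in the system. Hence the actions of `M` under `Γ` and under `Γᵗ`
correspond to each other (`Admissible.weaken`, `Admissible.strengthen`), bound names can be chosen
at will (`Step.rename_bound`), and an internal action under a restriction is one under the extended
environment (`Step.nus`, `Step.nus_inv`). As weights are differences of records, the weight of a
weak action depends only on its end points (`weak_iff`).

If `M` performs `μ`, the test does the complementary action and then runs to completion free of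
charge. Nothing is left that knows `fail`, so that only the barb on `succ` remains
(`IsTest.success_of_weak`). Conversely, consider a run of `M | T` that ends with a barb on `succ`
but with none on `fail` (`IsTest.weak_of_success`). The output on `fail` disappears only if the test
has run to completion, and to this end it must have taken part in an action `μ`. As long as the
output on `fail` is present, it is a barb, unless the funds of its owner `o` are undefined. But then
`o` cannot use or provide any resource, and `succ`, which occurs only below prefixes of `o`, never
becomes observable. This is the invariant `Sys.Frozen`, which reductions and structural equivalence
preserve.

When the owner of `μ` is not in `O`, or a free name of `μ` cannot belong to the domain of an
environment under consideration, no system under test performs `μ`, and the inert test defines it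
(`definable_of_impossible`).
-/

namespace Picost

universe u v

/-! ### Renaming in code and systems -/

namespace Ident

variable {Chan : Type u} {n n' n'' : ℕ}

/-- Rename the channel names of an identifier. -/
def ren (σ : Chan → Chan) : Ident Chan n → Ident Chan n
  | chan c => chan (σ c)
  | var i => var i

@[simp] theorem ren_chan (σ : Chan → Chan) (c : Chan) :
    ren σ (chan c : Ident Chan n) = chan (σ c) := rfl

@[simp] theorem ren_var (σ : Chan → Chan) (i : Fin n) : ren σ (var i) = var i := rfl

@[simp] theorem lift_shift (f : Ident Chan n → Ident Chan n') (x : Ident Chan n) :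
    lift f (shift x) = shift (f x) := by
  cases x <;> rfl

theorem lift_comp_shift (f : Ident Chan n → Ident Chan n') :
    lift f ∘ shift = shift ∘ f := funext (lift_shift f)

theorem lift_comp (g : Ident Chan n' → Ident Chan n'') (f : Ident Chan n → Ident Chan n') :
    lift g ∘ lift f = lift (g ∘ f) := by
  funext x
  cases x with
  | chan c => exact lift_shift g (f (chan c))
  | var i =>
    cases i using Fin.cases with
    | zero => rfl
    | succ j => exact lift_shift g (f (var j))

theorem lift_id : lift (id : Ident Chan n → Ident Chan n) = id := by
  funext x
  cases x with
  | chan c => rfl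
  | var i => cases i using Fin.cases <;> rfl

theorem lift_ren (σ : Chan → Chan) : lift (ren σ : Ident Chan n → _) = ren σ := by
  funext x
  cases x with
  | chan c => rfl
  | var i => cases i using Fin.cases <;> rfl

theorem names_shift (x : Ident Chan n) : (shift x).names = x.names := by
  cases x <;> rfl

end Ident

namespace Proc

variable {Chan : Type u}

theorem map_map {n m : ℕ} (P : Proc Chan n m) : ∀ {n' n'' : ℕ} (f : Ident Chan n → Ident Chan n')
    (g : Ident Chan n' → Ident Chan n''), (P.map f).map g = P.map (g ∘ f) := by
  induction P with
  | nil => intros; rfl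
  | inp a T ih => intro n' n'' f g; simp [map, ih, Ident.lift_comp]
  | out a w T ih => intro n' n'' f g; simp [map, ih]
  | cond w w' T U ih1 ih2 => intro n' n'' f g; simp [map, ih1, ih2]
  | new R T ih => intro n' n'' f g; simp [map, ih, Ident.lift_comp]
  | par T U ih1 ih2 => intro n' n'' f g; simp [map, ih1, ih2]
  | fix T ih => intro n' n'' f g; simp [map, ih]
  | rvar X => intros; rfl

theorem map_renRec {n m : ℕ} (P : Proc Chan n m) : ∀ {n' m' : ℕ} (f : Ident Chan n → Ident Chan n')
    (g : Fin m → Fin m'), (P.renRec g).map f = (P.map f).renRec g := by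
  induction P with
  | nil => intros; rfl
  | inp a T ih => intro n' m' f g; simp [map, renRec, ih]
  | out a w T ih => intro n' m' f g; simp [map, renRec, ih]
  | cond w w' T U ih1 ih2 => intro n' m' f g; simp [map, renRec, ih1, ih2]
  | new R T ih => intro n' m' f g; simp [map, renRec, ih]
  | par T U ih1 ih2 => intro n' m' f g; simp [map, renRec, ih1, ih2]
  | fix T ih => intro n' m' f g; simp [map, renRec, ih]
  | rvar X => intros; rfl

theorem map_substRec {n m : ℕ} (P : Proc Chan n m) :
    ∀ {n' m' : ℕ} (f : Ident Chan n → Ident Chan n') (s : Fin m → Proc Chan n m'),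
      (P.substRec s).map f = (P.map f).substRec (fun i => (s i).map f) := by
  induction P with
  | nil => intros; rfl
  | inp a T ih => intro n' m' f s; simp [map, substRec, ih, map_map, Ident.lift_comp_shift]
  | out a w T ih => intro n' m' f s; simp [map, substRec, ih]
  | cond w w' T U ih1 ih2 => intro n' m' f s; simp [map, substRec, ih1, ih2]
  | new R T ih => intro n' m' f s; simp [map, substRec, ih, map_map, Ident.lift_comp_shift]
  | par T U ih1 ih2 => intro n' m' f s; simp [map, substRec, ih1, ih2]
  | fix T ih =>
    intro n' m' f s
    simp only [map, substRec, ih]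
    congr 2
    funext i
    cases i using Fin.cases <;> simp [map, map_renRec]
  | rvar X => intros; rfl

theorem map_unfold {n n' : ℕ} (f : Ident Chan n → Ident Chan n') (T : Proc Chan n 1) :
    T.unfold.map f = (T.map f).unfold := by
  simp [unfold, map_substRec, map]

/-- The effect of a renaming depends only on its values at the free names and at the variables. -/
theorem map_congr [DecidableEq Chan] {n m : ℕ} (P : Proc Chan n m) :
    ∀ {n' : ℕ} {f g : Ident Chan n → Ident Chan n'}, (∀ c ∈ P.fn, f (.chan c) = g (.chan c)) →
      (∀ i, f (.var i) = g (.var i)) → P.map f = P.map g := by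
  have key : ∀ {n n' : ℕ} {f g : Ident Chan n → Ident Chan n'} (x : Ident Chan n),
      (∀ c ∈ x.names, f (.chan c) = g (.chan c)) → (∀ i, f (.var i) = g (.var i)) →
      f x = g x := by
    intro n n' f g x h1 h2
    cases x with
    | chan c => exact h1 c (by simp [Ident.names])
    | var i => exact h2 i
  have keyl : ∀ {n n' : ℕ} {f g : Ident Chan n → Ident Chan n'},
      (∀ i, f (.var i) = g (.var i)) → ∀ i, Ident.lift f (.var i) = Ident.lift g (.var i) := by
    intro n n' f g h i
    cases i using Fin.cases <;> simp [Ident.lift, h]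
  induction P with
  | nil => intros; rfl
  | inp a T ih =>
    intro n' f g h1 h2
    simp only [map, fn, Finset.mem_union] at h1 ⊢
    rw [key a (fun c hc => h1 c (Or.inl hc)) h2,
      ih (f := Ident.lift f) (g := Ident.lift g)
        (fun c hc => by simp [Ident.lift, h1 c (Or.inr hc)]) (keyl h2)]
  | out a w T ih =>
    intro n' f g h1 h2
    simp only [map, fn, Finset.mem_union] at h1 ⊢
    rw [key a (fun c hc => h1 c (by tauto)) h2, key w (fun c hc => h1 c (by tauto)) h2,
      ih (fun c hc => h1 c (by tauto)) h2]
  | cond w w' T U ih1 ih2 =>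
    intro n' f g h1 h2
    simp only [map, fn, Finset.mem_union] at h1 ⊢
    rw [key w (fun c hc => h1 c (by tauto)) h2, key w' (fun c hc => h1 c (by tauto)) h2,
      ih1 (fun c hc => h1 c (by tauto)) h2, ih2 (fun c hc => h1 c (by tauto)) h2]
  | new R T ih =>
    intro n' f g h1 h2
    simp only [map, fn] at h1 ⊢
    rw [ih (f := Ident.lift f) (g := Ident.lift g) (fun c hc => by simp [Ident.lift, h1 c hc])
        (keyl h2)]
  | par T U ih1 ih2 =>
    intro n' f g h1 h2
    simp only [map, fn, Finset.mem_union] at h1 ⊢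
    rw [ih1 (fun c hc => h1 c (by tauto)) h2, ih2 (fun c hc => h1 c (by tauto)) h2]
  | fix T ih =>
    intro n' f g h1 h2
    simp only [map, fn] at h1 ⊢
    rw [ih h1 h2]
  | rvar X => intros; rfl

theorem map_id {n m : ℕ} (P : Proc Chan n m) : P.map id = P := by
  induction P <;> simp_all [map, Ident.lift_id]

theorem ren_inst (σ : Chan → Chan) (b : Chan) (P : Proc Chan 1 0) :
    (P.inst b).map (Ident.ren σ) = (P.map (Ident.ren σ)).inst (σ b) := by
  simp only [inst, map_map]
  congr 1
  funext x
  cases x <;> rfl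

variable [DecidableEq Chan]

theorem mem_fn_map {n m : ℕ} (P : Proc Chan n m) : ∀ {n' : ℕ} {f : Ident Chan n → Ident Chan n'}
    {c : Chan}, c ∈ (P.map f).fn →
      (∃ d ∈ P.fn, c ∈ (f (.chan d)).names) ∨ ∃ i, c ∈ (f (.var i)).names := by
  have key : ∀ {n n' : ℕ} {f : Ident Chan n → Ident Chan n'} {c : Chan} (x : Ident Chan n),
      c ∈ (f x).names → (∃ d ∈ x.names, c ∈ (f (.chan d)).names) ∨
        ∃ i, c ∈ (f (.var i)).names := by
    intro n n' f c x h
    cases x with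
    | chan d => exact Or.inl ⟨d, by simp [Ident.names], h⟩
    | var i => exact Or.inr ⟨i, h⟩
  have keyl : ∀ {n n' : ℕ} {f : Ident Chan n → Ident Chan n'} {c : Chan} {S : Finset Chan},
      ((∃ d ∈ S, c ∈ (Ident.lift f (.chan d)).names) ∨ ∃ i, c ∈ (Ident.lift f (.var i)).names) →
      ((∃ d ∈ S, c ∈ (f (.chan d)).names) ∨ ∃ i, c ∈ (f (.var i)).names) := by
    rintro n n' f c S (⟨d, hd, h⟩ | ⟨i, h⟩)
    · exact Or.inl ⟨d, hd, by simpa [Ident.lift, Ident.names_shift] using h⟩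
    · cases i using Fin.cases with
      | zero => simp [Ident.lift, Ident.names] at h
      | succ j => exact Or.inr ⟨j, by simpa [Ident.lift, Ident.names_shift] using h⟩
  induction P with
  | nil => intro n' f c h; simp [map, fn] at h
  | inp a T ih =>
    intro n' f c h
    simp only [map, fn, Finset.mem_union] at h ⊢
    rcases h with h | h
    · have := key a h
      grind
    · have := keyl (ih h)
      grind
  | out a w T ih =>
    intro n' f c h
    simp only [map, fn, Finset.mem_union] at h ⊢
    rcases h with (h | h) | h
    · have := key a h
      grind
    · have := key w h
      grind
    · have := ih h
      grind
  | cond w w' T U ih1 ih2 =>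
    intro n' f c h
    simp only [map, fn, Finset.mem_union] at h ⊢
    rcases h with ((h | h) | h) | h
    · have := key w h
      grind
    · have := key w' h
      grind
    · have := ih1 h
      grind
    · have := ih2 h
      grind
  | new R T ih =>
    intro n' f c h
    exact keyl (ih h)
  | par T U ih1 ih2 =>
    intro n' f c h
    simp only [map, fn, Finset.mem_union] at h ⊢
    rcases h with h | h
    · have := ih1 h
      grind
    · have := ih2 h
      grind
  | fix T ih => intro n' f c h; exact ih h
  | rvar X => intro n' f c h; simp [map, fn] at h

theorem mem_fn_map_of_mem {n m : ℕ} (P : Proc Chan n m) :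
    ∀ {n' : ℕ} {f : Ident Chan n → Ident Chan n'} {c d : Chan}, d ∈ P.fn →
      c ∈ (f (.chan d)).names → c ∈ (P.map f).fn := by
  have key : ∀ {n n' : ℕ} {f : Ident Chan n → Ident Chan n'} {c d : Chan} (x : Ident Chan n),
      d ∈ x.names → c ∈ (f (.chan d)).names → c ∈ (f x).names := by
    intro n n' f c d x h hc
    cases x with
    | chan e => simp only [Ident.names, Finset.mem_singleton] at h; subst h; exact hc
    | var i => simp [Ident.names] at h
  induction P with
  | nil => intro n' f c d h; simp [fn] at h
  | inp a T ih =>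
    intro n' f c d h hc
    simp only [map, fn, Finset.mem_union] at h ⊢
    rcases h with h | h
    · exact Or.inl (key a h hc)
    · exact Or.inr (ih h (by simpa [Ident.lift, Ident.names_shift] using hc))
  | out a w T ih =>
    intro n' f c d h hc
    simp only [map, fn, Finset.mem_union] at h ⊢
    exact h.imp (Or.imp (key a · hc) (key w · hc)) (ih · hc)
  | cond w w' T U ih1 ih2 =>
    intro n' f c d h hc
    simp only [map, fn, Finset.mem_union] at h ⊢
    exact h.imp (Or.imp (Or.imp (key w · hc) (key w' · hc)) (ih1 · hc)) (ih2 · hc)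
  | new R T ih =>
    intro n' f c d h hc
    exact ih h (by simpa [Ident.lift, Ident.names_shift] using hc)
  | par T U ih1 ih2 =>
    intro n' f c d h hc
    simp only [map, fn, Finset.mem_union] at h ⊢
    exact h.imp (ih1 · hc) (ih2 · hc)
  | fix T ih => intro n' f c d h hc; exact ih h hc
  | rvar X => intro n' f c d h; simp [fn] at h

theorem fn_renRec {n m : ℕ} (P : Proc Chan n m) : ∀ {m' : ℕ} (g : Fin m → Fin m'),
    (P.renRec g).fn = P.fn := by
  induction P <;> simp_all [renRec, fn]

theorem fn_map_shift {n m : ℕ} (P : Proc Chan n m) : (P.map Ident.shift).fn = P.fn := by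
  ext c
  constructor
  · intro h
    rcases mem_fn_map P h with ⟨d, hd, h⟩ | ⟨i, h⟩
    · simp only [Ident.shift, Ident.names, Finset.mem_singleton] at h
      exact h ▸ hd
    · simp [Ident.shift, Ident.names] at h
  · intro h
    exact mem_fn_map_of_mem P h (by simp [Ident.shift, Ident.names])

theorem mem_fn_substRec {n m : ℕ} (P : Proc Chan n m) : ∀ {m' : ℕ} {s : Fin m → Proc Chan n m'}
    {c : Chan}, c ∈ (P.substRec s).fn → c ∈ P.fn ∨ ∃ i, c ∈ (s i).fn := by
  induction P with
  | nil => intro m' s c h; simp [substRec, fn] at h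
  | inp a T ih =>
    intro m' s c h
    simp only [substRec, fn, Finset.mem_union] at h ⊢
    rcases h with h | h
    · exact Or.inl (Or.inl h)
    · have := ih h
      simp only [fn_map_shift] at this
      tauto
  | out a w T ih =>
    intro m' s c h
    simp only [substRec, fn, Finset.mem_union] at h ⊢
    rcases h with h | h
    · exact Or.inl (Or.inl h)
    · have := ih h
      tauto
  | cond w w' T U ih1 ih2 =>
    intro m' s c h
    simp only [substRec, fn, Finset.mem_union] at h ⊢
    rcases h with (h | h) | h
    · tauto
    · have := ih1 h
      tauto
    · have := ih2 h
      tauto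
  | new R T ih =>
    intro m' s c h
    simp only [substRec, fn] at h ⊢
    have := ih h
    simpa only [fn_map_shift] using this
  | par T U ih1 ih2 =>
    intro m' s c h
    simp only [substRec, fn, Finset.mem_union] at h ⊢
    rcases h with h | h
    · have := ih1 h
      tauto
    · have := ih2 h
      tauto
  | fix T ih =>
    intro m' s c h
    simp only [substRec, fn] at h ⊢
    rcases ih h with h | ⟨i, h⟩
    · exact Or.inl h
    · cases i using Fin.cases with
      | zero => simp [fn] at h
      | succ j => exact Or.inr ⟨j, by simpa [fn_renRec] using h⟩
  | rvar X => intro m' s c h; exact Or.inr ⟨X, h⟩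

theorem fn_unfold_subset {n : ℕ} (T : Proc Chan n 1) : T.unfold.fn ⊆ T.fn := by
  intro c h
  rcases mem_fn_substRec T h with h | ⟨_, h⟩
  · exact h
  · exact h

theorem fn_inst_subset (b : Chan) (P : Proc Chan 1 0) : (P.inst b).fn ⊆ insert b P.fn := by
  intro c h
  rcases mem_fn_map P h with ⟨d, hd, h⟩ | ⟨_, h⟩
  · simp only [Ident.inst, Ident.names, Finset.mem_singleton] at h
    exact Finset.mem_insert_of_mem (h ▸ hd)
  · simp only [Ident.inst, Ident.names, Finset.mem_singleton] at h
    exact h ▸ Finset.mem_insert_self _ _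

theorem mem_fn_ren {n m : ℕ} {σ : Chan → Chan} (P : Proc Chan n m) {c : Chan} :
    c ∈ (P.map (Ident.ren σ)).fn ↔ ∃ d ∈ P.fn, σ d = c := by
  constructor
  · intro h
    rcases mem_fn_map P h with ⟨d, hd, h⟩ | ⟨_, h⟩
    · simp only [Ident.ren, Ident.names, Finset.mem_singleton] at h
      exact ⟨d, hd, h.symm⟩
    · simp [Ident.ren, Ident.names] at h
  · rintro ⟨d, hd, rfl⟩
    exact mem_fn_map_of_mem P hd (by simp [Ident.ren, Ident.names])

end Proc

namespace Sys

variable {Chan : Type u} {Own : Type v}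

theorem map_map {n : ℕ} (M : Sys Chan Own n) : ∀ {n' n'' : ℕ} (f : Ident Chan n → Ident Chan n')
    (g : Ident Chan n' → Ident Chan n''), (M.map f).map g = M.map (g ∘ f) := by
  induction M with
  | owned o T => intro n' n'' f g; simp [map, Proc.map_map]
  | par M N ih1 ih2 => intro n' n'' f g; simp [map, ih1, ih2]
  | new R M ih => intro n' n'' f g; simp [map, ih, Ident.lift_comp]
  | zero => intros; rfl

theorem map_id {n : ℕ} (M : Sys Chan Own n) : M.map id = M := by
  induction M <;> simp_all [map, Ident.lift_id, Proc.map_id]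

/-- The action of a renaming of channel names on systems. -/
def ren {n : ℕ} (σ : Chan → Chan) (M : Sys Chan Own n) : Sys Chan Own n :=
  M.map (Ident.ren σ)

theorem ren_new {n : ℕ} (σ : Chan → Chan) (R : ResType) (M : Sys Chan Own (n + 1)) :
    (new R M).ren σ = new R (M.ren σ) := by
  simp [ren, map, Ident.lift_ren]

theorem ren_ren {n : ℕ} (σ τ : Chan → Chan) (M : Sys Chan Own n) :
    (M.ren σ).ren τ = M.ren (τ ∘ σ) := by
  simp only [ren, map_map]
  congr 1
  funext x
  cases x <;> rfl

theorem ren_id {n : ℕ} {M : Sys Chan Own n} : M.ren id = M := by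
  have : (Ident.ren id : Ident Chan n → Ident Chan n) = id := by
    funext x
    cases x <;> rfl
  rw [ren, this, map_id]

theorem ren_inst (σ : Chan → Chan) (b : Chan) (M : Sys Chan Own 1) :
    (M.inst b).ren σ = (M.ren σ).inst (σ b) := by
  simp only [inst, ren, map_map]
  congr 1
  funext x
  cases x <;> rfl

variable [DecidableEq Chan]

theorem map_congr {n : ℕ} (M : Sys Chan Own n) : ∀ {n' : ℕ} {f g : Ident Chan n → Ident Chan n'},
    (∀ c ∈ M.fn, f (.chan c) = g (.chan c)) → (∀ i, f (.var i) = g (.var i)) →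
      M.map f = M.map g := by
  induction M with
  | owned o T => intro n' f g h1 h2; simp only [map]; rw [Proc.map_congr T h1 h2]
  | par M N ih1 ih2 =>
    intro n' f g h1 h2
    simp only [map, fn, Finset.mem_union] at h1 ⊢
    rw [ih1 (fun c hc => h1 c (Or.inl hc)) h2, ih2 (fun c hc => h1 c (Or.inr hc)) h2]
  | new R M ih =>
    intro n' f g h1 h2
    simp only [map, fn] at h1 ⊢
    rw [ih (f := Ident.lift f) (g := Ident.lift g) (fun c hc => by simp [Ident.lift, h1 c hc])]
    intro i
    cases i using Fin.cases <;> simp [Ident.lift, h2]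
  | zero => intros; rfl

theorem mem_fn_map {n : ℕ} (M : Sys Chan Own n) : ∀ {n' : ℕ} {f : Ident Chan n → Ident Chan n'}
    {c : Chan}, c ∈ (M.map f).fn →
      (∃ d ∈ M.fn, c ∈ (f (.chan d)).names) ∨ ∃ i, c ∈ (f (.var i)).names := by
  induction M with
  | owned o T => intro n' f c h; exact Proc.mem_fn_map T h
  | par M N ih1 ih2 =>
    intro n' f c h
    simp only [map, fn, Finset.mem_union] at h ⊢
    rcases h with h | h
    · have := ih1 h
      grind
    · have := ih2 h
      grind
  | new R M ih =>
    intro n' f c h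
    rcases ih h with ⟨d, hd, h⟩ | ⟨i, h⟩
    · exact Or.inl ⟨d, hd, by simpa [Ident.lift, Ident.names_shift] using h⟩
    · cases i using Fin.cases with
      | zero => simp [Ident.lift, Ident.names] at h
      | succ j => exact Or.inr ⟨j, by simpa [Ident.lift, Ident.names_shift] using h⟩
  | zero => intro n' f c h; simp [map, fn] at h

theorem mem_fn_map_of_mem {n : ℕ} (M : Sys Chan Own n) :
    ∀ {n' : ℕ} {f : Ident Chan n → Ident Chan n'} {c d : Chan}, d ∈ M.fn →
      c ∈ (f (.chan d)).names → c ∈ (M.map f).fn := by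
  induction M with
  | owned o T => intro n' f c d h hc; exact Proc.mem_fn_map_of_mem T h hc
  | par M N ih1 ih2 =>
    intro n' f c d h hc
    simp only [map, fn, Finset.mem_union] at h ⊢
    exact h.imp (ih1 · hc) (ih2 · hc)
  | new R M ih =>
    intro n' f c d h hc
    exact ih h (by simpa [Ident.lift, Ident.names_shift] using hc)
  | zero => intro n' f c d h; simp [fn] at h

theorem fn_inst_subset (b : Chan) (M : Sys Chan Own 1) : (M.inst b).fn ⊆ insert b M.fn := by
  intro c h
  rcases mem_fn_map M h with ⟨d, hd, h⟩ | ⟨_, h⟩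
  · simp only [Ident.inst, Ident.names, Finset.mem_singleton] at h
    exact Finset.mem_insert_of_mem (h ▸ hd)
  · simp only [Ident.inst, Ident.names, Finset.mem_singleton] at h
    exact h ▸ Finset.mem_insert_self _ _

theorem fn_subset_fn_inst (b : Chan) (M : Sys Chan Own 1) : M.fn ⊆ (M.inst b).fn := fun _ h =>
  mem_fn_map_of_mem M h (by simp [Ident.inst, Ident.names])

theorem mem_fn_nu {b c : Chan} {R : ResType} {M : Sys Chan Own 0} :
    c ∈ (nu b R M).fn ↔ c ≠ b ∧ c ∈ M.fn := by
  constructor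
  · intro h
    rcases mem_fn_map M h with ⟨d, hd, h⟩ | ⟨i, _⟩
    · simp only [Ident.bind] at h
      split_ifs at h with hdb
      · simp [Ident.names] at h
      · simp only [Ident.names, Finset.mem_singleton] at h
        exact h ▸ ⟨hdb, hd⟩
    · exact i.elim0
  · rintro ⟨h1, h2⟩
    exact mem_fn_map_of_mem M h2 (by simp [Ident.bind, Ident.names, h1])

theorem mem_fn_ren {n : ℕ} {σ : Chan → Chan} {M : Sys Chan Own n} {c : Chan} :
    c ∈ (M.ren σ).fn ↔ ∃ d ∈ M.fn, σ d = c := by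
  constructor
  · intro h
    rcases mem_fn_map M h with ⟨d, hd, h⟩ | ⟨_, h⟩
    · simp only [Ident.ren, Ident.names, Finset.mem_singleton] at h
      exact ⟨d, hd, h.symm⟩
    · simp [Ident.ren, Ident.names] at h
  · rintro ⟨d, hd, rfl⟩
    exact mem_fn_map_of_mem M hd (by simp [Ident.ren, Ident.names])

theorem ren_congr {n : ℕ} {σ τ : Chan → Chan} {M : Sys Chan Own n} (h : ∀ c ∈ M.fn, σ c = τ c) :
    M.ren σ = M.ren τ :=
  map_congr M (fun c hc => by simp [h c hc]) (fun _ => rfl)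

theorem ren_eq_self {n : ℕ} {σ : Chan → Chan} {M : Sys Chan Own n} (h : ∀ c ∈ M.fn, σ c = c) :
    M.ren σ = M := by
  rw [ren_congr (τ := id) h, ren_id]

theorem ren_nu {σ : Chan → Chan} (hσ : Function.Injective σ) (b : Chan) (R : ResType)
    (M : Sys Chan Own 0) : (nu b R M).ren σ = nu (σ b) R (M.ren σ) := by
  simp only [nu, ren, map, map_map, Ident.lift_ren]
  congr 1
  apply map_congr
  · intro c _
    by_cases h : c = b
    · simp [Ident.bind, h]
    · simp [Ident.bind, h, hσ.ne h]
  · exact fun i => i.elim0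

theorem map_bind_inst (b : Chan) (M : Sys Chan Own 0) : (M.map (Ident.bind b)).inst b = M := by
  conv_rhs => rw [← map_id M]
  rw [inst, map_map]
  congr 1
  funext x
  cases x with
  | chan c => by_cases h : c = b <;> simp [Ident.bind, Ident.inst, h]
  | var i => exact i.elim0

theorem map_bind_inst_swap {b c : Chan} {M : Sys Chan Own 0} (h : c ∉ M.fn ∨ c = b) :
    (M.map (Ident.bind b)).inst c = M.ren (Equiv.swap b c) := by
  rw [inst, ren, map_map]
  apply map_congr
  · intro d hd
    by_cases hdb : d = b
    · subst hdb
      simp [Ident.bind, Ident.inst]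
    · have hdc : d ≠ c := by
        rcases h with h | h
        · exact fun e => h (e ▸ hd)
        · exact h ▸ hdb
      simp [Ident.bind, Ident.inst, hdb, Equiv.swap_apply_of_ne_of_ne hdb hdc]
  · exact fun i => i.elim0

/-- Renaming the bound name of a restriction. -/
theorem nu_ren_swap {b c : Chan} {R : ResType} {M : Sys Chan Own 0} (h : c ∉ M.fn) :
    nu c R (M.ren (Equiv.swap b c)) = nu b R M := by
  rw [nu, nu, ren, map_map]
  congr 1
  apply map_congr
  · intro d hd
    have hdc : d ≠ c := fun e => h (e ▸ hd)
    by_cases hdb : d = b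
    · subst hdb
      simp [Ident.bind]
    · simp [Ident.bind, hdb, hdc, Equiv.swap_apply_of_ne_of_ne hdb hdc]
  · exact fun i => i.elim0

end Sys

/-! ### Cost environments and labels -/

namespace CostEnv

variable {Chan : Type u} {Own : Type v}

theorem ext_fields {Γ Δ : CostEnv Chan Own} (h1 : Γ.res = Δ.res) (h2 : Γ.funds = Δ.funds)
    (h3 : Γ.record = Δ.record) : Γ = Δ := by
  cases Γ
  cases Δ
  cases h1
  cases h2
  cases h3
  rfl

theorem not_mem_dom {Γ : CostEnv Chan Own} {a : Chan} : a ∉ Γ.dom ↔ Γ.res a = none := by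
  simp [dom]

theorem mem_dom_congr {Γ Δ : CostEnv Chan Own} {a b : Chan} (h : Γ.res a = Δ.res b) :
    a ∈ Γ.dom ↔ b ∈ Δ.dom := by
  simp [dom, h]

theorem dom_congr {Γ Δ : CostEnv Chan Own} (h : Γ.res = Δ.res) : Γ.dom = Δ.dom := by
  simp [dom, h]

theorem exists_fresh [Infinite Chan] (Γ : CostEnv Chan Own) (S : Finset Chan) :
    ∃ c, c ∉ S ∧ c ∉ Γ.dom := by
  classical
  obtain ⟨c, hc⟩ := Infinite.exists_notMem_finset (S ∪ Γ.finite_res.toFinset)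
  exact ⟨c, fun h => hc (by simp [h]),
    fun h => hc (Finset.mem_union_right _ (Γ.finite_res.mem_toFinset.2 h))⟩

/-- `Γ` with the funds and the record of `E`. -/
def withFunds (Γ E : CostEnv Chan Own) : CostEnv Chan Own :=
  { Γ with funds := E.funds, record := E.record }

@[simp] theorem withFunds_res (Γ E : CostEnv Chan Own) : (Γ.withFunds E).res = Γ.res := rfl
@[simp] theorem withFunds_funds (Γ E : CostEnv Chan Own) : (Γ.withFunds E).funds = E.funds := rfl
@[simp] theorem withFunds_record (Γ E : CostEnv Chan Own) : (Γ.withFunds E).record = E.record := rfl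

section

variable [DecidableEq Own]

theorem moveFunds_isSome (f : Own → Option ℕ∞) (u p : Own) (k l : ℕ) (o : Own) :
    (moveFunds f u p k l o).isSome = (f o).isSome := by
  by_cases h1 : o = p <;> by_cases h2 : o = u <;> by_cases h3 : p = u <;>
    simp_all [moveFunds, Function.update]

theorem moveFunds_zero (f : Own → Option ℕ∞) (u p : Own) : moveFunds f u p 0 0 = f := by
  funext o
  by_cases h1 : o = p <;> by_cases h2 : o = u <;> by_cases h3 : p = u <;>
    simp_all [moveFunds, Function.update]

/-- The use of a cost-free resource changes nothing. -/
theorem charge_free {Γ : CostEnv Chan Own} {u p : Own} {a : Chan} (ha : Γ.res a = some ⟨0, 0⟩)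
    (hu : (Γ.funds u).isSome) (hp : (Γ.funds p).isSome) : Γ.Charge u a p Γ := by
  obtain ⟨x, hx⟩ := Option.isSome_iff_exists.1 hu
  obtain ⟨y, hy⟩ := Option.isSome_iff_exists.1 hp
  refine ⟨⟨0, 0⟩, x, y, ha, hx, hy, by simp, by simp, ext_fields rfl ?_ ?_⟩
  · simp [moveFunds_zero]
  · simp

theorem Charge.eq_of_free {Γ Δ : CostEnv Chan Own} {u p : Own} {a : Chan}
    (ha : Γ.res a = some ⟨0, 0⟩) (h : Γ.Charge u a p Δ) : Δ = Γ := by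
  obtain ⟨R, x, y, h1, h2, h3, h4, h5, rfl⟩ := h
  rw [ha] at h1
  cases h1
  exact ext_fields rfl (by simp [moveFunds_zero]) (by simp)

theorem Charge.res_eq {Γ Δ : CostEnv Chan Own} {u p : Own} {a : Chan} (h : Γ.Charge u a p Δ) :
    Δ.res = Γ.res := by
  obtain ⟨R, x, y, h1, h2, h3, h4, h5, rfl⟩ := h
  rfl

theorem Charge.mem_dom {Γ Δ : CostEnv Chan Own} {u p : Own} {a : Chan} (h : Γ.Charge u a p Δ) :
    a ∈ Γ.dom := by
  obtain ⟨R, x, y, h1, h2, h3, h4, h5, rfl⟩ := h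
  simp [dom, h1]

theorem Charge.funds_isSome {Γ Δ : CostEnv Chan Own} {u p : Own} {a : Chan}
    (h : Γ.Charge u a p Δ) (o : Own) : (Δ.funds o).isSome = (Γ.funds o).isSome := by
  obtain ⟨R, x, y, h1, h2, h3, h4, h5, rfl⟩ := h
  exact moveFunds_isSome _ _ _ _ _ _

theorem Charge.user_isSome {Γ Δ : CostEnv Chan Own} {u p : Own} {a : Chan}
    (h : Γ.Charge u a p Δ) : (Γ.funds u).isSome := by
  obtain ⟨R, x, y, h1, h2, h3, h4, h5, rfl⟩ := h
  simp [h2]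

theorem Charge.provider_isSome {Γ Δ : CostEnv Chan Own} {u p : Own} {a : Chan}
    (h : Γ.Charge u a p Δ) : (Γ.funds p).isSome := by
  obtain ⟨R, x, y, h1, h2, h3, h4, h5, rfl⟩ := h
  simp [h3]

/-- Charging for `a` looks only at the funds, the record and the costs of `a`. -/
theorem Charge.congr {Γ Δ Γ' Δ' : CostEnv Chan Own} {u p : Own} {a a' : Chan}
    (h : Γ.Charge u a p Δ) (hr : Γ'.res a' = Γ.res a) (hf : Γ'.funds = Γ.funds)
    (hc : Γ'.record = Γ.record) (hr' : Δ'.res = Γ'.res) (hf' : Δ'.funds = Δ.funds)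
    (hc' : Δ'.record = Δ.record) : Γ'.Charge u a' p Δ' := by
  obtain ⟨R, x, y, h1, h2, h3, h4, h5, rfl⟩ := h
  refine ⟨R, x, y, hr.trans h1, hf ▸ h2, hf ▸ h3, h4, h5, ext_fields hr' ?_ ?_⟩
  · rw [hf', hf]
  · rw [hc', hc]

end

variable [DecidableEq Chan]

theorem extend_res (Γ : CostEnv Chan Own) (a : Chan) (R : ResType) :
    (Γ.extend a R).res = Function.update Γ.res a (some R) := rfl

@[simp] theorem extend_res_self (Γ : CostEnv Chan Own) (a : Chan) (R : ResType) :
    (Γ.extend a R).res a = some R := by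
  simp [extend_res]

theorem extend_res_of_ne (Γ : CostEnv Chan Own) {a c : Chan} (R : ResType) (h : c ≠ a) :
    (Γ.extend a R).res c = Γ.res c := by
  simp [extend_res, h]

theorem mem_dom_extend {Γ : CostEnv Chan Own} {a c : Chan} {R : ResType} :
    c ∈ (Γ.extend a R).dom ↔ c = a ∨ c ∈ Γ.dom := by
  by_cases h : c = a <;> simp [dom, extend_res, h]

theorem extend_res_inj {Γ Δ : CostEnv Chan Own} {a : Chan} {R R' : ResType} (h1 : a ∉ Γ.dom)
    (h2 : a ∉ Δ.dom) (h : (Γ.extend a R).res = (Δ.extend a R').res) : Γ.res = Δ.res := by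
  funext c
  by_cases hc : c = a
  · subst hc
    rw [not_mem_dom.1 h1, not_mem_dom.1 h2]
  · simpa [extend_res, hc] using congrFun h c

@[simp] theorem extendAll_funds (bs : List (Chan × ResType)) : ∀ Γ : CostEnv Chan Own,
    (Γ.extendAll bs).funds = Γ.funds := by
  induction bs with
  | nil => exact fun _ => rfl
  | cons b bs ih => exact fun Γ => ih (Γ.extend b.1 b.2)

@[simp] theorem extendAll_record (bs : List (Chan × ResType)) : ∀ Γ : CostEnv Chan Own,
    (Γ.extendAll bs).record = Γ.record := by
  induction bs with
  | nil => exact fun _ => rfl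
  | cons b bs ih => exact fun Γ => ih (Γ.extend b.1 b.2)

theorem extendAll_res_congr (bs : List (Chan × ResType)) : ∀ {Γ Δ : CostEnv Chan Own} {c : Chan},
    Γ.res c = Δ.res c → (Γ.extendAll bs).res c = (Δ.extendAll bs).res c := by
  induction bs with
  | nil => exact fun h => h
  | cons b bs ih =>
    intro Γ Δ c h
    refine ih (Γ := Γ.extend b.1 b.2) (Δ := Δ.extend b.1 b.2) ?_
    by_cases hc : c = b.1 <;> simp [extend_res, hc, h]

theorem extendAll_res_of_notMem (bs : List (Chan × ResType)) : ∀ {Γ : CostEnv Chan Own} {c : Chan},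
    c ∉ bs.map Prod.fst → (Γ.extendAll bs).res c = Γ.res c := by
  induction bs with
  | nil => exact fun _ => rfl
  | cons b bs ih =>
    intro Γ c h
    simp only [List.map_cons, List.mem_cons, not_or] at h
    exact (ih (Γ := Γ.extend b.1 b.2) h.2).trans (extend_res_of_ne _ _ h.1)

theorem extendAll_res_eq (bs : List (Chan × ResType)) {Γ Δ : CostEnv Chan Own}
    (h : Γ.res = Δ.res) : (Γ.extendAll bs).res = (Δ.extendAll bs).res :=
  funext fun c => extendAll_res_congr bs (congrFun h c)

theorem mem_dom_extendAll (bs : List (Chan × ResType)) : ∀ {Γ : CostEnv Chan Own} {c : Chan},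
    c ∈ (Γ.extendAll bs).dom ↔ c ∈ bs.map Prod.fst ∨ c ∈ Γ.dom := by
  induction bs with
  | nil => simp [extendAll]
  | cons b bs ih =>
    intro Γ c
    have := ih (Γ := Γ.extend b.1 b.2) (c := c)
    rw [mem_dom_extend] at this
    simp only [List.map_cons, List.mem_cons]
    exact this.trans (by tauto)

theorem Fresh.cons {Γ : CostEnv Chan Own} {r : Chan × ResType}
    {rs : List (Chan × ResType)} (h : Γ.Fresh (r :: rs)) :
    r.1 ∉ Γ.dom ∧ (Γ.extend r.1 r.2).Fresh rs := by
  obtain ⟨h1, h2⟩ := h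
  simp only [List.map_cons, List.nodup_cons] at h1
  refine ⟨h2 r (by simp), h1.2, fun b hb hd => ?_⟩
  rcases CostEnv.mem_dom_extend.1 hd with e | hd
  · exact h1.1 (e ▸ List.mem_map_of_mem hb)
  · exact h2 b (by simp [hb]) hd

end CostEnv

namespace Label

variable {Chan : Type u} {Own : Type v}

/-- The bound names of a label, with their types. -/
def binds : Label Chan Own → List (Chan × ResType)
  | tau => []
  | inp _ t _ b _ => bindings b t
  | out _ t _ b _ => bindings b t

theorem bn_eq (l : Label Chan Own) : l.bn = l.binds.map Prod.fst := by
  cases l <;> rfl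

/-- The user, the channel and the provider of a visible label. -/
def core : Label Chan Own → Option (Own × Chan × Own)
  | tau => none
  | inp u _ a _ p => some (u, a, p)
  | out u _ a _ p => some (u, a, p)

/-- The action of a renaming of channel names on labels. -/
def ren (σ : Chan → Chan) : Label Chan Own → Label Chan Own
  | tau => tau
  | inp u t a b p => inp u t (σ a) (σ b) p
  | out u t a b p => out u t (σ a) (σ b) p

theorem bn_ren (σ : Chan → Chan) (l : Label Chan Own) : (l.ren σ).bn = l.bn.map σ := by
  cases l with
  | tau => rfl
  | inp u t a b p => cases t <;> rfl
  | out u t a b p => cases t <;> rfl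

variable [DecidableEq Chan]

theorem bn_subset_names {l : Label Chan Own} {b : Chan} (h : b ∈ l.bn) : b ∈ l.names := by
  cases l with
  | tau => simp [bn] at h
  | inp u t a b p => cases t <;> simp_all [bn, names, bindings]
  | out u t a b p => cases t <;> simp_all [bn, names, bindings]

theorem ren_congr {σ τ : Chan → Chan} {l : Label Chan Own} (h : ∀ c ∈ l.names, σ c = τ c) :
    l.ren σ = l.ren τ := by
  cases l <;> simp_all [ren, names]

theorem mem_names_ren {σ : Chan → Chan} {l : Label Chan Own} {c : Chan} :
    c ∈ (l.ren σ).names ↔ ∃ d ∈ l.names, σ d = c := by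
  cases l <;> simp [ren, names, eq_comm]

end Label

/-! ### Basic properties of actions -/

section

variable {Chan : Type u} {Own : Type v} [DecidableEq Chan] [DecidableEq Own]
variable {Γ Γ' : CostEnv Chan Own} {M M' : Sys Chan Own 0} {l : Label Chan Own}

theorem Step.bound_fresh (h : Step Γ M l Γ' M') : ∀ b ∈ l.bn, b ∉ Γ.dom ∧ b ∉ M.fn := by
  induction h with
  | inpFresh R P hc hb hP =>
    intro b' hb'
    simp only [Label.bn, bindings, Option.toList_some, List.map_cons, List.map_nil,
      List.mem_singleton] at hb'
    subst hb'
    refine ⟨hb, ?_⟩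
    simp only [Sys.fn, Proc.fn, Ident.names, Finset.mem_union, Finset.mem_singleton, not_or]
    exact ⟨fun e => hb (e ▸ hc.mem_dom), hP⟩
  | opening h1 h2 h3 _ _ =>
    intro b' hb'
    simp only [Label.bn, bindings, Option.toList_some, List.map_cons, List.map_nil,
      List.mem_singleton] at hb'
    subst hb'
    exact ⟨h2, h1⟩
  | parL N hN _ ih =>
    intro b hb
    simp only [Sys.fn, Finset.mem_union, not_or]
    exact ⟨(ih b hb).1, (ih b hb).2, hN b hb⟩
  | parR N hN _ ih =>
    intro b hb
    simp only [Sys.fn, Finset.mem_union, not_or]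
    exact ⟨(ih b hb).1, hN b hb, (ih b hb).2⟩
  | new _ _ _ _ _ ih =>
    intro b hb
    exact ⟨fun h => (ih b hb).1 (CostEnv.mem_dom_extend.2 (Or.inr h)),
      fun h => (ih b hb).2 (Sys.fn_subset_fn_inst _ _ h)⟩
  | _ => simp [Label.bn, bindings]

/-- Actions change the resources only by adding the bound names of the label. -/
theorem Step.res_eq (h : Step Γ M l Γ' M') : Γ'.res = (Γ.extendAll l.binds).res := by
  have comm : ∀ {Γ Δ : CostEnv Chan Own} {b : Chan} {t : Option ResType},
      Δ.Fresh (bindings b t) → (∀ r ∈ (bindings b t).map Prod.fst, r ∉ Γ.dom) →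
      (Δ.extendAll (bindings b t)).res = (Γ.extendAll (bindings b t)).res → Δ.res = Γ.res := by
    intro Γ Δ b t h1 h2 h3
    cases t with
    | none => exact h3
    | some R =>
      exact CostEnv.extend_res_inj (h1.2 (b, R) (by simp [bindings])) (h2 b (by simp [bindings])) h3
  induction h with
  | inp P hc hb => exact hc.res_eq
  | inpFresh R P hc hb hP =>
    funext c
    simp only [Label.binds, bindings, CostEnv.extendAll, Option.toList_some, List.map_cons,
      List.map_nil, List.foldl_cons, List.foldl_nil, CostEnv.extend_res, hc.res_eq]
  | out P hc => exact hc.res_eq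
  | commL hf h1 h2 ih1 ih2 => exact comm hf (fun b hb => (h1.bound_fresh b hb).1) ih1
  | commR hf h1 h2 ih1 ih2 => exact comm hf (fun b hb => (h1.bound_fresh b hb).1) ih1
  | opening h1 h2 h3 h4 ih => exact ih
  | parL N hN _ ih => exact ih
  | parR N hN _ ih => exact ih
  | @new Γ Γ' b R l M M' h1 h2 h3 h4 h5 ih =>
    funext c
    have hb : b ∉ l.binds.map Prod.fst := fun h => h4 (Label.bn_subset_names (l.bn_eq ▸ h))
    by_cases hc : c = b
    · subst hc
      rw [CostEnv.extendAll_res_of_notMem _ hb, CostEnv.not_mem_dom.1 h2, CostEnv.not_mem_dom.1 h3]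
    · rw [← CostEnv.extend_res_of_ne Γ' R hc, ih]
      exact CostEnv.extendAll_res_congr _ (CostEnv.extend_res_of_ne _ _ hc)
  | _ => rfl

theorem Step.res_eq_of_tau (h : Step Γ M .tau Γ' M') : Γ'.res = Γ.res := h.res_eq

theorem Step.funds_isSome (h : Step Γ M l Γ' M') (o : Own) :
    (Γ'.funds o).isSome = (Γ.funds o).isSome := by
  induction h with
  | inp P hc hb => exact hc.funds_isSome o
  | inpFresh R P hc hb hP => exact hc.funds_isSome o
  | out P hc => exact hc.funds_isSome o
  | commL hf h1 h2 ih1 ih2 => simpa using ih1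
  | commR hf h1 h2 ih1 ih2 => simpa using ih1
  | opening h1 h2 h3 h4 ih => exact ih
  | parL N hN _ ih => exact ih
  | parR N hN _ ih => exact ih
  | new h1 h2 h3 h4 h5 ih => exact ih
  | _ => rfl

/-- A visible action charges for the use of its channel. -/
theorem Step.charge (h : Step Γ M l Γ' M') {u p : Own} {a : Chan} (hl : l.core = some (u, a, p)) :
    a ∈ M.fn ∧ Γ.Charge u a p (Γ.withFunds Γ') := by
  induction h with
  | inp P hc hb =>
    cases hl
    exact ⟨by simp [Sys.fn, Proc.fn, Ident.names], hc.congr rfl rfl rfl rfl rfl rfl⟩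
  | inpFresh R P hc hb hP =>
    cases hl
    exact ⟨by simp [Sys.fn, Proc.fn, Ident.names], hc.congr rfl rfl rfl rfl rfl rfl⟩
  | out P hc =>
    cases hl
    exact ⟨by simp [Sys.fn, Proc.fn, Ident.names], hc.congr rfl rfl rfl rfl rfl rfl⟩
  | opening h1 h2 h3 h4 ih =>
    cases hl
    obtain ⟨ha, hc⟩ := ih rfl
    exact ⟨Finset.mem_of_mem_insert_of_ne (Sys.fn_inst_subset _ _ ha) h3,
      hc.congr (CostEnv.extend_res_of_ne _ _ h3).symm rfl rfl rfl rfl rfl⟩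
  | parL N hN _ ih => exact ⟨Finset.mem_union_left _ (ih hl).1, (ih hl).2⟩
  | parR N hN _ ih => exact ⟨Finset.mem_union_right _ (ih hl).1, (ih hl).2⟩
  | @new Γ Γ' b R l M M' h1 h2 h3 h4 h5 ih =>
    obtain ⟨ha, hc⟩ := ih hl
    have hab : a ≠ b := by
      rintro rfl
      apply h4
      cases l <;> simp_all [Label.core, Label.names]
    exact ⟨Finset.mem_of_mem_insert_of_ne (Sys.fn_inst_subset _ _ ha) hab,
      hc.congr (CostEnv.extend_res_of_ne _ _ hab).symm rfl rfl rfl rfl rfl⟩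
  | _ => cases hl

/-- A name sent free is free in the sender. -/
theorem Step.value_mem_fn (h : Step Γ M l Γ' M') {u p : Own} {a b : Chan}
    (hl : l = .out u none a b p) : b ∈ M.fn := by
  induction h with
  | out P hc =>
    cases hl
    simp [Sys.fn, Proc.fn, Ident.names]
  | parL N hN _ ih => exact Finset.mem_union_left _ (ih hl)
  | parR N hN _ ih => exact Finset.mem_union_right _ (ih hl)
  | new h1 h2 h3 h4 h5 ih =>
    refine Finset.mem_of_mem_insert_of_ne (Sys.fn_inst_subset _ _ (ih hl)) ?_
    rintro rfl
    simp [hl, Label.names] at h4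
  | _ => cases hl

/-- A name received free is known to the environment. -/
theorem Step.value_mem_dom (h : Step Γ M l Γ' M') {u p : Own} {a b : Chan}
    (hl : l = .inp u none a b p) : b ∈ Γ.dom := by
  induction h with
  | inp P hc hb =>
    cases hl
    exact hb
  | parL N hN _ ih => exact ih hl
  | parR N hN _ ih => exact ih hl
  | new h1 h2 h3 h4 h5 ih =>
    refine (CostEnv.mem_dom_extend.1 (ih hl)).resolve_left ?_
    rintro rfl
    simp [hl, Label.names] at h4
  | _ => cases hl

theorem Step.fn_subset (h : Step Γ M l Γ' M') : ∀ c ∈ M'.fn, c ∈ M.fn ∨ c ∈ l.names := by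
  have comm : ∀ {b : Chan} {t : Option ResType} {X : Sys Chan Own 0} {c : Chan},
      c ∈ (Sys.nus (bindings b t) X).fn → c ∈ X.fn ∧ (c = b → t = none) := by
    intro b t X c hc
    cases t with
    | none => exact ⟨hc, fun _ => rfl⟩
    | some R =>
      have := Sys.mem_fn_nu.1 (show c ∈ (Sys.nu b R X).fn from hc)
      exact ⟨this.2, fun e => absurd e this.1⟩
  induction h with
  | inp P hc hb =>
    intro c h
    have := Proc.fn_inst_subset _ _ h
    simp only [Sys.fn, Proc.fn, Label.names, Finset.mem_insert, Finset.mem_union,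
      Finset.mem_singleton] at this ⊢
    tauto
  | inpFresh R P hc hb hP =>
    intro c h
    have := Proc.fn_inst_subset _ _ h
    simp only [Sys.fn, Proc.fn, Label.names, Finset.mem_insert, Finset.mem_union,
      Finset.mem_singleton] at this ⊢
    tauto
  | out P hc =>
    intro c h
    simp only [Sys.fn, Proc.fn, Finset.mem_union] at h ⊢
    tauto
  | @commL Γ Δ u p t a b M M' N N' hf h1 h2 ih1 ih2 =>
    intro c h
    obtain ⟨h, hb⟩ := comm h
    simp only [Sys.fn, Finset.mem_union, Label.names, Finset.mem_insert,
      Finset.mem_singleton] at h ih1 ih2 ⊢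
    have ha := (h1.charge rfl).1
    have hv : c = b → c ∈ N.fn := fun e => by
      cases hb e
      exact e ▸ h2.value_mem_fn rfl
    have := ih1 c
    have := ih2 c
    grind
  | @commR Γ Δ u p t a b M M' N N' hf h1 h2 ih1 ih2 =>
    intro c h
    obtain ⟨h, hb⟩ := comm h
    simp only [Sys.fn, Finset.mem_union, Label.names, Finset.mem_insert,
      Finset.mem_singleton] at h ih1 ih2 ⊢
    have ha := (h1.charge rfl).1
    have hv : c = b → c ∈ M.fn := fun e => by
      cases hb e
      exact e ▸ h1.value_mem_fn rfl
    have := ih1 c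
    have := ih2 c
    grind
  | opening h1 h2 h3 h4 ih =>
    intro c h
    have h := ih c h
    simp only [Label.names, Finset.mem_insert, Finset.mem_singleton] at h ⊢
    rcases h with h | h
    · have := Sys.fn_inst_subset _ _ h
      simp only [Sys.fn, Finset.mem_insert] at this ⊢
      tauto
    · tauto
  | extrude | split => exact fun c h => Or.inl h
  | unwind Γ o T => exact fun c h => Or.inl (Proc.fn_unfold_subset T h)
  | eq | ne =>
    intro c h
    simp only [Sys.fn, Proc.fn, Finset.mem_union] at h ⊢
    tauto
  | parL N hN _ ih =>
    intro c h
    simp only [Sys.fn, Finset.mem_union] at h ⊢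
    have := ih c
    tauto
  | parR N hN _ ih =>
    intro c h
    simp only [Sys.fn, Finset.mem_union] at h ⊢
    have := ih c
    tauto
  | new h1 h2 h3 h4 h5 ih =>
    intro c h
    obtain ⟨hc, h⟩ := Sys.mem_fn_nu.1 h
    exact (ih c h).imp (fun h => Finset.mem_of_mem_insert_of_ne (Sys.fn_inst_subset _ _ h) hc) id

theorem Step.fn_subset_of_tau (h : Step Γ M .tau Γ' M') : M'.fn ⊆ M.fn := fun c hc =>
  (h.fn_subset c hc).resolve_right (by simp [Label.names])

end

/-! ### Renaming and change of the environment -/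

section

variable {Chan : Type u} {Own : Type v} [DecidableEq Chan] [DecidableEq Own]

/-- Actions are invariant under permutations `σ` of the channel names, and under changes of the
resources that do not affect the free names of the system. The permutation is generalized in the
induction, so that names bound inside the derivation can be replaced by fresh ones. -/
theorem Step.transfer [Infinite Chan] {Γ Γ' : CostEnv Chan Own} {M M' : Sys Chan Own 0}
    {l : Label Chan Own} (h : Step Γ M l Γ' M') :
    ∀ (σ : Equiv.Perm Chan) (Γ₂ Γ₂' : CostEnv Chan Own), Γ₂.funds = Γ.funds →
      Γ₂.record = Γ.record → Γ₂'.funds = Γ'.funds → Γ₂'.record = Γ'.record →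
      Γ₂'.res = (Γ₂.extendAll (l.ren σ).binds).res → (∀ c ∈ M.fn, Γ₂.res (σ c) = Γ.res c) →
      (∀ u a b p, l = .inp u none a b p → σ b ∈ Γ₂.dom) → (∀ b ∈ (l.ren σ).bn, b ∉ Γ₂.dom) →
      Step Γ₂ (M.ren σ) (l.ren σ) Γ₂' (M'.ren σ) := by
  induction h with
  | @inp Γ Δ u o a b P hc hb =>
    intro σ Γ₂ Γ₂' hf hr hf' hr' hs hM hi _
    have ha := hM a (by simp [Sys.fn, Proc.fn, Ident.names])
    have := Step.inp (P.map (Ident.ren σ)) (hc.congr ha hf hr hs hf' hr') (hi _ _ _ _ rfl)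
    rw [← Proc.ren_inst] at this
    simpa [Sys.ren, Sys.map, Proc.map, Ident.lift_ren, Label.ren] using this
  | @inpFresh Γ Δ u o a b R P hc hb hP =>
    intro σ Γ₂ Γ₂' hf hr hf' hr' hs hM _ hn
    have ha := hM a (by simp [Sys.fn, Proc.fn, Ident.names])
    have hσ : σ b ∉ Γ₂.dom := hn (σ b) (by simp [Label.bn, Label.ren, bindings])
    have hc' : Γ₂.Charge u (σ a) o (Γ₂.withFunds Γ₂') :=
      hc.congr ha hf hr rfl (by simpa [CostEnv.extend] using hf')
        (by simpa [CostEnv.extend] using hr')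
    have := Step.inpFresh R (P.map (Ident.ren σ)) hc' hσ (by
      intro h
      obtain ⟨d, hd, e⟩ := (Proc.mem_fn_ren P).1 h
      exact hP (σ.injective e ▸ hd))
    rw [← Proc.ren_inst] at this
    have he : (Γ₂.withFunds Γ₂').extend (σ b) R = Γ₂' :=
      CostEnv.ext_fields (by rw [hs]; rfl) rfl rfl
    rw [he] at this
    simpa [Sys.ren, Sys.map, Proc.map, Ident.lift_ren, Label.ren] using this
  | @out Γ Δ o p a b P hc =>
    intro σ Γ₂ Γ₂' hf hr hf' hr' hs hM _ _
    have ha := hM a (by simp [Sys.fn, Proc.fn, Ident.names])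
    exact Step.out (P.map (Ident.ren σ)) (hc.congr ha hf hr hs hf' hr')
  | @commL Γ Δ u p t a b M M' N N' hf h1 h2 ih1 ih2 =>
    intro σ Γ₂ Γ₂' hfu hr hf' hr' hs hM _ _
    have hn1 : ∀ d ∈ M.fn, Γ₂.res (σ d) = Γ.res d := fun d hd =>
      hM d (Finset.mem_union_left _ hd)
    have hn2 : ∀ d ∈ N.fn, Γ₂.res (σ d) = Γ.res d := fun d hd =>
      hM d (Finset.mem_union_right _ hd)
    cases t with
    | none =>
      have hb : σ b ∈ Γ₂.dom := (CostEnv.mem_dom_congr (hM b (Finset.mem_union_right _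
        (h2.value_mem_fn rfl)))).2 (h1.value_mem_dom rfl)
      exact Step.commL (t := none) ⟨by simp [bindings], by simp [bindings]⟩
        (ih1 σ Γ₂ Γ₂' hfu hr hf' hr' hs hn1 (by rintro _ _ _ _ ⟨⟩; exact hb)
          (by simp [Label.bn, Label.ren, bindings]))
        (ih2 σ Γ₂ Γ₂' hfu hr hf' hr' hs hn2 (by simp)
          (by simp [Label.bn, Label.ren, bindings]))
    | some R =>
      have hbn : b ∈ [b] := List.mem_singleton_self b
      have hab : a ≠ b := fun e => (h1.bound_fresh b hbn).1 (e ▸ (h1.charge rfl).2.mem_dom)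
      -- The image of the transmitted name may clash with `Γ₂`, so a fresh `c` takes its place.
      obtain ⟨c, hc, hcd⟩ := Γ₂.exists_fresh
        (((Sys.par M N).ren σ).fn ∪ ((Sys.par M' N').ren σ).fn ∪ {σ a})
      simp only [Finset.mem_union, Finset.mem_singleton, not_or] at hc
      obtain ⟨⟨hc1, hc2⟩, hc3⟩ := hc
      set σ' : Equiv.Perm Chan := σ.trans (Equiv.swap (σ b) c) with hσ'
      have hσb : σ' b = c := by simp [hσ']
      have hσ'_of : ∀ d, d ≠ b → σ d ≠ c → σ' d = σ d := fun d hd h =>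
        Equiv.swap_apply_of_ne_of_ne (σ.injective.ne hd) h
      have hMf : ∀ d ∈ (Sys.par M N).fn, σ' d = σ d := fun d hd => hσ'_of d
        (by rintro rfl; exact (Finset.mem_union.1 hd).elim (h1.bound_fresh d hbn).2
              (h2.bound_fresh d hbn).2)
        (fun e => hc1 (Sys.mem_fn_ren.2 ⟨d, hd, e⟩))
      have hσa : σ' a = σ a := hσ'_of a hab (Ne.symm hc3)
      have hcd' : c ∉ Γ₂'.dom := by
        rwa [CostEnv.dom_congr hs]
      have s1 := ih1 σ' Γ₂ (Γ₂'.extend c R) hfu hr hf' hr'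
        (by simp only [Label.ren, hσb, CostEnv.extend_res, hs]; rfl)
        (fun d hd => (hMf d (Finset.mem_union_left _ hd)).symm ▸ hn1 d hd) (by simp)
        (by simpa [Label.bn, Label.ren, bindings, hσb] using hcd)
      have s2 := ih2 σ' Γ₂ (Γ₂'.extend c R) hfu hr hf' hr'
        (by simp only [Label.ren, hσb, CostEnv.extend_res, hs]; rfl)
        (fun d hd => (hMf d (Finset.mem_union_right _ hd)).symm ▸ hn2 d hd) (by simp)
        (by simpa [Label.bn, Label.ren, bindings, hσb] using hcd)
      simp only [Label.ren, hσb, hσa] at s1 s2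
      rw [Sys.ren_congr (fun d hd => hMf d (Finset.mem_union_left _ hd))] at s1
      rw [Sys.ren_congr (fun d hd => hMf d (Finset.mem_union_right _ hd))] at s2
      have := Step.commL (Δ := Γ₂') (t := some R)
        ⟨by simp [bindings], by simpa [bindings] using hcd'⟩ s1 s2
      have he : Sys.par (M'.ren σ') (N'.ren σ') =
          ((Sys.par M' N').ren σ).ren (Equiv.swap (σ b) c) := by rw [Sys.ren_ren]; rfl
      have he' : Sys.nus (bindings c (some R)) (Sys.par (M'.ren σ') (N'.ren σ')) =
          (Sys.nus (bindings b (some R)) (Sys.par M' N')).ren σ := by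
        rw [he]
        exact (Sys.nu_ren_swap hc2).trans (Sys.ren_nu σ.injective _ _ _).symm
      rw [he'] at this
      exact this
  | @commR Γ Δ u p t a b M M' N N' hf h1 h2 ih1 ih2 =>
    intro σ Γ₂ Γ₂' hfu hr hf' hr' hs hM _ _
    have hn1 : ∀ d ∈ M.fn, Γ₂.res (σ d) = Γ.res d := fun d hd =>
      hM d (Finset.mem_union_left _ hd)
    have hn2 : ∀ d ∈ N.fn, Γ₂.res (σ d) = Γ.res d := fun d hd =>
      hM d (Finset.mem_union_right _ hd)
    cases t with
    | none =>
      have hb : σ b ∈ Γ₂.dom := (CostEnv.mem_dom_congr (hM b (Finset.mem_union_left _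
        (h1.value_mem_fn rfl)))).2 (h2.value_mem_dom rfl)
      exact Step.commR (t := none) ⟨by simp [bindings], by simp [bindings]⟩
        (ih1 σ Γ₂ Γ₂' hfu hr hf' hr' hs hn1 (by simp)
          (by simp [Label.bn, Label.ren, bindings]))
        (ih2 σ Γ₂ Γ₂' hfu hr hf' hr' hs hn2 (by rintro _ _ _ _ ⟨⟩; exact hb)
          (by simp [Label.bn, Label.ren, bindings]))
    | some R =>
      have hbn : b ∈ [b] := List.mem_singleton_self b
      have hab : a ≠ b := fun e => (h1.bound_fresh b hbn).1 (e ▸ (h1.charge rfl).2.mem_dom)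
      -- The image of the transmitted name may clash with `Γ₂`, so a fresh `c` takes its place.
      obtain ⟨c, hc, hcd⟩ := Γ₂.exists_fresh
        (((Sys.par M N).ren σ).fn ∪ ((Sys.par M' N').ren σ).fn ∪ {σ a})
      simp only [Finset.mem_union, Finset.mem_singleton, not_or] at hc
      obtain ⟨⟨hc1, hc2⟩, hc3⟩ := hc
      set σ' : Equiv.Perm Chan := σ.trans (Equiv.swap (σ b) c) with hσ'
      have hσb : σ' b = c := by simp [hσ']
      have hσ'_of : ∀ d, d ≠ b → σ d ≠ c → σ' d = σ d := fun d hd h =>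
        Equiv.swap_apply_of_ne_of_ne (σ.injective.ne hd) h
      have hMf : ∀ d ∈ (Sys.par M N).fn, σ' d = σ d := fun d hd => hσ'_of d
        (by rintro rfl; exact (Finset.mem_union.1 hd).elim (h1.bound_fresh d hbn).2
              (h2.bound_fresh d hbn).2)
        (fun e => hc1 (Sys.mem_fn_ren.2 ⟨d, hd, e⟩))
      have hσa : σ' a = σ a := hσ'_of a hab (Ne.symm hc3)
      have hcd' : c ∉ Γ₂'.dom := by
        rwa [CostEnv.dom_congr hs]
      have s1 := ih1 σ' Γ₂ (Γ₂'.extend c R) hfu hr hf' hr'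
        (by simp only [Label.ren, hσb, CostEnv.extend_res, hs]; rfl)
        (fun d hd => (hMf d (Finset.mem_union_left _ hd)).symm ▸ hn1 d hd) (by simp)
        (by simpa [Label.bn, Label.ren, bindings, hσb] using hcd)
      have s2 := ih2 σ' Γ₂ (Γ₂'.extend c R) hfu hr hf' hr'
        (by simp only [Label.ren, hσb, CostEnv.extend_res, hs]; rfl)
        (fun d hd => (hMf d (Finset.mem_union_right _ hd)).symm ▸ hn2 d hd) (by simp)
        (by simpa [Label.bn, Label.ren, bindings, hσb] using hcd)
      simp only [Label.ren, hσb, hσa] at s1 s2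
      rw [Sys.ren_congr (fun d hd => hMf d (Finset.mem_union_left _ hd))] at s1
      rw [Sys.ren_congr (fun d hd => hMf d (Finset.mem_union_right _ hd))] at s2
      have := Step.commR (Δ := Γ₂') (t := some R)
        ⟨by simp [bindings], by simpa [bindings] using hcd'⟩ s1 s2
      have he : Sys.par (M'.ren σ') (N'.ren σ') =
          ((Sys.par M' N').ren σ).ren (Equiv.swap (σ b) c) := by rw [Sys.ren_ren]; rfl
      have he' : Sys.nus (bindings c (some R)) (Sys.par (M'.ren σ') (N'.ren σ')) =
          (Sys.nus (bindings b (some R)) (Sys.par M' N')).ren σ := by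
        rw [he]
        exact (Sys.nu_ren_swap hc2).trans (Sys.ren_nu σ.injective _ _ _).symm
      rw [he'] at this
      exact this
  | @opening Γ Γ' u p a b R M M' h1 h2 h3 h4 ih =>
    intro σ Γ₂ Γ₂' hf hr hf' hr' hs hM _ hn
    have hσ : σ b ∉ Γ₂.dom := hn (σ b) (by simp [Label.bn, Label.ren, bindings])
    have := ih σ (Γ₂.extend (σ b) R) Γ₂' hf hr hf' hr' hs ?_ (by simp)
      (by simp [Label.bn, Label.ren, bindings])
    · rw [Sys.ren_inst] at this
      rw [Sys.ren_new]
      refine Step.opening ?_ hσ (σ.injective.ne h3) this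
      intro h
      obtain ⟨d, hd, e⟩ := Sys.mem_fn_ren.1 h
      exact h1 (σ.injective e ▸ hd)
    · intro c hc
      by_cases hcb : c = b
      · subst hcb
        simp
      · rw [CostEnv.extend_res_of_ne _ _ hcb, CostEnv.extend_res_of_ne _ _ (σ.injective.ne hcb)]
        exact hM c (Finset.mem_of_mem_insert_of_ne (Sys.fn_inst_subset _ _ hc) hcb)
  | extrude Γ o R P =>
    intro σ Γ₂ Γ₂' hf hr hf' hr' hs _ _ _
    obtain rfl : Γ₂' = Γ₂ := CostEnv.ext_fields hs (hf'.trans hf.symm) (hr'.trans hr.symm)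
    exact Step.extrude _ _ _ _
  | split Γ o P Q =>
    intro σ Γ₂ Γ₂' hf hr hf' hr' hs _ _ _
    obtain rfl : Γ₂' = Γ₂ := CostEnv.ext_fields hs (hf'.trans hf.symm) (hr'.trans hr.symm)
    exact Step.split _ _ _ _
  | unwind Γ o T =>
    intro σ Γ₂ Γ₂' hf hr hf' hr' hs _ _ _
    obtain rfl : Γ₂' = Γ₂ := CostEnv.ext_fields hs (hf'.trans hf.symm) (hr'.trans hr.symm)
    simp only [Sys.ren, Sys.map, Proc.map_unfold]
    exact Step.unwind _ _ _
  | eq Γ o a P Q =>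
    intro σ Γ₂ Γ₂' hf hr hf' hr' hs _ _ _
    obtain rfl : Γ₂' = Γ₂ := CostEnv.ext_fields hs (hf'.trans hf.symm) (hr'.trans hr.symm)
    exact Step.eq _ _ _ _ _
  | ne Γ o P Q hab =>
    intro σ Γ₂ Γ₂' hf hr hf' hr' hs _ _ _
    obtain rfl : Γ₂' = Γ₂ := CostEnv.ext_fields hs (hf'.trans hf.symm) (hr'.trans hr.symm)
    exact Step.ne _ _ _ _ (σ.injective.ne hab)
  | @parL Γ Γ' M M' l N hN _ ih =>
    intro σ Γ₂ Γ₂' hf hr hf' hr' hs hM hi hn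
    refine Step.parL (N.ren σ) ?_ (ih σ Γ₂ Γ₂' hf hr hf' hr' hs
      (fun c hc => hM c (Finset.mem_union_left _ hc)) hi hn)
    intro b hb h
    rw [Label.bn_ren] at hb
    obtain ⟨c, hc, rfl⟩ := List.mem_map.1 hb
    obtain ⟨d, hd, e⟩ := Sys.mem_fn_ren.1 h
    exact hN c hc (σ.injective e ▸ hd)
  | @parR Γ Γ' M M' l N hN _ ih =>
    intro σ Γ₂ Γ₂' hf hr hf' hr' hs hM hi hn
    refine Step.parR (N.ren σ) ?_ (ih σ Γ₂ Γ₂' hf hr hf' hr' hs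
      (fun c hc => hM c (Finset.mem_union_right _ hc)) hi hn)
    intro b hb h
    rw [Label.bn_ren] at hb
    obtain ⟨c, hc, rfl⟩ := List.mem_map.1 hb
    obtain ⟨d, hd, e⟩ := Sys.mem_fn_ren.1 h
    exact hN c hc (σ.injective e ▸ hd)
  | @new Γ Γ' b R l M M' h1 h2 h3 h4 h5 ih =>
    intro σ Γ₂ Γ₂' hf hr hf' hr' hs hM hi hn
    -- The image of the restricted name may clash with `Γ₂`, so a fresh `c` takes its place.
    obtain ⟨c, hc, hcd⟩ := Γ₂.exists_fresh
      ((M.ren σ).fn ∪ (M'.ren σ).fn ∪ (l.ren σ).names ∪ {σ b})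
    simp only [Finset.mem_union, Finset.mem_singleton, not_or] at hc
    obtain ⟨⟨⟨hc1, hc2⟩, hc3⟩, hc4⟩ := hc
    set σ' : Equiv.Perm Chan := σ.trans (Equiv.swap (σ b) c) with hσ'
    have hσb : σ' b = c := by simp [hσ']
    have hσ'_of : ∀ d, d ≠ b → σ d ≠ c → σ' d = σ d := fun d hd h =>
      Equiv.swap_apply_of_ne_of_ne (σ.injective.ne hd) h
    have hMf : ∀ d ∈ M.fn, σ' d = σ d := fun d hd => hσ'_of d (fun e => h1 (e ▸ hd))
      (fun e => hc1 (Sys.mem_fn_ren.2 ⟨d, hd, e⟩))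
    have hl : l.ren σ' = l.ren σ := Label.ren_congr fun d hd =>
      hσ'_of d (fun e => h4 (e ▸ hd)) (fun e => hc3 (Label.mem_names_ren.2 ⟨d, hd, e⟩))
    have hcb : c ∉ (l.ren σ).binds.map Prod.fst := fun h =>
      hc3 (Label.bn_subset_names (Label.bn_eq (l.ren σ) ▸ h))
    have hcd' : c ∉ Γ₂'.dom := by
      rw [CostEnv.dom_congr hs, CostEnv.mem_dom_extendAll]
      tauto
    have := ih σ' (Γ₂.extend c R) (Γ₂'.extend c R) hf hr hf' hr' ?_ ?_ ?_ ?_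
    · rw [Sys.ren_inst, hσb, Sys.ren_congr hMf, hl] at this
      have := Step.new hc1 hcd hcd' hc3 this
      have he : M'.ren σ' = (M'.ren σ).ren (Equiv.swap (σ b) c) := by rw [Sys.ren_ren]; rfl
      rw [he, Sys.nu_ren_swap hc2, ← Sys.ren_nu σ.injective,
        ← Sys.ren_new] at this
      exact this
    · rw [hl]
      funext d
      by_cases hd : d = c
      · subst hd
        rw [CostEnv.extendAll_res_of_notMem _ hcb]
        simp
      · rw [CostEnv.extend_res_of_ne _ _ hd, hs]
        exact CostEnv.extendAll_res_congr _ (CostEnv.extend_res_of_ne _ _ hd).symm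
    · intro d hd
      by_cases hdb : d = b
      · subst hdb
        simp [hσb]
      · have hdM := Finset.mem_of_mem_insert_of_ne (Sys.fn_inst_subset _ _ hd) hdb
        have hdc : σ' d ≠ c := fun e => hdb (σ'.injective (e.trans hσb.symm))
        rw [CostEnv.extend_res_of_ne _ _ hdb, CostEnv.extend_res_of_ne _ _ hdc, hMf d hdM]
        exact hM d hdM
    · intro u a d p e
      have hd : σ' d = σ d := hσ'_of d (fun e' => h4 (by simp [e, e', Label.names]))
        (fun e' => hc3 (Label.mem_names_ren.2 ⟨d, by simp [e, Label.names], e'⟩))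
      rw [hd]
      exact CostEnv.mem_dom_extend.2 (Or.inr (hi u a d p e))
    · rw [hl]
      intro d hd h
      rcases CostEnv.mem_dom_extend.1 h with rfl | h
      · exact hc3 (Label.bn_subset_names hd)
      · exact hn d hd h

end

section

variable {Chan : Type u} {Own : Type v} [DecidableEq Chan] [DecidableEq Own]

/-- Actions do not depend on the resources that are not free in the system. -/
theorem Step.change_res [Infinite Chan] {Γ Γ' Γ₂ Γ₂' : CostEnv Chan Own} {M M' : Sys Chan Own 0}
    {l : Label Chan Own} (h : Step Γ M l Γ' M') (hf : Γ₂.funds = Γ.funds)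
    (hr : Γ₂.record = Γ.record) (hf' : Γ₂'.funds = Γ'.funds) (hr' : Γ₂'.record = Γ'.record)
    (hs : Γ₂'.res = (Γ₂.extendAll l.binds).res) (hM : ∀ c ∈ M.fn, Γ₂.res c = Γ.res c)
    (hi : ∀ u a b p, l = .inp u none a b p → b ∈ Γ₂.dom) (hn : ∀ b ∈ l.bn, b ∉ Γ₂.dom) :
    Step Γ₂ M l Γ₂' M' := by
  have hl : l.ren (id : Chan → Chan) = l := by cases l <;> rfl
  have := h.transfer 1 Γ₂ Γ₂' hf hr hf' hr' (by rw [Equiv.Perm.coe_one, hl, hs]) hM hi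
    (by rwa [Equiv.Perm.coe_one, hl])
  rwa [Equiv.Perm.coe_one, hl, Sys.ren_id, Sys.ren_id] at this

/-- Replacing the bound name of a visible label. -/
theorem Step.rename_bound [Infinite Chan] {Γ Γ' : CostEnv Chan Own} {M M' : Sys Chan Own 0}
    {u p : Own} {a b c : Chan} {R : ResType} (hc : c ∉ Γ.dom) (hcM : c ∉ M.fn) :
    (Step Γ M (.inp u (some R) a b p) Γ' M' →
      Step Γ M (.inp u (some R) a c p) ((Γ.withFunds Γ').extend c R)
        (M'.ren (Equiv.swap b c))) ∧
    (Step Γ M (.out u (some R) a b p) Γ' M' →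
      Step Γ M (.out u (some R) a c p) ((Γ.withFunds Γ').extend c R)
        (M'.ren (Equiv.swap b c))) := by
  have hM : b ∉ M.fn → M.ren (Equiv.swap b c) = M := fun h => Sys.ren_eq_self fun d hd =>
    Equiv.swap_apply_of_ne_of_ne (fun e => h (e ▸ hd)) (fun e => hcM (e ▸ hd))
  have hMr : b ∉ M.fn → ∀ d ∈ M.fn, Γ.res (Equiv.swap b c d) = Γ.res d := fun h d hd => by
    have hdb : d ≠ b := fun e => h (e ▸ hd)
    have hdc : d ≠ c := fun e => hcM (e ▸ hd)
    rw [Equiv.swap_apply_of_ne_of_ne hdb hdc]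
  have hbb : b ∈ [b] := List.mem_singleton_self b
  have ha : b ∉ Γ.dom → a ∈ Γ.dom → Equiv.swap b c a = a := fun h1 h2 =>
    Equiv.swap_apply_of_ne_of_ne (fun e => h1 (e ▸ h2)) (fun e => hc (e ▸ h2))
  constructor
  · intro h
    obtain ⟨h1, h2⟩ := h.bound_fresh b hbb
    have := h.transfer (Equiv.swap b c) Γ ((Γ.withFunds Γ').extend c R) rfl rfl rfl rfl
      (by simp [Label.ren, Label.binds, bindings, CostEnv.extendAll, CostEnv.extend_res])
      (hMr h2) (by simp) (by simpa [Label.ren, Label.bn, bindings] using hc)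
    simpa only [hM h2, Label.ren, ha h1 (h.charge rfl).2.mem_dom, Equiv.swap_apply_left] using this
  · intro h
    obtain ⟨h1, h2⟩ := h.bound_fresh b hbb
    have := h.transfer (Equiv.swap b c) Γ ((Γ.withFunds Γ').extend c R) rfl rfl rfl rfl
      (by simp [Label.ren, Label.binds, bindings, CostEnv.extendAll, CostEnv.extend_res])
      (hMr h2) (by simp) (by simpa [Label.ren, Label.bn, bindings] using hc)
    simpa only [hM h2, Label.ren, ha h1 (h.charge rfl).2.mem_dom, Equiv.swap_apply_left] using this

/-! ### Internal actions under restrictions -/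

theorem Step.nu {Γ Γ' : CostEnv Chan Own} {M M' : Sys Chan Own 0} {b : Chan} {R : ResType}
    (hb : b ∉ Γ.dom) (h : Step (Γ.extend b R) M .tau (Γ'.extend b R) M') (hb' : b ∉ Γ'.dom) :
    Step Γ (.nu b R M) .tau Γ' (.nu b R M') := by
  refine Step.new (fun h => (Sys.mem_fn_nu.1 (show b ∈ (Sys.nu b R M).fn from h)).1 rfl) hb hb'
    (by simp [Label.names]) ?_
  rwa [Sys.map_bind_inst]

theorem Step.nu_inv [Infinite Chan] {Γ Γ' : CostEnv Chan Own} {M X : Sys Chan Own 0} {b : Chan}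
    {R : ResType} (hb : b ∉ Γ.dom) (h : Step Γ (.nu b R M) .tau Γ' X) :
    ∃ M', X = .nu b R M' ∧ Step (Γ.extend b R) M .tau (Γ'.extend b R) M' := by
  generalize hY : Sys.nu b R M = Y at h
  generalize hl : (Label.tau : Label Chan Own) = l at h
  cases h with
  | @new Γ Γ' c R' l N M' h1 h2 h3 h4 h5 =>
    subst hl
    cases hY
    have hcM : c ∉ M.fn ∨ c = b := by
      by_contra hcon
      push Not at hcon
      exact h1 (Sys.mem_fn_nu.2 ⟨hcon.2, hcon.1⟩ : c ∈ (Sys.nu b R M).fn)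
    rw [Sys.map_bind_inst_swap hcM] at h5
    have hbM' : b ∉ M'.fn ∨ c = b := by
      by_cases hcb : c = b
      · exact Or.inr hcb
      refine Or.inl fun hb' => ?_
      obtain ⟨d, hd, e⟩ := Sys.mem_fn_ren.1 (h5.fn_subset_of_tau hb')
      have : d = c := (Equiv.swap b c).injective (e.trans (Equiv.swap_apply_right b c).symm)
      subst this
      exact hcM.elim (fun h => h hd) hcb
    have hdom : Γ'.dom = Γ.dom := CostEnv.dom_congr
      (CostEnv.extend_res_inj h3 h2 h5.res_eq_of_tau)
    refine ⟨M'.ren (Equiv.swap c b), ?_, ?_⟩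
    · rcases hbM' with h | rfl
      · exact (Sys.nu_ren_swap h).symm
      · rw [Equiv.swap_self, Equiv.coe_refl, Sys.ren_id]
    · have := h5.transfer (Equiv.swap c b) (Γ.extend b R) (Γ'.extend b R) rfl rfl rfl rfl ?_ ?_
        (by simp) (by simp [Label.ren, Label.bn])
      · rw [Sys.ren_ren] at this
        have e : (Equiv.swap c b : Chan → Chan) ∘ (Equiv.swap b c) = id := by
          rw [Equiv.swap_comm c b]
          funext x
          simp
        rwa [e, Sys.ren_id] at this
      · rw [CostEnv.extend_res, CostEnv.extend_res_inj h3 h2 h5.res_eq_of_tau]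
        rfl
      · intro d' hd'
        obtain ⟨d, hd, rfl⟩ := Sys.mem_fn_ren.1 hd'
        rw [Equiv.swap_comm c b, Equiv.swap_apply_self]
        by_cases hdb : d = b
        · subst hdb
          simp
        · have hdc : d ≠ c := by
            rcases hcM with h | rfl
            · rintro rfl
              exact h hd
            · exact hdb
          rw [Equiv.swap_apply_of_ne_of_ne hdb hdc, CostEnv.extend_res_of_ne _ _ hdb,
            CostEnv.extend_res_of_ne _ _ hdc]
  | opening => cases hl
  | _ => cases hY

theorem Step.nus : ∀ {rs : List (Chan × ResType)} {Γ Γ' : CostEnv Chan Own}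
    {M M' : Sys Chan Own 0}, Γ.Fresh rs → Γ'.Fresh rs →
    Step (Γ.extendAll rs) M .tau (Γ'.extendAll rs) M' →
    Step Γ (.nus rs M) .tau Γ' (.nus rs M')
  | [], _, _, _, _, _, _, h => h
  | _ :: _, _, _, _, _, hf, hf', h =>
    Step.nu hf.cons.1 (Step.nus hf.cons.2 hf'.cons.2 h) hf'.cons.1

theorem Step.nus_inv [Infinite Chan] : ∀ {rs : List (Chan × ResType)} {Γ Γ' : CostEnv Chan Own}
    {M X : Sys Chan Own 0}, Γ.Fresh rs → Step Γ (.nus rs M) .tau Γ' X →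
    ∃ M', X = .nus rs M' ∧ Step (Γ.extendAll rs) M .tau (Γ'.extendAll rs) M'
  | [], _, _, _, X, _, h => ⟨X, rfl, h⟩
  | r :: rs, _, _, _, _, hf, h => by
    obtain ⟨X, rfl, h₁⟩ := Step.nu_inv hf.cons.1 h
    obtain ⟨M', rfl, h₂⟩ := Step.nus_inv hf.cons.2 h₁
    exact ⟨M', rfl, h₂⟩

end

/-! ### Weak actions -/

section

variable {Chan : Type u} {Own : Type v} [DecidableEq Chan] [DecidableEq Own]

/-- One internal action, without its weight. -/
def Tau (C D : CostEnv Chan Own × Sys Chan Own 0) : Prop :=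
  Step C.1 C.2 .tau D.1 D.2

theorem AStep.weight {O : Set Own} {C D : CostEnv Chan Own × Sys Chan Own 0}
    {μ : ALabel Chan Own} {w : ℤ} (h : AStep O C μ w D) : w = D.1.record - C.1.record := by
  cases h <;> rfl

theorem aStep_tau_iff {O : Set Own} {C D : CostEnv Chan Own × Sys Chan Own 0} {w : ℤ} :
    AStep O C .tau w D ↔ Tau C D ∧ w = D.1.record - C.1.record := by
  constructor
  · intro h
    cases h with
    | tau h => exact ⟨h, rfl⟩
  · rintro ⟨h, rfl⟩
    exact AStep.tau h

/-- Weights telescope: the weight of a weak action is the difference of the records. -/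
theorem weak_iff {O : Set Own} {C D : CostEnv Chan Own × Sys Chan Own 0} {μ : ALabel Chan Own}
    {w : ℤ} : Weak .tau (AStep O) C μ w D ↔
      w = D.1.record - C.1.record ∧ ∃ C' D' z, Relation.ReflTransGen Tau C C' ∧
        AStep O C' μ z D' ∧ Relation.ReflTransGen Tau D' D := by
  constructor
  · intro h
    induction h with
    | base h => exact ⟨h.weight, _, _, _, .refl, h, .refl⟩
    | right _ h ih =>
      obtain ⟨rfl, C', D', z, h1, h2, h3⟩ := ih
      rw [aStep_tau_iff] at h
      exact ⟨by rw [h.2]; ring, C', D', z, h1, h2, h3.tail h.1⟩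
    | left h _ ih =>
      obtain ⟨rfl, C', D', z, h1, h2, h3⟩ := ih
      rw [aStep_tau_iff] at h
      exact ⟨by rw [h.2]; ring, C', D', z, .head h.1 h1, h2, h3⟩
  · rintro ⟨rfl, C', D', z, h1, h2, h3⟩
    have key : Weak .tau (AStep O) C' μ (D.1.record - C'.1.record) D := by
      induction h3 with
      | refl => exact h2.weight ▸ .base h2
      | @tail E E' _ h ih =>
        have := Weak.right ih (aStep_tau_iff.2 ⟨h, rfl⟩)
        rwa [show E.1.record - C'.1.record + (E'.1.record - E.1.record) =
          E'.1.record - C'.1.record by ring] at this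
    induction h1 using Relation.ReflTransGen.head_induction_on with
    | refl => exact key
    | @head E E' h _ ih =>
      have := Weak.left (aStep_tau_iff.2 ⟨h, rfl⟩) ih
      rwa [show E'.1.record - E.1.record + (D.1.record - E'.1.record) =
        D.1.record - E.1.record by ring] at this

end

/-! ### Absence and presence of barbs -/

section

variable {Chan : Type u} {Own : Type v}

/-- A communication prefix that is not an output on `s`. -/
def Proc.Stuck (s : Chan) {n m : ℕ} : Proc Chan n m → Prop
  | .inp _ _ => True
  | .out a _ _ => a ≠ .chan s
  | _ => False

variable [DecidableEq Chan]

/-- The name `s` occurs only below communication prefixes of owners in `D`. If the owners in `D`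
have no funds, these prefixes cannot be executed, so that no output on `s` ever appears. -/
def Sys.Frozen (s : Chan) (D : Set Own) : {n : ℕ} → Sys Chan Own n → Prop
  | _, .owned o T => s ∉ T.fn ∨ o ∈ D ∧ T.Stuck s
  | _, .par M N => Frozen s D M ∧ Frozen s D N
  | _, .new _ M => Frozen s D M
  | _, .zero => True

namespace Sys

variable {s : Chan} {D : Set Own}

theorem Frozen.of_notMem {n : ℕ} {M : Sys Chan Own n} (h : s ∉ M.fn) : M.Frozen s D := by
  induction M with
  | owned o T => exact Or.inl h
  | par M N ih1 ih2 =>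
    simp only [fn, Finset.mem_union, not_or] at h
    exact ⟨ih1 h.1, ih2 h.2⟩
  | new R M ih => exact ih h
  | zero => trivial

theorem Frozen.map {n : ℕ} {M : Sys Chan Own n} (h : M.Frozen s D) :
    ∀ {n' : ℕ} {f : Ident Chan n → Ident Chan n'}, (∀ x, f x = .chan s → x = .chan s) →
      (M.map f).Frozen s D := by
  have key : ∀ {n : ℕ} {x : Ident Chan n}, s ∈ x.names → x = .chan s := by
    intro n x hx
    cases x <;> simp_all [Ident.names]
  induction M with
  | owned o T =>
    intro n' f hf
    rcases h with h | ⟨ho, h⟩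
    · refine Or.inl fun hs => h ?_
      rcases Proc.mem_fn_map T hs with ⟨d, hd, hs⟩ | ⟨i, hs⟩
      · cases hf _ (key hs)
        exact hd
      · cases hf _ (key hs)
    · refine Or.inr ⟨ho, ?_⟩
      cases T with
      | inp a T => trivial
      | out a w T => exact fun e => h (hf a e)
      | _ => exact h
  | par M N ih1 ih2 => intro n' f hf; exact ⟨ih1 h.1 hf, ih2 h.2 hf⟩
  | new R M ih =>
    intro n' f hf
    refine ih h fun x hx => ?_
    have shift : ∀ {n : ℕ} {y : Ident Chan n}, y.shift = .chan s → y = .chan s := by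
      intro n y hy
      cases y <;> simp_all [Ident.shift]
    cases x with
    | chan c =>
      have := hf (.chan c) (shift hx)
      simpa using this
    | var i =>
      cases i using Fin.cases with
      | zero => cases hx
      | succ j => cases hf (.var j) (shift hx)
  | zero => intros; trivial

theorem Frozen.inst {b : Chan} {M : Sys Chan Own 1} (h : M.Frozen s D) (hb : b ≠ s) :
    (M.inst b).Frozen s D := by
  refine h.map fun x hx => ?_
  cases x <;> simp_all [Ident.inst]

theorem frozen_nu {b : Chan} {R : ResType} {M : Sys Chan Own 0} :
    (nu b R M).Frozen s D ↔ b = s ∨ M.Frozen s D := by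
  constructor
  · intro h
    by_cases hb : b = s
    · exact Or.inl hb
    · have : ((M.map (Ident.bind b)).inst b).Frozen s D := Frozen.inst h hb
      rw [map_bind_inst] at this
      exact Or.inr this
  · rintro (rfl | h)
    · exact Frozen.of_notMem fun h => (mem_fn_nu.1 h).1 rfl
    · refine Frozen.map h fun x hx => ?_
      cases x with
      | chan c =>
        simp only [Ident.bind] at hx
        split_ifs at hx
        cases hx
        rfl
      | var i => exact i.elim0

theorem frozen_nus {cs : List (Chan × ResType)} {M : Sys Chan Own 0} (hs : s ∉ cs.map Prod.fst)
    (h : (nus cs M).Frozen s D) : M.Frozen s D := by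
  induction cs with
  | nil => exact h
  | cons c cs ih =>
    simp only [List.map_cons, List.mem_cons, not_or] at hs
    exact ih hs.2 ((frozen_nu.1 h).resolve_left (Ne.symm hs.1))

end Sys

theorem Struct.frozen_iff {s : Chan} {D : Set Own} {M N : Sys Chan Own 0} (h : Struct M N) :
    M.Frozen s D ↔ N.Frozen s D := by
  induction h with
  | refl => rfl
  | symm _ ih => exact ih.symm
  | trans _ _ ih1 ih2 => exact ih1.trans ih2
  | par _ _ ih1 ih2 => exact and_congr ih1 ih2
  | nu r R _ ih => rw [Sys.frozen_nu, Sys.frozen_nu, ih]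
  | extr r R M N hr =>
    have hM : r = s → M.Frozen s D := fun e => .of_notMem (e ▸ hr)
    simp only [Sys.frozen_nu, Sys.Frozen]
    tauto
  | com => exact and_comm
  | assoc => exact and_assoc
  | zero => simp [Sys.Frozen]
  | nil => simp [Sys.Frozen, Proc.fn]
  | flip r r' R R' M h =>
    simp only [Sys.frozen_nu]
    tauto
  | gc => exact Iff.rfl

theorem Struct.nus {M N : Sys Chan Own 0} (h : Struct M N) :
    ∀ rs : List (Chan × ResType), Struct (.nus rs M) (.nus rs N)
  | [] => h
  | r :: rs => .nu r.1 r.2 (h.nus rs)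

variable [DecidableEq Own]

theorem Red.res_eq {Γ Δ : CostEnv Chan Own} {M N : Sys Chan Own 0} (h : Red Γ M Δ N) :
    Δ.res = Γ.res := by
  induction h with
  | comm Q P hc => exact hc.res_eq
  | struct _ _ _ ih => exact ih
  | par _ _ ih => exact ih
  | new h1 h2 h3 _ ih => exact CostEnv.extend_res_inj h3 h2 ih
  | _ => rfl

theorem Red.funds_isSome {Γ Δ : CostEnv Chan Own} {M N : Sys Chan Own 0} (h : Red Γ M Δ N)
    (o : Own) : (Δ.funds o).isSome = (Γ.funds o).isSome := by
  induction h with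
  | comm Q P hc => exact hc.funds_isSome o
  | struct _ _ _ ih => exact ih
  | par _ _ ih => exact ih
  | new h1 h2 h3 _ ih => exact ih
  | _ => rfl

theorem Red.frozen {s : Chan} {D : Set Own} {Γ Δ : CostEnv Chan Own} {M N : Sys Chan Own 0}
    (h : Red Γ M Δ N) (hs : s ∈ Γ.dom) (hD : ∀ o ∈ D, (Γ.funds o).isSome = false)
    (hM : M.Frozen s D) : N.Frozen s D := by
  induction h with
  | @comm Γ Δ u p a b Q P hc =>
    obtain ⟨h1, h2⟩ := hM
    have h1 := h1.resolve_right fun h => by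
      have := hD _ h.1
      rw [hc.user_isSome] at this
      cases this
    have h2 := h2.resolve_right fun h => by
      have := hD _ h.1
      rw [hc.provider_isSome] at this
      cases this
    simp only [Proc.fn, Ident.names, Finset.mem_union, Finset.mem_singleton, not_or] at h1 h2
    refine ⟨Or.inl h1.2, Or.inl fun h => ?_⟩
    rcases Finset.mem_insert.1 (Proc.fn_inst_subset _ _ h) with h | h
    · exact h1.1.2 h
    · exact h2.2 h
  | split Γ o P Q =>
    have := hM.resolve_right And.right
    simp only [Proc.fn, Finset.mem_union, not_or] at this
    exact ⟨Or.inl this.1, Or.inl this.2⟩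
  | extrude Γ o R P => exact Or.inl (hM.resolve_right And.right)
  | unwind Γ o T => exact Or.inl fun h => hM.resolve_right And.right (Proc.fn_unfold_subset T h)
  | eq | ne =>
    have := hM.resolve_right And.right
    simp only [Proc.fn, Finset.mem_union, not_or] at this
    exact Or.inl (by tauto)
  | struct h1 _ h2 ih => exact h2.frozen_iff.1 (ih hs hD (h1.frozen_iff.2 hM))
  | par _ _ ih => exact ⟨ih hs hD hM.1, hM.2⟩
  | new h1 h2 h3 _ ih =>
    exact Sys.frozen_nu.2 (Or.inr (ih (CostEnv.mem_dom_extend.2 (Or.inr hs)) hD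
      (Sys.Frozen.inst hM fun e => h2 (e ▸ hs))))

theorem not_barbOut_of_frozen {s : Chan} {D : Set Own} {Γ : CostEnv Chan Own}
    {M : Sys Chan Own 0} (hs : s ∈ Γ.dom) (hD : ∀ o ∈ D, (Γ.funds o).isSome = false)
    (hM : M.Frozen s D) : ¬ BarbOut Γ M s := by
  rintro ⟨Δ, N, h, cs, o, b, T, N', hN, hcs, p, Δ', hc⟩
  have key : ∀ C : CostEnv Chan Own × Sys Chan Own 0,
      Relation.ReflTransGen (fun C D => Red C.1 C.2 D.1 D.2) (Γ, M) C →
      C.1.dom = Γ.dom ∧ (∀ o ∈ D, (C.1.funds o).isSome = false) ∧ C.2.Frozen s D := by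
    intro C h
    induction h with
    | refl => exact ⟨rfl, hD, hM⟩
    | tail _ h ih =>
      obtain ⟨h1, h2, h3⟩ := ih
      exact ⟨(CostEnv.dom_congr h.res_eq).trans h1,
        fun o ho => (h.funds_isSome o).trans (h2 o ho), h.frozen (h1 ▸ hs) h2 h3⟩
  obtain ⟨_, h2, h3⟩ := key _ h
  have := (Sys.frozen_nus hcs (hN.frozen_iff.1 h3)).1
  rcases this with h | ⟨h, h'⟩
  · exact h (by simp [Proc.fn, Ident.names])
  · exact h' rfl

theorem not_barbOut_of_notMem {s : Chan} {Γ : CostEnv Chan Own} {M : Sys Chan Own 0}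
    (hs : s ∈ Γ.dom) (hM : s ∉ M.fn) : ¬ BarbOut Γ M s :=
  not_barbOut_of_frozen (D := ∅) hs (by simp) (.of_notMem hM)

theorem barbOut_of_struct {a b : Chan} {o : Own} {T : Proc Chan 0 0} {Γ : CostEnv Chan Own}
    {M N : Sys Chan Own 0} {cs : List (Chan × ResType)} (ha : Γ.res a = some ⟨0, 0⟩)
    (ho : (Γ.funds o).isSome)
    (hM : Struct M (.nus cs (.par (.owned o (.out (.chan a) (.chan b) T)) N)))
    (hcs : a ∉ cs.map Prod.fst) : BarbOut Γ M a :=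
  ⟨Γ, M, .refl, cs, o, b, T, N, hM, hcs, o, Γ, CostEnv.charge_free ha ho ho⟩

end

/-! ### Tests and the systems under test -/

section

variable {Chan : Type u} {Own : Type v}

theorem CostEnv.fresh_testResources_iff {Γ : CostEnv Chan Own} {succ fail req : Chan} :
    Γ.Fresh (testResources succ fail req) ↔
      [succ, fail, req].Nodup ∧ ∀ r ∈ [succ, fail, req], r ∉ Γ.dom := by
  simp [CostEnv.Fresh, testResources]

theorem ALabel.bn_nodup (μ : ALabel Chan Own) : μ.bn.Nodup := by
  cases μ with
  | tau => exact List.nodup_nil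
  | inp u t a b => cases t <;> simp [ALabel.bn, bindings]
  | out bound a b p => cases bound <;> simp [ALabel.bn]
  | ext u k p => exact List.nodup_nil

variable [DecidableEq Chan]

theorem CostEnv.withFunds_extendAll_eq {Γ E : CostEnv Chan Own} {bs : List (Chan × ResType)}
    (h : E.res = (Γ.extendAll bs).res) : (Γ.withFunds E).extendAll bs = E := by
  refine CostEnv.ext_fields ?_ (by simp) (by simp)
  rw [h]
  exact CostEnv.extendAll_res_eq bs rfl

theorem CostEnv.extendAll_extendAll_res {Γ : CostEnv Chan Own} {ts rs : List (Chan × ResType)}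
    {c : Chan} (h : c ∉ ts.map Prod.fst) :
    ((Γ.extendAll ts).extendAll rs).res c = (Γ.extendAll rs).res c :=
  CostEnv.extendAll_res_congr rs (CostEnv.extendAll_res_of_notMem ts h)

theorem CostEnv.res_testResources {Γ : CostEnv Chan Own} {succ fail req : Chan}
    (h : [succ, fail, req].Nodup) :
    (Γ.extendAll (testResources succ fail req)).res succ = some ⟨0, 0⟩ ∧
      (Γ.extendAll (testResources succ fail req)).res fail = some ⟨0, 0⟩ := by
  simp only [List.nodup_cons, List.mem_cons, not_or] at h
  simp [CostEnv.extendAll, testResources, CostEnv.extend_res, h, Function.update]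

variable [DecidableEq Own]

/-- An action under `Θ` is possible under each `Γ` that agrees with `Θ` on the funds, the record and
the costs of the free names, and it changes the funds and the record in the same way. -/
theorem Step.change_env [Infinite Chan] {Θ Θ' Γ : CostEnv Chan Own} {M M' : Sys Chan Own 0}
    {l : Label Chan Own} (h : Step Θ M l Θ' M') (hf : Γ.funds = Θ.funds)
    (hr : Γ.record = Θ.record) (hM : ∀ c ∈ M.fn, Γ.res c = Θ.res c)
    (hi : ∀ u a b p, l = .inp u none a b p → b ∈ Γ.dom) (hn : ∀ b ∈ l.bn, b ∉ Γ.dom) :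
    Step Γ M l ((Γ.withFunds Θ').extendAll l.binds) M' :=
  h.change_res hf hr (by simp) (by simp) (CostEnv.extendAll_res_eq _ rfl) hM hi hn

theorem Step.isConfig {Γ Γ' : CostEnv Chan Own} {M M' : Sys Chan Own 0} {l : Label Chan Own}
    (h : Step Γ M l Γ' M') (hM : IsConfig Γ M) : IsConfig Γ' M' := by
  intro c hc
  rw [CostEnv.dom_congr h.res_eq, CostEnv.mem_dom_extendAll, ← Label.bn_eq]
  rcases h.fn_subset c hc with hc | hc
  · exact Or.inr (hM c hc)
  · cases l with
    | tau => simp [Label.names] at hc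
    | inp u t a b p =>
      simp only [Label.names, Finset.mem_insert, Finset.mem_singleton] at hc
      rcases hc with rfl | rfl
      · exact Or.inr (hM _ (h.charge rfl).1)
      · cases t with
        | none => exact Or.inr (h.value_mem_dom rfl)
        | some R => exact Or.inl (by simp [Label.bn, bindings])
    | out u t a b p =>
      simp only [Label.names, Finset.mem_insert, Finset.mem_singleton] at hc
      rcases hc with rfl | rfl
      · exact Or.inr (hM _ (h.charge rfl).1)
      · cases t with
        | none => exact Or.inr (hM _ (h.value_mem_fn rfl))
        | some R => exact Or.inl (by simp [Label.bn, bindings])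

theorem tau_star_invariant {C D : CostEnv Chan Own × Sys Chan Own 0}
    (h : Relation.ReflTransGen Tau C D) :
    D.1.res = C.1.res ∧ (IsConfig C.1 C.2 → IsConfig D.1 D.2) ∧
      ∀ o, (D.1.funds o).isSome = (C.1.funds o).isSome := by
  induction h with
  | refl => exact ⟨rfl, id, fun _ => rfl⟩
  | tail _ h ih =>
    exact ⟨h.res_eq_of_tau.trans ih.1, fun hc => h.isConfig (ih.2.1 hc),
      fun o => (h.funds_isSome o).trans (ih.2.2 o)⟩

/-- A communication between `M` and `T` that takes `Θ ▷ M | T` to `E ▷ X`. -/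
def Interact (Θ : CostEnv Chan Own) (M T : Sys Chan Own 0) (E : CostEnv Chan Own)
    (X : Sys Chan Own 0) : Prop :=
  ∃ u t a b p M' T', E.Fresh (bindings b t) ∧ X = Sys.nus (bindings b t) (.par M' T') ∧
    (Step Θ M (.inp u t a b p) (E.extendAll (bindings b t)) M' ∧
        Step Θ T (.out u t a b p) (E.extendAll (bindings b t)) T' ∨
      Step Θ M (.out u t a b p) (E.extendAll (bindings b t)) M' ∧
        Step Θ T (.inp u t a b p) (E.extendAll (bindings b t)) T')

/-- The internal actions of two parallel components. -/
theorem Step.par_tau_inv {Θ E : CostEnv Chan Own} {M T X : Sys Chan Own 0}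
    (h : Step Θ (.par M T) .tau E X) :
    (∃ M', X = .par M' T ∧ Step Θ M .tau E M') ∨ (∃ T', X = .par M T' ∧ Step Θ T .tau E T') ∨
      Interact Θ M T E X := by
  generalize hl : (Label.tau : Label Chan Own) = l at h
  cases h with
  | parL _ _ h => subst hl; exact Or.inl ⟨_, rfl, h⟩
  | parR _ _ h => subst hl; exact Or.inr (Or.inl ⟨_, rfl, h⟩)
  | commL hf h1 h2 => exact Or.inr (Or.inr ⟨_, _, _, _, _, _, _, hf, rfl, Or.inl ⟨h1, h2⟩⟩)
  | commR hf h1 h2 => exact Or.inr (Or.inr ⟨_, _, _, _, _, _, _, hf, rfl, Or.inr ⟨h1, h2⟩⟩)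

/-- The configurations to which a test for `μ` is applied. -/
structure Admissible (μ : ALabel Chan Own) (succ fail req : Chan) (F : Finset Chan)
    (Γ : CostEnv Chan Own) (M : Sys Chan Own 0) : Prop where
  config : IsConfig Γ M
  dom_subset : Γ.dom ⊆ (F : Set Chan)
  fresh : Γ.Fresh (testResources succ fail req)
  bn_fresh : ∀ r ∈ μ.bn, r ∉ Γ.dom

/-- The test can output on `fail` right away. -/
def Failing (fail : Chan) (o : Own) (T : Sys Chan Own 0) : Prop :=
  ∃ U, Struct T (.par (.owned o (.out (.chan fail) (.chan fail) .nil)) U)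

/-- The states in `G` of a test interact with the outside on `succ` and `fail` only, and cannot be
left by internal actions, which moreover are free of charge. -/
def Secluded (succ fail : Chan) (G : Sys Chan Own 0 → Prop) : Prop :=
  ∀ T Θ l Θ' T', G T → Θ.res fail = some ⟨0, 0⟩ → Step Θ T l Θ' T' →
    (l = .tau → Θ' = Θ ∧ G T') ∧ ∀ u a p, l.core = some (u, a, p) → a = succ ∨ a = fail

/-- Internal actions that are free of charge. -/
def TestRun (Θ : CostEnv Chan Own) : Sys Chan Own 0 → Sys Chan Own 0 → Prop :=
  Relation.ReflTransGen fun T T' => Step Θ T .tau Θ T'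

/-- `T` is a test for `μ`, run by `o`, with `Good` the states of `T` in which `μ` has been observed,
and `Bad` those in which a different action has. A good state will report success, but it announces
failure until it has done its internal work; a bad state announces failure forever. -/
structure IsTest (O : Set Own) (μ : ALabel Chan Own) (succ fail req : Chan) (F : Finset Chan)
    (T : Sys Chan Own 0) (o : Own) (Good Bad : Sys Chan Own 0 → Prop) : Prop where
  owner : o ∈ O
  failing : Failing fail o T
  /-- An owner `o` without funds cannot announce failure, but then it cannot report success
  either. -/
  frozen : T.Frozen succ {o}
  good_secluded : Secluded succ fail Good
  bad_secluded : Secluded succ fail Bad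
  good : ∀ T', Good T' →
    Struct T' (.owned o (.out (.chan succ) (.chan (μ.bn.headD succ)) .nil)) ∨ Failing fail o T'
  bad : ∀ T', Bad T' → Failing fail o T'
  /-- Every action of the test on its own or with an admissible system `M` is due to an action `μ`
  of `M`, or puts the test into a bad state. It also shows that `o` has funds. -/
  sound : ∀ {Γ : CostEnv Chan Own} {M : Sys Chan Own 0} {E : CostEnv Chan Own}
    {X : Sys Chan Own 0}, Admissible μ succ fail req F Γ M →
    ((∃ T', X = .par M T' ∧ Step (Γ.extendAll (testResources succ fail req)) T .tau E T') ∨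
      Interact (Γ.extendAll (testResources succ fail req)) M T E X) →
    (E.funds o).isSome ∧
    ((∃ rs N T' z, rs.map Prod.fst = μ.bn ∧ X = Sys.nus rs (.par N T') ∧ Good T' ∧
        AStep O (Γ, M) μ z ((Γ.withFunds E).extendAll rs, N)) ∨
      ∃ rs N T', E.Fresh rs ∧ X = Sys.nus rs (.par N T') ∧ Bad T' ∧ succ ∉ N.fn ∧ fail ∉ N.fn)
  /-- Every action `μ` of an admissible system lets the test succeed. -/
  complete : ∀ {Γ : CostEnv Chan Own} {M : Sys Chan Own 0} {Γ' : CostEnv Chan Own}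
    {M' : Sys Chan Own 0} {z : ℤ}, Admissible μ succ fail req F Γ M →
    AStep O (Γ, M) μ z (Γ', M') →
    ∃ rs T₁ T₂, rs.map Prod.fst = μ.bn ∧ Γ'.res = (Γ.extendAll rs).res ∧ (Γ.funds o).isSome ∧
      Step (Γ.extendAll (testResources succ fail req)) (.par M T) .tau
        ((Γ.withFunds Γ').extendAll (testResources succ fail req)) (Sys.nus rs (.par M' T₁)) ∧
      TestRun (((Γ.withFunds Γ').extendAll (testResources succ fail req)).extendAll rs) T₁ T₂ ∧
      Struct T₂ (.owned o (.out (.chan succ) (.chan (μ.bn.headD succ)) .nil)) ∧ fail ∉ T₂.fn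

/-- The internal actions of a configuration are the same with and without additional resources. -/
theorem Step.weaken_iff [Infinite Chan] {ts rs : List (Chan × ResType)}
    {Δ Δ' : CostEnv Chan Own} {N N' : Sys Chan Own 0} (hN : IsConfig (Δ.extendAll rs) N)
    (hts : ∀ r ∈ ts.map Prod.fst, r ∉ (Δ.extendAll rs).dom) (hd : Δ'.res = Δ.res) :
    Step (Δ.extendAll rs) N .tau (Δ'.extendAll rs) N' ↔
      Step ((Δ.extendAll ts).extendAll rs) N .tau ((Δ'.extendAll ts).extendAll rs) N' := by
  have key : ∀ c ∈ N.fn, ((Δ.extendAll ts).extendAll rs).res c = (Δ.extendAll rs).res c :=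
    fun c hc => CostEnv.extendAll_extendAll_res fun h => hts c h (hN c hc)
  constructor
  · intro h
    exact h.change_res (by simp) (by simp) (by simp) (by simp)
      (CostEnv.extendAll_res_eq rs (CostEnv.extendAll_res_eq ts hd)) key (by simp)
      (by simp [Label.bn])
  · intro h
    exact h.change_res (by simp) (by simp) (by simp) (by simp)
      (CostEnv.extendAll_res_eq rs hd) (fun c hc => (key c hc).symm) (by simp)
      (by simp [Label.bn])

/-- Internal actions of a system are possible next to a test. -/
theorem tau_star_beside [Infinite Chan] {ts rs : List (Chan × ResType)} {Δ : CostEnv Chan Own}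
    {N T : Sys Chan Own 0} (hN : IsConfig (Δ.extendAll rs) N)
    (hts : ∀ r ∈ ts.map Prod.fst, r ∉ (Δ.extendAll rs).dom) (hrs : (Δ.extendAll ts).Fresh rs)
    {D : CostEnv Chan Own × Sys Chan Own 0}
    (h : Relation.ReflTransGen Tau (Δ.extendAll rs, N) D) :
    Relation.ReflTransGen Tau (Δ.extendAll ts, .nus rs (.par N T))
      ((Δ.withFunds D.1).extendAll ts, .nus rs (.par D.2 T)) := by
  have e0 : Δ.withFunds (Δ.extendAll rs) = Δ := CostEnv.ext_fields rfl (by simp) (by simp)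
  induction h with
  | refl => simp only [e0]; exact .refl
  | @tail D D' h1 h ih =>
    refine ih.tail ?_
    obtain ⟨h2, h3, -⟩ := tau_star_invariant h1
    have hD := CostEnv.withFunds_extendAll_eq h2
    have hD' := CostEnv.withFunds_extendAll_eq (h.res_eq_of_tau.trans h2)
    have hf : ∀ E : CostEnv Chan Own, ((Δ.withFunds E).extendAll ts).Fresh rs := fun E =>
      ⟨hrs.1, fun b hb => by
        rw [CostEnv.dom_congr (Γ := (Δ.withFunds E).extendAll ts) (Δ := Δ.extendAll ts)
          (CostEnv.extendAll_res_eq ts rfl)]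
        exact hrs.2 b hb⟩
    refine Step.nus (hf _) (hf _) (Step.parL _ (by simp [Label.bn]) ?_)
    refine (Step.weaken_iff (Δ := Δ.withFunds D.1) (Δ' := Δ.withFunds D'.1) ?_ ?_ rfl).1 ?_
    · rw [hD]
      exact h3 hN
    · rw [hD, CostEnv.dom_congr h2]
      exact hts
    · rw [hD, hD']
      exact h

/-- Internal actions of a test are possible next to a system. -/
theorem TestRun.beside {rs : List (Chan × ResType)} {E : CostEnv Chan Own}
    {N T T' : Sys Chan Own 0} (hrs : E.Fresh rs) (h : TestRun (E.extendAll rs) T T') :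
    Relation.ReflTransGen Tau (E, .nus rs (.par N T)) (E, .nus rs (.par N T')) := by
  induction h with
  | refl => exact .refl
  | tail _ h ih => exact ih.tail (Step.nus hrs hrs (Step.parR _ (by simp [Label.bn]) h))

end

section

variable {Chan : Type u} {Own : Type v} [DecidableEq Chan]

theorem CostEnv.extendAll_inj : ∀ {rs rs' : List (Chan × ResType)} {Γ Δ : CostEnv Chan Own},
    rs.map Prod.fst = rs'.map Prod.fst → Γ.Fresh rs → Δ.Fresh rs' →
    (Γ.extendAll rs).res = (Δ.extendAll rs').res → rs = rs' ∧ Γ.res = Δ.res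
  | [], [], _, _, _, _, _, h => ⟨rfl, h⟩
  | [], _ :: _, _, _, hn, _, _, _ => by simp at hn
  | _ :: _, [], _, _, hn, _, _, _ => by simp at hn
  | r :: rs, r' :: rs', Γ, Δ, hn, h1, h2, h => by
    simp only [List.map_cons, List.cons.injEq] at hn
    obtain ⟨rfl, h'⟩ := CostEnv.extendAll_inj hn.2 h1.cons.2 h2.cons.2 h
    obtain ⟨c, R⟩ := r
    obtain ⟨c', R'⟩ := r'
    obtain rfl : c = c' := hn.1
    obtain rfl : R = R' := by
      have := congrFun h' c
      simpa using this
    exact ⟨rfl, CostEnv.extend_res_inj h1.cons.1 h2.cons.1 h'⟩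

theorem Sys.fn_nus_subset (rs : List (Chan × ResType)) (M : Sys Chan Own 0) :
    (Sys.nus rs M).fn ⊆ M.fn := by
  induction rs with
  | nil => exact fun _ h => h
  | cons r rs ih => exact fun _ h => ih (Sys.mem_fn_nu.1 h).2

variable {μ : ALabel Chan Own} {succ fail req : Chan} {F : Finset Chan}
  {Γ : CostEnv Chan Own} {M T : Sys Chan Own 0}

theorem Admissible.congr (h : Admissible μ succ fail req F Γ M) {Γ' : CostEnv Chan Own}
    {M' : Sys Chan Own 0} (hr : Γ'.res = Γ.res) (hc : IsConfig Γ' M') :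
    Admissible μ succ fail req F Γ' M' where
  config := hc
  dom_subset := CostEnv.dom_congr hr ▸ h.dom_subset
  fresh := ⟨h.fresh.1, CostEnv.dom_congr hr ▸ h.fresh.2⟩
  bn_fresh := CostEnv.dom_congr hr ▸ h.bn_fresh

theorem Admissible.fresh_extendAll (h : Admissible μ succ fail req F Γ M)
    (hbn : ∀ r ∈ μ.bn, r ∉ [succ, fail, req]) {rs : List (Chan × ResType)}
    (hrs : rs.map Prod.fst = μ.bn) {Δ : CostEnv Chan Own} (hΔ : Δ.res = Γ.res) :
    (Δ.extendAll (testResources succ fail req)).Fresh rs ∧ Δ.Fresh rs ∧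
      Δ.Fresh (testResources succ fail req) ∧
      ∀ r ∈ (testResources succ fail req).map Prod.fst, r ∉ (Δ.extendAll rs).dom := by
  have hd : Δ.dom = Γ.dom := CostEnv.dom_congr hΔ
  have hr : ∀ b ∈ rs, b.1 ∈ μ.bn := fun b hb => hrs ▸ List.mem_map_of_mem hb
  have hn := (CostEnv.fresh_testResources_iff.1 h.fresh).2
  refine ⟨⟨hrs ▸ μ.bn_nodup, fun b hb => ?_⟩, ⟨hrs ▸ μ.bn_nodup, fun b hb => ?_⟩,
    ⟨h.fresh.1, hd ▸ h.fresh.2⟩, fun r hrt => ?_⟩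
  · rw [CostEnv.mem_dom_extendAll, hd]
    exact not_or.2 ⟨hbn _ (hr b hb), h.bn_fresh _ (hr b hb)⟩
  · rw [hd]
    exact h.bn_fresh _ (hr b hb)
  · rw [CostEnv.mem_dom_extendAll, hd, hrs]
    exact not_or.2 ⟨fun hb => hbn r hb hrt, hn r hrt⟩

variable [DecidableEq Own]

theorem AStep.isConfig {O : Set Own} {C D : CostEnv Chan Own × Sys Chan Own 0}
    {z : ℤ} (h : AStep O C μ z D) (hC : IsConfig C.1 C.2) :
    IsConfig D.1 D.2 := by
  cases h with
  | tau h => exact h.isConfig hC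
  | inp _ h => exact h.isConfig hC
  | out _ h => exact h.isConfig hC
  | ext _ _ _ h =>
    obtain ⟨x, y, _, _, _, rfl⟩ := h
    exact hC

variable {O : Set Own} {o : Own} {Good Bad : Sys Chan Own 0 → Prop}

/-- A weak action `μ` of the system lets the test succeed. -/
theorem IsTest.success_of_weak [Infinite Chan] (ht : IsTest O μ succ fail req F T o Good Bad)
    (ha : Admissible μ succ fail req F Γ M) (hbn : ∀ r ∈ μ.bn, r ∉ [succ, fail, req])
    {Δ : CostEnv Chan Own} {rs : List (Chan × ResType)} {N : Sys Chan Own 0} {w : ℤ}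
    (hrs : rs.map Prod.fst = μ.bn) (hΔ : Δ.Fresh rs)
    (h : Weak .tau (AStep O) (Γ, M) μ w (Δ.extendAll rs, N)) :
    Δ.Fresh (testResources succ fail req) ∧ ∃ M' : Sys Chan Own 0,
      Weak .tau (AStep O) (Γ.extendAll (testResources succ fail req), .par M T) .tau w
        (Δ.extendAll (testResources succ fail req), M') ∧
      Struct M' (.nus rs (.par (success succ rs o) N)) ∧
      BarbOut (Δ.extendAll (testResources succ fail req)) M' succ ∧
      ¬ BarbOut (Δ.extendAll (testResources succ fail req)) M' fail := by
  obtain ⟨rfl, ⟨Γ₁, M₁⟩, ⟨Γ₂, M₂⟩, z, h1, h2, h3⟩ := weak_iff.1 h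
  obtain ⟨r1, c1, -⟩ := tau_star_invariant h1
  obtain ⟨r3, c3, f3⟩ := tau_star_invariant h3
  have ha1 : Admissible μ succ fail req F Γ₁ M₁ := ha.congr r1 (c1 ha.config)
  obtain ⟨rs', T₁, T₂, hrs', r2, ho, hs, hT, hT₂, hfT₂⟩ := ht.complete ha1 h2
  have hcN : IsConfig (Δ.extendAll rs) N := c3 (h2.isConfig ha1.config)
  have hres : (Δ.extendAll rs).res = (Γ₁.extendAll rs').res := r3.trans r2
  obtain ⟨-, fr1, -, -⟩ := ha1.fresh_extendAll hbn hrs' rfl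
  obtain ⟨rfl, hΔΓ⟩ := CostEnv.extendAll_inj (hrs.trans hrs'.symm) hΔ fr1 hres
  obtain ⟨-, -, fr2, fr3⟩ := ha1.fresh_extendAll hbn hrs hΔΓ
  obtain ⟨fr4, -, -, fr5⟩ := ha1.fresh_extendAll hbn hrs
    (Δ := Γ₁.withFunds Γ₂) rfl
  have hnd := (CostEnv.fresh_testResources_iff.1 fr2).1
  obtain ⟨hsucc, hfail⟩ := CostEnv.res_testResources (Γ := Δ) hnd
  have e1 : Γ.withFunds Γ₁ = Γ₁ := CostEnv.ext_fields r1.symm rfl rfl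
  have e2 : (Γ₁.withFunds Γ₂).extendAll rs = Γ₂ := CostEnv.withFunds_extendAll_eq r2
  have e3 : (Γ₁.withFunds Γ₂).withFunds (Δ.extendAll rs) = Δ :=
    CostEnv.ext_fields hΔΓ.symm (by simp) (by simp)
  have p1 := tau_star_beside (ts := testResources succ fail req) (rs := []) (T := T) ha.config
    (CostEnv.fresh_testResources_iff.1 ha.fresh).2 ⟨by simp, by simp⟩ h1
  simp only [e1] at p1
  have p3 := tau_star_beside (T := T₂) (ts := testResources succ fail req) (rs := rs)
    (Δ := Γ₁.withFunds Γ₂) (N := M₂) (D := (Δ.extendAll rs, N))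
    (by rw [e2]; exact h2.isConfig ha1.config) fr5 fr4 (by rw [e2]; exact h3)
  simp only [e3] at p3
  refine ⟨fr2, .nus rs (.par N T₂), weak_iff.2 ⟨by simp, _, _, _, p1, .tau hs,
    (hT.beside fr4).trans p3⟩, ?_, ?_⟩
  · refine Struct.nus ((Struct.com _ _).trans (Struct.par (hT₂.trans ?_) (.refl _))) rs
    rw [success, hrs]
    exact .refl _
  have hst : Struct (.nus rs (.par N T₂)) (.nus rs (.par
      (.owned o (.out (.chan succ) (.chan (μ.bn.headD succ)) .nil)) N)) :=
    Struct.nus ((Struct.com _ _).trans (Struct.par hT₂ (.refl _))) rs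
  refine ⟨barbOut_of_struct hsucc ?_ hst ?_, not_barbOut_of_notMem ?_ fun h => ?_⟩
  · have := f3 o
    have := hs.funds_isSome o
    simp_all
  · rw [hrs]
    exact fun h => hbn _ h (by simp)
  · simp [CostEnv.dom, hfail]
  · rcases Finset.mem_union.1 (Sys.fn_nus_subset _ _ h) with h | h
    · exact fr3 fail (by simp [testResources]) (hcN _ h)
    · exact hfT₂ h

/-- The states reached by a secluded test next to a system that does not know `succ` and `fail`. -/
theorem Secluded.step [Infinite Chan] {G : Sys Chan Own 0 → Prop} (hG : Secluded succ fail G)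
    {E E' : CostEnv Chan Own} {rs : List (Chan × ResType)} {N T X : Sys Chan Own 0} (hT : G T)
    (hrs : E.Fresh rs) (hf : E.res fail = some ⟨0, 0⟩) (hN : succ ∉ N.fn ∧ fail ∉ N.fn)
    (h : Step E (.nus rs (.par N T)) .tau E' X) :
    (∃ N', X = .nus rs (.par N' T) ∧ Step (E.extendAll rs) N .tau (E'.extendAll rs) N') ∨
      ∃ T', X = .nus rs (.par N T') ∧ E' = E ∧ G T' := by
  have hfr : fail ∉ rs.map Prod.fst := by
    intro h
    obtain ⟨b, hb, rfl⟩ := List.mem_map.1 h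
    exact hrs.2 b hb (by simp [CostEnv.dom, hf])
  have hf' : (E.extendAll rs).res fail = some ⟨0, 0⟩ := by
    rw [CostEnv.extendAll_res_of_notMem _ hfr, hf]
  have hno : ∀ {l Θ N' l' Θ' T' u a p}, Step (E.extendAll rs) N l Θ N' →
      Step (E.extendAll rs) T l' Θ' T' → l.core = some (u, a, p) → l'.core = some (u, a, p) →
      False := by
    intro l Θ N' l' Θ' T' u a p h1 h2 h3 h4
    have := (h1.charge h3).1
    rcases (hG _ _ _ _ _ hT hf' h2).2 u a p h4 with rfl | rfl
    · exact hN.1 this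
    · exact hN.2 this
  obtain ⟨Y, rfl, hs⟩ := Step.nus_inv hrs h
  rcases hs.par_tau_inv with ⟨N', rfl, h1⟩ | ⟨T', rfl, h1⟩ |
    ⟨u, t, a, b, p, N', T', -, -, ⟨h1, h2⟩ | ⟨h1, h2⟩⟩
  · exact Or.inl ⟨N', rfl, h1⟩
  · obtain ⟨h2, h3⟩ := (hG _ _ _ _ _ hT hf' h1).1 rfl
    refine Or.inr ⟨T', rfl, CostEnv.ext_fields h.res_eq_of_tau ?_ ?_, h3⟩
    · simpa using congrArg CostEnv.funds h2
    · simpa using congrArg CostEnv.record h2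
  · exact (hno h1 h2 rfl rfl).elim
  · exact (hno h1 h2 rfl rfl).elim

theorem Failing.barbOut {E : CostEnv Chan Own} {rs : List (Chan × ResType)} {N T : Sys Chan Own 0}
    (hT : Failing fail o T) (hrs : E.Fresh rs) (hf : E.res fail = some ⟨0, 0⟩)
    (ho : (E.funds o).isSome) : BarbOut E (.nus rs (.par N T)) fail := by
  obtain ⟨U, hU⟩ := hT
  refine barbOut_of_struct hf ho (b := fail) (T := .nil) (N := .par U N) (cs := rs)
    (Struct.nus ?_ rs) ?_
  · exact (Struct.com _ _).trans ((Struct.par hU (.refl _)).trans (Struct.assoc _ _ _))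
  · intro h
    obtain ⟨b, hb, rfl⟩ := List.mem_map.1 h
    exact hrs.2 b hb (by simp [CostEnv.dom, hf])

/-- If the test succeeds, then the system has performed a weak action `μ`. -/
theorem IsTest.weak_of_success [Infinite Chan] (ht : IsTest O μ succ fail req F T o Good Bad)
    (ha : Admissible μ succ fail req F Γ M) (hbn : ∀ r ∈ μ.bn, r ∉ [succ, fail, req])
    {E : CostEnv Chan Own} {X : Sys Chan Own 0} {w : ℤ}
    (h : Weak .tau (AStep O) (Γ.extendAll (testResources succ fail req), .par M T) .tau w (E, X))
    (hsucc : BarbOut E X succ) (hfail : ¬ BarbOut E X fail) :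
    ∃ (Δ : CostEnv Chan Own) (rs : List (Chan × ResType)) (N : Sys Chan Own 0),
      rs.map Prod.fst = μ.bn ∧ Δ.Fresh rs ∧ Δ.Fresh (testResources succ fail req) ∧
      E = Δ.extendAll (testResources succ fail req) ∧
      Struct X (.nus rs (.par (success succ rs o) N)) ∧
      Weak .tau (AStep O) (Γ, M) μ w (Δ.extendAll rs, N) := by
  have hnd := (CostEnv.fresh_testResources_iff.1 ha.fresh).1
  have hts := (CostEnv.fresh_testResources_iff.1 ha.fresh).2
  -- While the test waits, `M` runs alone; afterwards, the test is in a good or in a bad state.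
  have inv : ∀ D : CostEnv Chan Own × Sys Chan Own 0,
      Relation.ReflTransGen Tau (Γ.extendAll (testResources succ fail req), .par M T) D →
      ∃ Γ₀ : CostEnv Chan Own, D.1 = Γ₀.extendAll (testResources succ fail req) ∧
        Γ₀.res = Γ.res ∧
        ((∃ M₁, D.2 = .par M₁ T ∧ Relation.ReflTransGen Tau (Γ, M) (Γ₀, M₁)) ∨
        (∃ rs N T₁ C' D' z, rs.map Prod.fst = μ.bn ∧ D.2 = Sys.nus rs (.par N T₁) ∧ Good T₁ ∧
          Relation.ReflTransGen Tau (Γ, M) C' ∧ AStep O C' μ z D' ∧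
          Relation.ReflTransGen Tau D' (Γ₀.extendAll rs, N) ∧ IsConfig (Γ₀.extendAll rs) N ∧
          (Γ₀.funds o).isSome) ∨
        ∃ rs N T₁, D.1.Fresh rs ∧ D.2 = Sys.nus rs (.par N T₁) ∧ Bad T₁ ∧ succ ∉ N.fn ∧
          fail ∉ N.fn ∧ (D.1.funds o).isSome) := by
    intro D hD
    induction hD with
    | refl => exact ⟨Γ, rfl, rfl, Or.inl ⟨M, rfl, .refl⟩⟩
    | @tail D D' h0 h ih =>
      obtain ⟨E, X⟩ := D
      obtain ⟨E', X'⟩ := D'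
      obtain ⟨Γ₀, rfl, hr0, ih⟩ := ih
      have hr : E'.res = (Γ₀.extendAll (testResources succ fail req)).res := h.res_eq_of_tau
      have hE' := CostEnv.withFunds_extendAll_eq hr
      have hf0 := (CostEnv.res_testResources (Γ := Γ₀) hnd).2
      refine ⟨Γ₀.withFunds E', hE'.symm, hr0, ?_⟩
      rcases ih with ⟨M₁, rfl, h1⟩ | ⟨rs, N, T₁, C', D', z, hrs, rfl, hT₁, h1, h2, h3, hc, ho⟩ |
        ⟨rs, N, T₁, hrs, rfl, hT₁, hsN, hfN, ho⟩
      · have hc1 : IsConfig Γ₀ M₁ := (tau_star_invariant h1).2.1 ha.config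
        have ha1 : Admissible μ succ fail req F Γ₀ M₁ := ha.congr hr0 hc1
        rcases h.par_tau_inv with ⟨M', rfl, hM⟩ | hT
        · refine Or.inl ⟨M', rfl, h1.tail ?_⟩
          refine (Step.weaken_iff (ts := testResources succ fail req) (rs := [])
            (Δ' := Γ₀.withFunds E') hc1 (CostEnv.dom_congr hr0 ▸ hts) rfl).2 ?_
          rw [hE']
          exact hM
        · obtain ⟨ho, ⟨rs, N, T', z, hrs, rfl, hT', hμ⟩ | ⟨rs, N, T', hrs, rfl, hT', hN⟩⟩ :=
            ht.sound ha1 hT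
          · exact Or.inr (Or.inl ⟨rs, N, T', _, _, z, hrs, rfl, hT', h1, hμ, .refl,
              hμ.isConfig hc1, ho⟩)
          · exact Or.inr (Or.inr ⟨rs, N, T', hrs, rfl, hT', hN.1, hN.2, ho⟩)
      · obtain ⟨fr1, -, -, fr2⟩ := ha.fresh_extendAll hbn hrs hr0
        have hN : succ ∉ N.fn ∧ fail ∉ N.fn :=
          ⟨fun h => fr2 _ (by simp [testResources]) (hc _ h),
            fun h => fr2 _ (by simp [testResources]) (hc _ h)⟩
        refine Or.inr (Or.inl ?_)
        rcases Secluded.step ht.good_secluded hT₁ fr1 hf0 hN h with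
          ⟨N', rfl, hs⟩ | ⟨T', rfl, rfl, hT'⟩
        · rw [← hE'] at hs
          have hs' := (Step.weaken_iff (Δ' := Γ₀.withFunds E') hc fr2 rfl).2 hs
          have ho' := h.funds_isSome o
          exact ⟨rs, N', T₁, C', D', z, hrs, rfl, hT₁, h1, h2, h3.tail hs', hs'.isConfig hc, by
            simpa [ho] using ho'⟩
        · have e : Γ₀.withFunds (Γ₀.extendAll (testResources succ fail req)) = Γ₀ :=
            CostEnv.ext_fields rfl (by simp) (by simp)
          rw [e]
          exact ⟨rs, N, T', C', D', z, hrs, rfl, hT', h1, h2, h3, hc, ho⟩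
      · refine Or.inr (Or.inr ?_)
        have hrs' : E'.Fresh rs := ⟨hrs.1, CostEnv.dom_congr hr ▸ hrs.2⟩
        have ho' := (h.funds_isSome o).trans ho
        rcases Secluded.step ht.bad_secluded hT₁ hrs hf0 ⟨hsN, hfN⟩ h with
          ⟨N', rfl, hs⟩ | ⟨T', rfl, rfl, hT'⟩
        · have := hs.fn_subset_of_tau
          exact ⟨rs, N', T₁, hrs', rfl, hT₁, fun h => hsN (this h), fun h => hfN (this h), ho'⟩
        · exact ⟨rs, N, T', hrs', rfl, hT', hsN, hfN, ho'⟩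
  obtain ⟨rfl, C, D, z, h1, h2, h3⟩ := weak_iff.1 h
  obtain ⟨Γ₀, hE, hr0, hX⟩ := inv _ ((h1.tail (aStep_tau_iff.1 h2).1).trans h3)
  simp only at hE hX
  subst hE
  have hres := CostEnv.res_testResources (Γ := Γ₀) hnd
  rcases hX with ⟨M₁, rfl, h1⟩ | ⟨rs, N, T₁, C', D', z, hrs, rfl, hT₁, h1, h2, h3, hc, ho⟩ |
    ⟨rs, N, T₁, hrs, rfl, hT₁, hsN, hfN, ho⟩
  · -- The test has not moved, so it announces failure, unless its owner has no funds.
    exfalso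
    by_cases ho : ((Γ₀.extendAll (testResources succ fail req)).funds o).isSome
    · exact hfail (ht.failing.barbOut (rs := []) ⟨by simp, by simp⟩ hres.2 ho)
    · have hM₁ : succ ∉ M₁.fn := fun h => hts succ (by simp)
        (CostEnv.dom_congr hr0 ▸ (tau_star_invariant h1).2.1 ha.config _ h)
      have hfr : (Sys.par M₁ T).Frozen succ {o} := ⟨.of_notMem hM₁, ht.frozen⟩
      refine not_barbOut_of_frozen ?_ ?_ hfr hsucc
      · simp [CostEnv.dom, hres.1]
      · rintro _ rfl
        simpa using ho
  · obtain ⟨fr1, fr2, fr3, -⟩ := ha.fresh_extendAll hbn hrs hr0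
    rcases ht.good T₁ hT₁ with hT | hT
    · refine ⟨Γ₀, rs, N, hrs, fr2, fr3, rfl, ?_, weak_iff.2 ⟨by simp, C', D', z, h1, h2, h3⟩⟩
      refine Struct.nus ((Struct.com _ _).trans (Struct.par (hT.trans ?_) (.refl _))) rs
      rw [success, hrs]
      exact .refl _
    · exact (hfail (hT.barbOut fr1 hres.2 (by simpa using ho))).elim
  · exact (hfail ((ht.bad T₁ hT₁).barbOut hrs hres.2 ho)).elim

end

/-! ### The code of the tests -/

section

variable {Chan : Type u} {Own : Type v}

/-- `fail!⟨fail⟩`, which announces failure until it is consumed. -/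
def failCode (fail : Chan) {n : ℕ} : Proc Chan n 0 :=
  .out (.chan fail) (.chan fail) .nil

/-- `succ!⟨v⟩` -/
def succCode (succ : Chan) {n : ℕ} (v : Ident Chan n) : Proc Chan n 0 :=
  .out (.chan succ) v .nil

/-- `fail?(y). succ!⟨v⟩`, which withdraws the announcement of failure and then reports `v`. -/
def winCode (succ fail : Chan) {n : ℕ} (v : Ident Chan n) : Proc Chan n 0 :=
  .inp (.chan fail) (succCode succ v.shift)

/-- `P` becomes `R` by deciding conditionals. -/
inductive Evals : Proc Chan 0 0 → Proc Chan 0 0 → Prop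
  | refl (R) : Evals R R
  | eq (a : Chan) {P Q R} : Evals P R → Evals (.cond (.chan a) (.chan a) P Q) R
  | ne {a b : Chan} {P Q R} : a ≠ b → Evals Q R → Evals (.cond (.chan a) (.chan b) P Q) R

/-- The announcement of failure by `o`, in parallel with `U`. -/
def pending (fail : Chan) (o : Own) (U : Sys Chan Own 0) : Sys Chan Own 0 :=
  .par (.owned o (failCode fail)) U

/-- The states of a test that will report `v`, or has done so. -/
def Passing (succ fail v : Chan) (o : Own) (T : Sys Chan Own 0) : Prop :=
  (∃ P, T = pending fail o (.owned o P) ∧ Evals P (winCode succ fail (.chan v))) ∨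
    T = .par (.owned o .nil) (.owned o (succCode succ (.chan v)))

/-- The states of a test that stops without withdrawing the announcement of failure. -/
def Doomed (fail : Chan) (o : Own) (T : Sys Chan Own 0) : Prop :=
  ∃ P, T = pending fail o (.owned o P) ∧ Evals P .nil

variable [DecidableEq Chan] {succ fail v : Chan} {o : Own}

theorem failing_pending (U : Sys Chan Own 0) : Failing fail o (pending fail o U) :=
  ⟨U, .refl _⟩

theorem struct_passed : Struct (.par (.owned o .nil) (.owned o (succCode succ (.chan v))))
    (.owned o (succCode succ (.chan v))) :=
  (Struct.par (.nil o) (.refl _)).trans ((Struct.com _ _).trans (.zero _))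

theorem Passing.struct_or_failing {T : Sys Chan Own 0} (h : Passing succ fail v o T) :
    Struct T (.owned o (.out (.chan succ) (.chan v) .nil)) ∨ Failing fail o T := by
  rcases h with ⟨P, rfl, -⟩ | rfl
  · exact Or.inr (failing_pending _)
  · exact Or.inl struct_passed

theorem Doomed.failing {T : Sys Chan Own 0} (h : Doomed fail o T) : Failing fail o T := by
  obtain ⟨P, rfl, -⟩ := h
  exact failing_pending _

variable [DecidableEq Own] {Θ Θ' : CostEnv Chan Own} {l : Label Chan Own}
  {X : Sys Chan Own 0}

theorem Step.owned_out_inv {a b : Chan} {P : Proc Chan 0 0}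
    (h : Step Θ (.owned o (.out (.chan a) (.chan b) P)) l Θ' X) :
    ∃ p, l = .out o none a b p ∧ X = .owned o P ∧ Θ.Charge o a p Θ' := by
  cases h with
  | out _ hc => exact ⟨_, rfl, rfl, hc⟩

theorem Step.owned_inp_inv {a : Chan} {P : Proc Chan 1 0}
    (h : Step Θ (.owned o (.inp (.chan a) P)) l Θ' X) :
    ∃ u t b, l = .inp u t a b o ∧ X = .owned o (P.inst b) ∧ (t.isSome → b ∉ P.fn) := by
  cases h with
  | inp _ _ _ => exact ⟨_, _, _, rfl, rfl, by simp⟩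
  | inpFresh _ _ _ _ h => exact ⟨_, _, _, rfl, rfl, fun _ => h⟩

theorem Step.owned_nil_inv (h : Step Θ (.owned o .nil) l Θ' X) : False := by
  cases h

theorem Evals.step_inv {P R : Proc Chan 0 0} (hP : Evals P R)
    (hR : R = .nil ∨ R = winCode succ fail (.chan v)) (h : Step Θ (.owned o P) l Θ' X) :
    (∃ P', X = .owned o P' ∧ l = .tau ∧ Θ' = Θ ∧ Evals P' R) ∨
      ∃ u t b, l = .inp u t fail b o ∧ R = winCode succ fail (.chan v) ∧
        X = .owned o (succCode succ (.chan v)) := by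
  cases hP with
  | refl =>
    rcases hR with rfl | rfl
    · exact h.owned_nil_inv.elim
    · obtain ⟨u, t, b, rfl, rfl, -⟩ := h.owned_inp_inv
      exact Or.inr ⟨u, t, b, rfl, rfl, rfl⟩
  | eq a hP =>
    cases h with
    | eq => exact Or.inl ⟨_, rfl, rfl, rfl, hP⟩
    | ne _ _ _ _ h => exact (h rfl).elim
  | ne hab hP =>
    cases h with
    | eq => exact (hab rfl).elim
    | ne => exact Or.inl ⟨_, rfl, rfl, rfl, hP⟩

/-- The actions of a test that announces failure. -/
theorem Step.pending_inv {U : Sys Chan Own 0} (hf : Θ.res fail = some ⟨0, 0⟩)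
    (h : Step Θ (pending fail o U) l Θ' X) :
    (∃ p, l = .out o none fail fail p) ∨ (∃ U', X = pending fail o U' ∧ Step Θ U l Θ' U') ∨
      ∃ U', l = .tau ∧ Θ' = Θ ∧ X = .par (.owned o .nil) U' ∧
        ∃ p, Step Θ U (.inp o none fail fail p) Θ U' := by
  cases h with
  | parL _ _ h =>
    obtain ⟨p, rfl, -⟩ := h.owned_out_inv
    exact Or.inl ⟨p, rfl⟩
  | parR _ _ h => exact Or.inr (Or.inl ⟨_, rfl, h⟩)
  | commL _ h _ =>
    obtain ⟨p, h, -⟩ := h.owned_out_inv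
    cases h
  | commR _ h h' =>
    obtain ⟨p, h, rfl, hc⟩ := h.owned_out_inv
    cases h
    have := hc.eq_of_free hf
    simp only [bindings, Option.toList_none, List.map_nil, CostEnv.extendAll,
      List.foldl_nil] at this
    subst this
    exact Or.inr (Or.inr ⟨_, rfl, rfl, rfl, _, h'⟩)

theorem secluded_passing : Secluded succ fail (Passing succ fail v o : Sys Chan Own 0 → Prop) := by
  rintro _ Θ l Θ' X (⟨P, rfl, hP⟩ | rfl) hf h
  · rcases h.pending_inv hf with ⟨p, rfl⟩ | ⟨U', rfl, hU⟩ | ⟨U', rfl, rfl, rfl, p, hU⟩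
    · refine ⟨by simp, ?_⟩
      rintro _ _ _ ⟨⟩
      exact Or.inr rfl
    · rcases hP.step_inv (Or.inr rfl) hU with ⟨P', rfl, rfl, rfl, hP'⟩ | ⟨u, t, b, rfl, -, rfl⟩
      · exact ⟨fun _ => ⟨rfl, Or.inl ⟨P', rfl, hP'⟩⟩, by simp [Label.core]⟩
      · refine ⟨by simp, ?_⟩
        rintro _ _ _ ⟨⟩
        exact Or.inr rfl
    · rcases hP.step_inv (Or.inr rfl) hU with ⟨P', -, h, -⟩ | ⟨u, t, b, -, -, rfl⟩
      · cases h
      · exact ⟨fun _ => ⟨rfl, Or.inr rfl⟩, by simp [Label.core]⟩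
  · cases h with
    | parL _ _ h => exact h.owned_nil_inv.elim
    | parR _ _ h =>
      obtain ⟨p, rfl, -⟩ := h.owned_out_inv
      refine ⟨by simp, ?_⟩
      rintro _ _ _ ⟨⟩
      exact Or.inl rfl
    | commL _ h _ => exact h.owned_nil_inv.elim
    | commR _ h _ => exact h.owned_nil_inv.elim

theorem secluded_doomed : Secluded succ fail (Doomed fail o : Sys Chan Own 0 → Prop) := by
  rintro _ Θ l Θ' X ⟨P, rfl, hP⟩ hf h
  have hstep : ∀ {l Θ' X}, Step Θ (.owned o P) l Θ' X →
      ∃ P', X = .owned o P' ∧ l = .tau ∧ Θ' = Θ ∧ Evals P' .nil := by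
    intro l Θ' X h
    rcases hP.step_inv (succ := succ) (fail := fail) (v := succ) (Or.inl rfl) h with
      h | ⟨_, _, _, _, h, _⟩
    · exact h
    · cases h
  rcases h.pending_inv hf with ⟨p, rfl⟩ | ⟨U', rfl, hU⟩ | ⟨U', rfl, rfl, rfl, p, hU⟩
  · refine ⟨by simp, ?_⟩
    rintro _ _ _ ⟨⟩
    exact Or.inr rfl
  · obtain ⟨P', rfl, rfl, rfl, hP'⟩ := hstep hU
    exact ⟨fun _ => ⟨rfl, ⟨P', rfl, hP'⟩⟩, by simp [Label.core]⟩
  · obtain ⟨P', -, h, -⟩ := hstep hU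
    cases h

/-- A test that is going to pass can withdraw the announcement of failure. -/
theorem Step.withdraw {U U' : Sys Chan Own 0} (hf : Θ.res fail = some ⟨0, 0⟩)
    (ho : (Θ.funds o).isSome)
    (h : Step Θ U (.inp o none fail fail o) Θ U') :
    Step Θ (pending fail o U) .tau Θ (.par (.owned o .nil) U') :=
  Step.commR (Δ := Θ) (t := none) ⟨by simp [bindings], by simp [bindings]⟩
    (Step.out _ (CostEnv.charge_free hf ho ho)) h

theorem Evals.testRun {P : Proc Chan 0 0} (h : Evals P (winCode succ fail (.chan v)))
    (hf : Θ.res fail = some ⟨0, 0⟩) (ho : (Θ.funds o).isSome) :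
    TestRun Θ (pending fail o (.owned o P))
      (.par (.owned o .nil) (.owned o (succCode succ (.chan v)))) := by
  generalize hR : winCode succ fail (.chan v) = R at h
  induction h with
  | refl =>
    subst hR
    refine .single (Step.withdraw hf ho ?_)
    exact Step.inp (succCode succ (Ident.shift (.chan v))) (CostEnv.charge_free hf ho ho)
      (by simp [CostEnv.dom, hf])
  | eq a _ ih =>
    exact .head (Step.parR _ (by simp [Label.bn]) (Step.eq _ _ _ _ _)) (ih hR)
  | ne hab _ ih =>
    exact .head (Step.parR _ (by simp [Label.bn]) (Step.ne _ _ _ _ hab)) (ih hR)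

end

/-! ### Tests for outputs -/

section

variable {Chan : Type u} {Own : Type v} {succ fail req : Chan} {o : Own}

/-- `if x = b then fail?(y). succ!⟨succ⟩` -/
def matchCode (succ fail b : Chan) : Proc Chan 1 0 :=
  .cond (.var 0) (.chan b) (winCode succ fail (.chan succ)) .nil

/-- `fail?(y). succ!⟨x⟩`, provided that `x` is not in the list. -/
def freshCode (succ fail : Chan) : List Chan → Proc Chan 1 0
  | [] => winCode succ fail (.var 0)
  | c :: L => .cond (.var 0) (.chan c) .nil (freshCode succ fail L)

theorem evals_matchCode_self (b : Chan) :
    Evals ((matchCode succ fail b).inst b) (winCode succ fail (.chan succ)) :=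
  .eq b (.refl _)

theorem evals_matchCode_of_ne {b b' : Chan} (h : b' ≠ b) :
    Evals ((matchCode succ fail b).inst b') .nil :=
  .ne h (.refl _)

theorem evals_freshCode {L : List Chan} {b : Chan} (h : b ∉ L) :
    Evals ((freshCode succ fail L).inst b) (winCode succ fail (.chan b)) := by
  induction L with
  | nil => exact .refl _
  | cons c L ih =>
    simp only [List.mem_cons, not_or] at h
    exact .ne h.1 (ih h.2)

theorem evals_freshCode_of_mem {L : List Chan} {b : Chan} (h : b ∈ L) :
    Evals ((freshCode succ fail L).inst b) .nil := by
  induction L with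
  | nil => simp at h
  | cons c L ih =>
    rcases eq_or_ne b c with rfl | hbc
    · exact .eq b (.refl _)
    · exact .ne hbc (ih ((List.mem_cons.1 h).resolve_left hbc))

variable [DecidableEq Chan] {O : Set Own} {μ : ALabel Chan Own} {F : Finset Chan}
  {Γ : CostEnv Chan Own} {M : Sys Chan Own 0}

theorem fn_matchCode {b : Chan} : (matchCode succ fail b).fn = {b, fail, succ} := by
  ext c
  simp only [matchCode, winCode, succCode, Proc.fn, Ident.names, Ident.shift, Finset.mem_union,
    Finset.mem_singleton, Finset.mem_insert, Finset.notMem_empty]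
  tauto

theorem fn_freshCode {L : List Chan} {c : Chan} :
    c ∈ (freshCode succ fail L).fn ↔ c = fail ∨ c = succ ∨ c ∈ L := by
  induction L with
  | nil => simp [freshCode, winCode, succCode, Proc.fn, Ident.names, Ident.shift]
  | cons d L ih =>
    simp only [freshCode, Proc.fn, Ident.names, Finset.mem_union, Finset.mem_singleton, ih,
      List.mem_cons, Finset.notMem_empty, false_or]
    tauto

theorem CostEnv.withFunds_extendAll (Γ E : CostEnv Chan Own) (ts : List (Chan × ResType)) :
    (Γ.extendAll ts).withFunds E = (Γ.withFunds E).extendAll ts :=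
  CostEnv.ext_fields (CostEnv.extendAll_res_eq (Γ := Γ) (Δ := Γ.withFunds E) ts rfl)
    (by simp) (by simp)

theorem Admissible.notMem_fn (ha : Admissible μ succ fail req F Γ M) {c : Chan}
    (hc : c ∈ [succ, fail, req]) : c ∉ M.fn := fun h =>
  (CostEnv.fresh_testResources_iff.1 ha.fresh).2 c hc (ha.config c h)

/-- The test with code `C` after the reception of `b`. -/
def received (fail : Chan) (o : Own) (C : Proc Chan 1 0) (b : Chan) : Sys Chan Own 0 :=
  pending fail o (.owned o (C.inst b))

/-- Which fresh name the test has received does not matter, up to the choice of bound names. -/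
theorem nu_received {N : Sys Chan Own 0} {C : Proc Chan 1 0} {b c : Chan} {R : ResType}
    (hN : c ∉ N.fn ∨ c = b) (hb : b ∉ C.fn) (hc : c ∉ C.fn) (hbf : b ≠ fail) (hcf : c ≠ fail) :
    Sys.nu b R (.par N (received fail o C b)) =
      Sys.nu c R (.par (N.ren (Equiv.swap b c)) (received fail o C c)) := by
  rcases eq_or_ne c b with rfl | hcb
  · rw [Equiv.swap_self, Equiv.coe_refl, Sys.ren_id]
  have hN := hN.resolve_right hcb
  have hC : C.map (Ident.ren (Equiv.swap b c)) = C := by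
    conv_rhs => rw [← Proc.map_id C]
    refine Proc.map_congr C (fun d hd => ?_) (fun _ => rfl)
    have h1 : d ≠ b := fun e => hb (e ▸ hd)
    have h2 : d ≠ c := fun e => hc (e ▸ hd)
    simp [Equiv.swap_apply_of_ne_of_ne h1 h2]
  have e : (Sys.par N (received fail o C b)).ren (Equiv.swap b c) =
      .par (N.ren (Equiv.swap b c)) (received fail o C c) := by
    have := Proc.ren_inst (Equiv.swap b c) b C
    rw [hC, Equiv.swap_apply_left] at this
    simp [Sys.ren, Sys.map, received, pending, failCode, Proc.map, this,
      Equiv.swap_apply_of_ne_of_ne hbf.symm hcf.symm]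
  rw [← e]
  refine (Sys.nu_ren_swap ?_).symm
  simp only [Sys.fn, received, pending, failCode, Proc.fn, Ident.names, Finset.mem_union,
    Finset.mem_singleton, not_or]
  refine ⟨hN, ⟨⟨⟨hcf, hcf⟩, by simp⟩, fun h => ?_⟩⟩
  rcases Finset.mem_insert.1 (Proc.fn_inst_subset _ _ h) with h | h
  · exact hcb h
  · exact hc h

/-- The test `fail!⟨fail⟩ | a?(x). C`, run by `o`. -/
def outTest (fail : Chan) (o : Own) (a : Chan) (C : Proc Chan 1 0) : Sys Chan Own 0 :=
  pending fail o (.owned o (.inp (.chan a) C))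

theorem frozen_outTest {a : Chan} {C : Proc Chan 1 0} (hsf : succ ≠ fail) :
    (outTest fail o a C).Frozen succ {o} :=
  ⟨Or.inl (by simp [failCode, Proc.fn, Ident.names, hsf]), Or.inr ⟨rfl, trivial⟩⟩

theorem notMem_fn_passed {v : Chan} (h : fail ≠ succ) (hv : fail ≠ v) :
    fail ∉ (Sys.par (.owned o .nil) (.owned o (succCode succ (.chan v))) : Sys Chan Own 0).fn := by
  simp [Sys.fn, succCode, Proc.fn, Ident.names, h, hv]

variable [DecidableEq Own]

/-- The actions of an admissible system are possible in the presence of the resources of the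
test. -/
theorem Admissible.weaken [Infinite Chan] (ha : Admissible μ succ fail req F Γ M)
    {Γ' : CostEnv Chan Own} {M' : Sys Chan Own 0} {l : Label Chan Own} (h : Step Γ M l Γ' M')
    (hl : ∀ b ∈ l.bn, b ∉ [succ, fail, req]) :
    Step (Γ.extendAll (testResources succ fail req)) M l
      (((Γ.withFunds Γ').extendAll (testResources succ fail req)).extendAll l.binds) M' := by
  rw [← CostEnv.withFunds_extendAll]
  refine h.change_env (by simp) (by simp) (fun c hc => ?_) ?_ ?_
  · exact CostEnv.extendAll_res_of_notMem _ fun h => ha.notMem_fn h hc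
  · rintro u a b p rfl
    exact (CostEnv.mem_dom_extendAll _).2 (Or.inr (h.value_mem_dom rfl))
  · intro b hb hd
    exact ((CostEnv.mem_dom_extendAll _).1 hd).elim (hl b hb) (h.bound_fresh b hb).1

/-- Conversely, an action in the presence of the resources of the test is one of the admissible
system itself, except for the input of a name of such a resource. -/
theorem Admissible.strengthen [Infinite Chan] (ha : Admissible μ succ fail req F Γ M)
    {E : CostEnv Chan Own} {M' : Sys Chan Own 0} {l : Label Chan Own}
    (h : Step (Γ.extendAll (testResources succ fail req)) M l (E.extendAll l.binds) M')
    (hl : ∀ u a b p, l = .inp u none a b p → b ∉ [succ, fail, req]) :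
    Step Γ M l ((Γ.withFunds E).extendAll l.binds) M' := by
  have e : Γ.withFunds E = Γ.withFunds (E.extendAll l.binds) :=
    CostEnv.ext_fields rfl (by simp) (by simp)
  rw [e]
  refine h.change_env (by simp) (by simp) (fun c hc => ?_) ?_ ?_
  · exact (CostEnv.extendAll_res_of_notMem _ fun h => ha.notMem_fn h hc).symm
  · rintro u a b p rfl
    exact ((CostEnv.mem_dom_extendAll _).1 (h.value_mem_dom rfl)).resolve_left (hl u a b p rfl)
  · intro b hb hd
    exact (h.bound_fresh b hb).1 ((CostEnv.mem_dom_extendAll _).2 (Or.inr hd))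

/-- The test for outputs on `a` can only receive a value on `a`. -/
theorem outTest_inv [Infinite Chan] {a : Chan} {C : Proc Chan 1 0}
    (ha : Admissible μ succ fail req F Γ M) (haf : a ≠ fail) {E : CostEnv Chan Own}
    {X : Sys Chan Own 0}
    (h : (∃ T', X = .par M T' ∧
        Step (Γ.extendAll (testResources succ fail req)) (outTest fail o a C) .tau E T') ∨
      Interact (Γ.extendAll (testResources succ fail req)) M (outTest fail o a C) E X) :
    ∃ u t b M', E.Fresh (bindings b t) ∧ (t.isSome → b ∉ C.fn) ∧
      X = Sys.nus (bindings b t) (.par M' (received fail o C b)) ∧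
      Step Γ M (.out u t a b o) ((Γ.withFunds E).extendAll (bindings b t)) M' ∧
      (E.funds o).isSome := by
  have hf := (CostEnv.res_testResources (Γ := Γ)
    (CostEnv.fresh_testResources_iff.1 ha.fresh).1).2
  have hfM := ha.notMem_fn (c := fail) (by simp)
  rcases h with ⟨T', -, h⟩ | ⟨u, t, a', b, p, M', T', hE, rfl, ⟨h1, h2⟩ | ⟨h1, h2⟩⟩
  · exfalso
    rcases h.pending_inv hf with ⟨p, h⟩ | ⟨U, -, h⟩ | ⟨U, -, -, -, p, h⟩
    · cases h
    · obtain ⟨_, _, _, h, -⟩ := h.owned_inp_inv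
      cases h
    · obtain ⟨_, _, _, h, -⟩ := h.owned_inp_inv
      cases h
      exact haf rfl
  · exfalso
    rcases h2.pending_inv hf with ⟨p, h⟩ | ⟨U, -, h⟩ | ⟨U, h, -⟩
    · cases h
      exact hfM (h1.charge rfl).1
    · obtain ⟨_, _, _, h, -⟩ := h.owned_inp_inv
      cases h
    · cases h
  · rcases h2.pending_inv hf with ⟨p, h⟩ | ⟨U, rfl, h⟩ | ⟨U, h, -⟩
    · cases h
    · have ho := h.funds_isSome o
      obtain ⟨_, _, _, h', rfl, hC⟩ := h.owned_inp_inv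
      cases h'
      have hc := (h.charge rfl).2.provider_isSome
      rw [hc] at ho
      exact ⟨u, t, b, M', hE, hC, rfl, ha.strengthen (l := .out u t a b o) h1 (by simp), by
        simpa using ho⟩
    · cases h

theorem outTest_complete [Infinite Chan] {a b : Chan} {t : Option ResType} {u : Own}
    {C : Proc Chan 1 0} {Γ' : CostEnv Chan Own} {M' : Sys Chan Own 0}
    (ha : Admissible μ succ fail req F Γ M) (h : Step Γ M (.out u t a b o) Γ' M')
    (hb : t.isSome → b ∉ [succ, fail, req] ∧ b ∉ C.fn) :
    (Γ.funds o).isSome ∧ Γ'.res = (Γ.extendAll (bindings b t)).res ∧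
    Step (Γ.extendAll (testResources succ fail req)) (.par M (outTest fail o a C)) .tau
      ((Γ.withFunds Γ').extendAll (testResources succ fail req))
      (.nus (bindings b t) (.par M' (received fail o C b))) := by
  have h1 := ha.weaken h (by
    cases t with
    | none => simp [Label.bn, bindings]
    | some R => simpa [Label.bn, bindings] using (hb rfl).1)
  refine ⟨(h.charge rfl).2.provider_isSome, h.res_eq, ?_⟩
  have hc := (h1.charge rfl).2
  have hfresh : ∀ r ∈ (bindings b t).map Prod.fst,
      r ∉ (Γ.extendAll (testResources succ fail req)).dom := fun r hr =>
    (h1.bound_fresh r hr).1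
  have e : (Γ.extendAll (testResources succ fail req)).withFunds
      (((Γ.withFunds Γ').extendAll (testResources succ fail req)).extendAll (bindings b t)) =
      (Γ.withFunds Γ').extendAll (testResources succ fail req) := by
    rw [CostEnv.withFunds_extendAll]
    congr 1
    exact CostEnv.ext_fields rfl (by simp) (by simp)
  have hd : ((Γ.withFunds Γ').extendAll (testResources succ fail req)).dom =
      (Γ.extendAll (testResources succ fail req)).dom :=
    CostEnv.dom_congr (CostEnv.extendAll_res_eq _ rfl)
  simp only [Label.binds] at hc
  rw [e] at hc
  refine Step.commR (u := u) (p := o) (a := a) (b := b) (t := t) ?_ h1 (Step.parR _ ?_ ?_)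
  · refine ⟨by cases t <;> simp [bindings], fun r hr => ?_⟩
    rw [hd]
    exact hfresh r.1 (List.mem_map_of_mem hr)
  · cases t with
    | none => simp [Label.bn, bindings]
    | some R =>
      have := (hb rfl).1
      simp only [List.mem_cons, not_or] at this
      simp [Label.bn, bindings, Sys.fn, failCode, Proc.fn, Ident.names, this]
  · cases t with
    | none =>
      refine Step.inp C hc ((CostEnv.mem_dom_extendAll _).2 (Or.inr ?_))
      exact ha.config _ (h.value_mem_fn rfl)
    | some R => exact Step.inpFresh R C hc (hfresh b (by simp [bindings])) (hb rfl).2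

theorem AStep.out_inv {Γ' : CostEnv Chan Own} {M' : Sys Chan Own 0} {β : Bool} {a b : Chan}
    {z : ℤ} (h : AStep O (Γ, M) (.out β a b o) z (Γ', M')) :
    ∃ u t, t.isSome = β ∧ Step Γ M (.out u t a b o) Γ' M' := by
  generalize hμ : ALabel.out β a b o = μ at h
  cases h with
  | out _ h =>
    cases hμ
    exact ⟨_, _, rfl, h⟩
  | _ => cases hμ

theorem Step.notMem_fn_of_out {Γ' : CostEnv Chan Own} {M' : Sys Chan Own 0} {u p : Own}
    {t : Option ResType} {a b c : Chan} (h : Step Γ M (.out u t a b p) Γ' M') (hc : c ∉ M.fn)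
    (hb : t.isSome → c ≠ b) : c ∉ M'.fn := by
  intro hcM
  have hn := h.fn_subset c hcM
  simp only [Label.names, Finset.mem_insert, Finset.mem_singleton] at hn
  rcases hn with hn | rfl | rfl
  · exact hc hn
  · exact hc (h.charge rfl).1
  · cases t with
    | none => exact hc (h.value_mem_fn rfl)
    | some R => exact hb rfl rfl

theorem isTest_out_free [Infinite Chan] {a b : Chan} (ho : o ∈ O)
    (hnd : [succ, fail, req].Nodup) (haf : a ≠ fail) :
    IsTest O (.out false a b o) succ fail req F (outTest fail o a (matchCode succ fail b)) o
      (Passing succ fail succ o) (Doomed fail o) where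
  owner := ho
  failing := failing_pending _
  frozen := frozen_outTest (by simp at hnd; tauto)
  good_secluded := secluded_passing
  bad_secluded := secluded_doomed
  good _ h := h.struct_or_failing
  bad _ h := h.failing
  sound ha h := by
    obtain ⟨u, t, b', M', hE, hC, rfl, hs, hfo⟩ := outTest_inv ha haf h
    simp only [fn_matchCode, Finset.mem_insert, Finset.mem_singleton, not_or] at hC
    refine ⟨hfo, ?_⟩
    rcases eq_or_ne b' b with rfl | hb
    · cases t with
      | none =>
        exact Or.inl ⟨[], M', _, _, rfl, rfl, Or.inl ⟨_, rfl, evals_matchCode_self b'⟩,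
          AStep.out (t := none) ho hs⟩
      -- A fresh name differs from `b`, which is free in the code of the test.
      | some R => exact ((hC rfl).1 rfl).elim
    · exact Or.inr ⟨_, M', _, hE, rfl, ⟨_, rfl, evals_matchCode_of_ne hb⟩,
        hs.notMem_fn_of_out (ha.notMem_fn (by simp)) fun h => Ne.symm (hC h).2.2,
        hs.notMem_fn_of_out (ha.notMem_fn (by simp)) fun h => Ne.symm (hC h).2.1⟩
  complete {Γ M Γ' M' z} ha h := by
    obtain ⟨u, t, ht, hs⟩ := h.out_inv
    obtain rfl : t = none := by simpa using ht
    obtain ⟨hfo, hres, hstep⟩ := outTest_complete (C := matchCode succ fail b) ha hs (by simp)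
    refine ⟨[], _, _, rfl, hres, hfo, hstep, (evals_matchCode_self b).testRun
      (CostEnv.res_testResources hnd).2 ?_, struct_passed, ?_⟩
    · rw [CostEnv.extendAll_funds, CostEnv.extendAll_funds]
      exact (hs.funds_isSome o).trans hfo
    · have : fail ≠ succ := by simp at hnd; tauto
      exact notMem_fn_passed this this

/-- A received name is fresh if and only if it is not in `F`, which contains all known names. -/
theorem isTest_out_bound [Infinite Chan] {a b : Chan} (ho : o ∈ O)
    (hnd : [succ, fail, req].Nodup) (haf : a ≠ fail) (hbt : b ∉ [succ, fail, req])
    (hbF : b ∉ F) :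
    IsTest O (.out true a b o) succ fail req F (outTest fail o a (freshCode succ fail F.toList)) o
      (Passing succ fail b o) (Doomed fail o) where
  owner := ho
  failing := failing_pending _
  frozen := frozen_outTest (by simp at hnd; tauto)
  good_secluded := secluded_passing
  bad_secluded := secluded_doomed
  good _ h := h.struct_or_failing
  bad _ h := h.failing
  sound {Γ M E X} ha h := by
    simp only [List.mem_cons, not_or] at hbt
    obtain ⟨u, t, b', M', hE, hC, rfl, hs, hfo⟩ := outTest_inv ha haf h
    refine ⟨hfo, ?_⟩
    cases t with
    | none =>
      have hb' : b' ∈ F.toList :=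
        Finset.mem_toList.2 (ha.dom_subset (ha.config _ (hs.value_mem_fn rfl)))
      exact Or.inr ⟨_, M', _, hE, rfl, ⟨_, rfl, evals_freshCode_of_mem hb'⟩,
        hs.notMem_fn_of_out (ha.notMem_fn (by simp)) (by simp),
        hs.notMem_fn_of_out (ha.notMem_fn (by simp)) (by simp)⟩
    | some R =>
      have hb' := hC rfl
      have hbC : b ∉ (freshCode succ fail F.toList).fn := by
        simp only [fn_freshCode, Finset.mem_toList]
        tauto
      have hbf : b' ≠ fail := fun e => hb' (fn_freshCode.2 (Or.inl e))
      have hbΓ : b ∉ Γ.dom := ha.bn_fresh b (by simp [ALabel.bn])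
      have hbM : b ∉ M.fn := fun h => hbΓ (ha.config b h)
      have hN : b ∉ M'.fn ∨ b = b' := by
        by_cases e : b = b'
        · exact Or.inr e
        · exact Or.inl (hs.notMem_fn_of_out hbM fun _ => e)
      have hs' := (Step.rename_bound hbΓ hbM).2 hs
      exact Or.inl ⟨[(b, R)], _, _, _, rfl, nu_received hN hb' hbC hbf hbt.2.1,
        Or.inl ⟨_, rfl, evals_freshCode (fun h => hbF (Finset.mem_toList.1 h))⟩,
        AStep.out (t := some R) ho hs'⟩
  complete {Γ M Γ' M' z} ha h := by
    obtain ⟨u, t, ht, hs⟩ := h.out_inv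
    obtain ⟨R, rfl⟩ := Option.isSome_iff_exists.1 ht
    have hbt' := hbt
    simp only [List.mem_cons, not_or] at hbt'
    have hbC : b ∉ (freshCode succ fail F.toList).fn := by
      simp only [fn_freshCode, Finset.mem_toList]
      tauto
    obtain ⟨hfo, hres, hstep⟩ := outTest_complete (C := freshCode succ fail F.toList) ha hs
      fun _ => ⟨hbt, hbC⟩
    refine ⟨[(b, R)], _, _, rfl, hres, hfo, hstep,
      (evals_freshCode (fun h => hbF (Finset.mem_toList.1 h))).testRun ?_ ?_, struct_passed, ?_⟩
    · rw [CostEnv.extendAll_res_of_notMem _ (by simpa using Ne.symm hbt'.2.1)]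
      exact (CostEnv.res_testResources hnd).2
    · simpa using (hs.funds_isSome o).trans hfo
    · exact notMem_fn_passed (by simp at hnd; tauto) (Ne.symm hbt'.2.1)

end

/-! ### Tests for inputs -/

section

variable {Chan : Type u} {Own : Type v} {succ fail req : Chan} {o : Own}

/-- The test `fail!⟨fail⟩ | a!⟨b⟩. fail?(y). succ!⟨succ⟩` for the input of a known name `b`. Tests
for inputs have no bad states, as they determine the value sent. -/
def inpTest (succ fail : Chan) (o : Own) (a b : Chan) : Sys Chan Own 0 :=
  pending fail o (.owned o (.out (.chan a) (.chan b) (winCode succ fail (.chan succ))))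

/-- The test `fail!⟨fail⟩ | (new b : R) a!⟨b⟩. fail?(y). succ!⟨b⟩` for the input of a fresh name of
type `R`. -/
def inpNewTest (succ fail : Chan) (o : Own) (R : ResType) (a : Chan) : Sys Chan Own 0 :=
  pending fail o (.new R (.owned o (.out (.chan a) (.var 0) (winCode succ fail (.var 0)))))

variable [DecidableEq Chan] [DecidableEq Own] {O : Set Own} {μ : ALabel Chan Own} {F : Finset Chan}
  {Γ : CostEnv Chan Own} {M : Sys Chan Own 0}

theorem AStep.inp_inv {Γ' : CostEnv Chan Own} {M' : Sys Chan Own 0} {t : Option ResType}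
    {a b : Chan} {z : ℤ} (h : AStep O (Γ, M) (.inp o t a b) z (Γ', M')) :
    ∃ p, Step Γ M (.inp o t a b p) Γ' M' := by
  generalize hμ : ALabel.inp o t a b = μ at h
  cases h with
  | inp _ h =>
    cases hμ
    exact ⟨_, h⟩
  | _ => cases hμ

/-- The environment after a visible action of an admissible system, as seen by the test. -/
theorem Admissible.charge_weakened [Infinite Chan] (ha : Admissible μ succ fail req F Γ M)
    {Γ' : CostEnv Chan Own} {M' : Sys Chan Own 0} {l : Label Chan Own} (h : Step Γ M l Γ' M')
    (hl : ∀ b ∈ l.bn, b ∉ [succ, fail, req]) {u p : Own} {a : Chan}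
    (hc : l.core = some (u, a, p)) :
    (Γ.extendAll (testResources succ fail req)).Charge u a p
        ((Γ.withFunds Γ').extendAll (testResources succ fail req)) ∧
      ((Γ.withFunds Γ').extendAll (testResources succ fail req)).dom =
        (Γ.extendAll (testResources succ fail req)).dom ∧
      ∀ r ∈ l.bn, r ∉ (Γ.extendAll (testResources succ fail req)).dom := by
  have h1 := ha.weaken h hl
  refine ⟨?_, CostEnv.dom_congr (CostEnv.extendAll_res_eq _ rfl),
    fun r hr => (h1.bound_fresh r hr).1⟩
  have e : (Γ.extendAll (testResources succ fail req)).withFunds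
      (((Γ.withFunds Γ').extendAll (testResources succ fail req)).extendAll l.binds) =
      (Γ.withFunds Γ').extendAll (testResources succ fail req) := by
    rw [CostEnv.withFunds_extendAll]
    congr 1
    exact CostEnv.ext_fields rfl (by simp) (by simp)
  exact e ▸ (h1.charge hc).2

theorem isTest_inp_free [Infinite Chan] {a b : Chan} (ho : o ∈ O)
    (hnd : [succ, fail, req].Nodup) (has : a ≠ succ) (hb : b ∉ [succ, fail, req]) :
    IsTest O (.inp o none a b) succ fail req F (inpTest succ fail o a b) o
      (Passing succ fail succ o) (fun _ => False) where
  owner := ho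
  failing := failing_pending _
  frozen := ⟨Or.inl (by
    have : succ ≠ fail := by simp at hnd; tauto
    simp [failCode, Proc.fn, Ident.names, this]), Or.inr ⟨rfl, by simp [Proc.Stuck, has]⟩⟩
  good_secluded := secluded_passing
  bad_secluded := fun _ _ _ _ _ h => h.elim
  good _ h := h.struct_or_failing
  bad _ h := h.elim
  sound {Γ M E X} ha h := by
    have hf := (CostEnv.res_testResources (Γ := Γ) hnd).2
    have hfM := ha.notMem_fn (c := fail) (by simp)
    rcases h with ⟨T', -, h⟩ | ⟨u, t, a', b', p, M', T', hE, rfl, ⟨h1, h2⟩ | ⟨h1, h2⟩⟩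
    · exfalso
      rcases h.pending_inv hf with ⟨p, h⟩ | ⟨U, -, h⟩ | ⟨U, -, -, -, p, h⟩
      · cases h
      · obtain ⟨_, h, -⟩ := h.owned_out_inv
        cases h
      · obtain ⟨_, h, -⟩ := h.owned_out_inv
        cases h
    · rcases h2.pending_inv hf with ⟨p, h⟩ | ⟨U, rfl, h⟩ | ⟨U, h, -⟩
      · cases h
        exact (hfM (h1.charge rfl).1).elim
      · have hfo := h.funds_isSome o
        obtain ⟨_, h', rfl, hc⟩ := h.owned_out_inv
        cases h'
        refine ⟨?_, Or.inl ⟨[], M', _, _, rfl, rfl, Or.inl ⟨_, rfl, .refl _⟩,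
          AStep.inp (p := p) ho ?_⟩⟩
        · rw [CostEnv.extendAll_funds] at hfo
          exact hfo.trans hc.user_isSome
        · exact ha.strengthen (l := .inp o none a b p) h1 (by rintro _ _ _ _ ⟨⟩; exact hb)
      · cases h
    · exfalso
      rcases h2.pending_inv hf with ⟨p, h⟩ | ⟨U, rfl, h⟩ | ⟨U, h, -⟩
      · cases h
      · obtain ⟨_, h, -⟩ := h.owned_out_inv
        cases h
      · cases h
  complete {Γ M Γ' M' z} ha h := by
    obtain ⟨p, hs⟩ := h.inp_inv
    have hbn : ∀ c ∈ (Label.inp o none a b p : Label Chan Own).bn, c ∉ [succ, fail, req] := by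
      simp [Label.bn, bindings]
    have hfo := (hs.charge rfl).2.user_isSome
    obtain ⟨hc, -, -⟩ := ha.charge_weakened hs hbn rfl
    refine ⟨[], pending fail o (.owned o (winCode succ fail (.chan succ))), _, rfl, hs.res_eq, hfo,
      Step.commL (t := none) (u := o) (a := a) (b := b) (p := p)
        ⟨by simp [bindings], by simp [bindings]⟩ (ha.weaken hs hbn)
        (Step.parR _ (by simp [Label.bn, bindings]) (Step.out _ hc)),
      (Evals.refl _).testRun (CostEnv.res_testResources hnd).2 ?_, struct_passed, ?_⟩
    · rw [CostEnv.extendAll_funds, CostEnv.extendAll_funds]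
      exact (hs.funds_isSome o).trans hfo
    · have : fail ≠ succ := by simp at hnd; tauto
      exact notMem_fn_passed this this

/-- The actions of a sender of a fresh name. -/
theorem Step.new_sender_inv {Θ E : CostEnv Chan Own} {l : Label Chan Own} {X : Sys Chan Own 0}
    {R : ResType} {a : Chan} {P : Proc Chan 1 0}
    (h : Step Θ (.new R (.owned o (.out (.chan a) (.var 0) P))) l E X) :
    ∃ b p, l = .out o (some R) a b p ∧ X = .owned o (P.inst b) ∧ b ∉ P.fn := by
  cases h with
  | opening h1 h2 h3 h =>
    obtain ⟨_, h, rfl, -⟩ := Step.owned_out_inv h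
    cases h
    refine ⟨_, _, rfl, rfl, fun h => h1 ?_⟩
    simp [Sys.fn, Proc.fn, h]
  | new h1 h2 h3 h4 h =>
    obtain ⟨_, rfl, -⟩ := Step.owned_out_inv h
    simp [Label.names] at h4

theorem fn_winCode_var : (winCode succ fail (.var 0) : Proc Chan 1 0).fn = {fail, succ} := by
  ext c
  simp only [winCode, succCode, Proc.fn, Ident.names, Ident.shift, Finset.mem_union,
    Finset.mem_singleton, Finset.mem_insert, Finset.notMem_empty]
  tauto

theorem isTest_inp_bound [Infinite Chan] {a b : Chan} {R : ResType} (ho : o ∈ O)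
    (hnd : [succ, fail, req].Nodup) (has : a ≠ succ) (haf : a ≠ fail) (hab : a ≠ b)
    (hbt : b ∉ [succ, fail, req]) :
    IsTest O (.inp o (some R) a b) succ fail req F (inpNewTest succ fail o R a) o
      (Passing succ fail b o) (fun _ => False) where
  owner := ho
  failing := failing_pending _
  frozen := ⟨Or.inl (by
    have : succ ≠ fail := by simp at hnd; tauto
    simp [failCode, Proc.fn, Ident.names, this]), Or.inr ⟨rfl, by simp [Proc.Stuck, has]⟩⟩
  good_secluded := secluded_passing
  bad_secluded := fun _ _ _ _ _ h => h.elim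
  good _ h := h.struct_or_failing
  bad _ h := h.elim
  sound {Γ M E X} ha h := by
    have hf := (CostEnv.res_testResources (Γ := Γ) hnd).2
    have hfM := ha.notMem_fn (c := fail) (by simp)
    simp only [List.mem_cons, not_or] at hbt
    rcases h with ⟨T', -, h⟩ | ⟨u, t, a', b', p, M', T', hE, rfl, ⟨h1, h2⟩ | ⟨h1, h2⟩⟩
    · exfalso
      rcases h.pending_inv hf with ⟨p, h⟩ | ⟨U, -, h⟩ | ⟨U, -, -, -, p, h⟩
      · cases h
      · obtain ⟨_, _, h, -⟩ := h.new_sender_inv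
        cases h
      · obtain ⟨_, _, h, -⟩ := h.new_sender_inv
        cases h
    · rcases h2.pending_inv hf with ⟨p, h⟩ | ⟨U, rfl, h⟩ | ⟨U, h, -⟩
      · cases h
        exact (hfM (h1.charge rfl).1).elim
      · have hfo := h.funds_isSome o
        obtain ⟨_, _, h', rfl, hbC⟩ := h.new_sender_inv
        cases h'
        have hc := (h.charge rfl).2
        have hs := ha.strengthen (l := .inp o (some R) a b' p) h1 (by simp)
        have hbΓ : b ∉ Γ.dom := ha.bn_fresh b (by simp [ALabel.bn, bindings])
        have hbM : b ∉ M.fn := fun h => hbΓ (ha.config b h)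
        have hbC' : b ∉ (winCode succ fail (.var 0) : Proc Chan 1 0).fn := by
          simp [fn_winCode_var, hbt]
        have hN : b ∉ M'.fn ∨ b = b' := by
          by_cases e : b = b'
          · exact Or.inr e
          · refine Or.inl fun h => ?_
            have := hs.fn_subset b h
            simp only [Label.names, Finset.mem_insert, Finset.mem_singleton] at this
            tauto
        have hbf : b' ≠ fail := by
          rintro rfl
          simp [fn_winCode_var] at hbC
        have hs' := (Step.rename_bound hbΓ hbM).1 hs
        rw [CostEnv.extendAll_funds] at hfo
        exact ⟨hfo.trans hc.user_isSome, Or.inl ⟨[(b, R)], _, _, _, rfl,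
          nu_received hN hbC hbC' hbf hbt.2.1, Or.inl ⟨_, rfl, .refl _⟩, AStep.inp ho hs'⟩⟩
      · cases h
    · exfalso
      rcases h2.pending_inv hf with ⟨p, h⟩ | ⟨U, rfl, h⟩ | ⟨U, h, -⟩
      · cases h
      · obtain ⟨_, _, h, -⟩ := h.new_sender_inv
        cases h
      · cases h
  complete {Γ M Γ' M' z} ha h := by
    obtain ⟨p, hs⟩ := h.inp_inv
    have hbn : ∀ c ∈ (Label.inp o (some R) a b p : Label Chan Own).bn,
        c ∉ [succ, fail, req] := by
      simpa [Label.bn, bindings] using hbt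
    have hfo := (hs.charge rfl).2.user_isSome
    obtain ⟨hc, hd, hfr⟩ := ha.charge_weakened hs hbn rfl
    have hbd := hfr b (by simp [Label.bn, bindings])
    simp only [List.mem_cons, not_or] at hbt
    have hopen : Step (Γ.extendAll (testResources succ fail req))
        (.new R (.owned o (.out (.chan a) (.var 0) (winCode succ fail (.var 0)))))
        (.out o (some R) a b p)
        (((Γ.withFunds Γ').extendAll (testResources succ fail req)).extend b R)
        (.owned o (winCode succ fail (.chan b))) := by
      refine Step.opening ?_ hbd hab (Step.out _ (hc.congr ?_ rfl rfl ?_ rfl rfl))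
      · simp [Sys.fn, Proc.fn, Ident.names, fn_winCode_var, hbt, hab.symm]
      · exact CostEnv.extend_res_of_ne _ _ hab
      · simp only [CostEnv.extend_res, hc.res_eq]
    refine ⟨[(b, R)], pending fail o (.owned o (winCode succ fail (.chan b))), _, rfl, hs.res_eq,
      hfo, Step.commL (t := some R) (u := o) (a := a) (b := b) (p := p)
        ⟨by simp [bindings], by simpa [bindings, hd] using hbd⟩ (ha.weaken hs hbn)
        (Step.parR _ ?_ hopen),
      (Evals.refl _).testRun ?_ ?_, struct_passed, ?_⟩
    · simp [Label.bn, bindings, Sys.fn, failCode, Proc.fn, Ident.names, hbt]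
    · rw [CostEnv.extendAll_res_of_notMem _ (by simpa using Ne.symm hbt.2.1)]
      exact (CostEnv.res_testResources hnd).2
    · simpa using (hs.funds_isSome o).trans hfo
    · exact notMem_fn_passed (by simp at hnd; tauto) (Ne.symm hbt.2.1)

end

/-! ### Tests for fund transfers -/

section

variable {Chan : Type u} {Own : Type v} {succ fail req : Chan} {o p : Own} {k : ℕ}

/-- `(new r : (k, 0)) ([r!⟨r⟩. fail?(y). succ!⟨succ⟩]_o | [r?(x)]_p)`: by communicating on the
private resource `r`, the owner `o` pays `k` to `p`. -/
def payment (succ fail : Chan) (o p : Own) (k : ℕ) : Sys Chan Own 0 :=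
  .new ⟨k, 0⟩ (.par (.owned o (.out (.var 0) (.var 0) (winCode succ fail (.chan succ))))
    (.owned p (.inp (.var 0) .nil)))

/-- The payment, once made, leaves the code `P` of `o`. -/
def paid (o p : Own) (k : ℕ) (P : Proc Chan 1 0) : Sys Chan Own 0 :=
  .new ⟨k, 0⟩ (.par (.owned o P) (.owned p .nil))

variable [DecidableEq Chan] [DecidableEq Own] {O : Set Own} {μ : ALabel Chan Own} {F : Finset Chan}
  {Γ Θ E : CostEnv Chan Own} {M X : Sys Chan Own 0} {l : Label Chan Own}

theorem Step.payment_inv (h : Step Θ (payment succ fail o p k) l E X) :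
    l = .tau ∧ X = paid o p k (winCode succ fail (.chan succ)) ∧
    ∃ x y, Θ.funds o = some x ∧ Θ.funds p = some y ∧ (k : ℕ∞) ≤ x ∧
      E.funds = CostEnv.moveFunds Θ.funds o p k 0 ∧ E.record = Θ.record + k := by
  cases h with
  | @opening _ _ _ _ a b R _ _ h1 h2 h3 h =>
    exfalso
    change Step _ (.par (.owned o (.out (.chan b) (.chan b) _)) (.owned p (.inp (.chan b) _))) _ _ _
      at h
    cases h with
    | parL _ _ h =>
      obtain ⟨_, h, -⟩ := h.owned_out_inv
      cases h
      exact h3 rfl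
    | parR _ _ h =>
      obtain ⟨_, _, _, h, -⟩ := h.owned_inp_inv
      cases h
  | @new _ _ b R _ _ M' h1 h2 h3 h4 h =>
    change Step _ (.par (.owned o (.out (.chan b) (.chan b) (winCode succ fail (.chan succ))))
      (.owned p (.inp (.chan b) .nil))) _ _ _ at h
    cases h with
    | parL _ _ h =>
      obtain ⟨_, rfl, -⟩ := h.owned_out_inv
      simp [Label.names] at h4
    | parR _ _ h =>
      obtain ⟨_, _, _, rfl, -⟩ := h.owned_inp_inv
      simp [Label.names] at h4
    | commL _ h _ =>
      obtain ⟨_, h, -⟩ := h.owned_out_inv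
      cases h
    | commR _ h h' =>
      obtain ⟨_, e, rfl, hc⟩ := h.owned_out_inv
      cases e
      obtain ⟨_, _, _, e, rfl, -⟩ := h'.owned_inp_inv
      cases e
      refine ⟨rfl, ?_, ?_⟩
      · simp only [Sys.fn, Proc.fn, winCode, succCode, Ident.names, Ident.shift, Finset.mem_union,
          Finset.mem_singleton, not_or] at h1
        have hf : fail ≠ b := by grind
        have hs : succ ≠ b := by grind
        simp [paid, Sys.nu, Sys.nus, bindings, Sys.map, Proc.map, winCode, succCode, Ident.bind,
          Ident.lift, Ident.shift, Proc.inst, hf, hs]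
      · obtain ⟨R', x, y, hR, hx, hy, hk, -, e⟩ := hc
        simp only [CostEnv.extend_res_self, Option.some.injEq] at hR
        subst hR
        refine ⟨x, y, hx, hy, hk, ?_, ?_⟩
        · simpa [CostEnv.extend] using congrArg CostEnv.funds e
        · simpa [CostEnv.extend] using congrArg CostEnv.record e

/-- The payment is possible under a private name that is fresh for `Θ`. -/
theorem Step.payment [Infinite Chan] {x y : ℕ∞} (hx : Θ.funds o = some x) (hy : Θ.funds p = some y)
    (hk : (k : ℕ∞) ≤ x) (hr : E.res = Θ.res) (hf : E.funds = CostEnv.moveFunds Θ.funds o p k 0)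
    (hc : E.record = Θ.record + k) :
    Step Θ (payment succ fail o p k) .tau E (paid o p k (winCode succ fail (.chan succ))) := by
  obtain ⟨b, hb, hbd⟩ := Θ.exists_fresh {fail, succ}
  simp only [Finset.mem_insert, Finset.mem_singleton, not_or] at hb
  have hch : (Θ.extend b ⟨k, 0⟩).Charge o b p (E.extend b ⟨k, 0⟩) := by
    refine ⟨⟨k, 0⟩, x, y, by simp, hx, hy, hk, by simp, CostEnv.ext_fields ?_ hf ?_⟩
    · simp [CostEnv.extend_res, hr]
    · simpa [CostEnv.extend] using hc
  have h := Step.new (Γ := Θ) (Γ' := E) (b := b) (R := ⟨k, 0⟩) (l := .tau)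
    (M := .par (.owned o (.out (.var 0) (.var 0) (winCode succ fail (.chan succ))))
      (.owned p (.inp (.var 0) .nil)))
    (M' := .par (.owned o (winCode succ fail (.chan succ))) (.owned p .nil))
    (by simp [Sys.fn, Proc.fn, winCode, succCode, Ident.names, Ident.shift, hb]) hbd
    (by rwa [CostEnv.dom_congr hr]) (by simp [Label.names])
    (Step.commR (t := none) (u := o) (p := p) (a := b) (b := b)
      ⟨by simp [bindings], by simp [bindings]⟩ (Step.out _ hch)
      (Step.inp _ hch (CostEnv.mem_dom_extend.2 (Or.inl rfl))))
  simpa [paid, Picost.payment, Sys.nu, Sys.map, Proc.map, winCode, succCode, Ident.bind,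
    Ident.lift, Ident.shift, Ne.symm hb.1, Ne.symm hb.2] using h

theorem Step.paid_win_inv (h : Step Θ (paid o p k (winCode succ fail (.chan succ))) l E X) :
    X = paid o p k (succCode succ (.chan succ)) ∧ ∃ u t b, l = .inp u t fail b o := by
  cases h with
  | @opening _ _ _ _ a b R _ _ h1 h2 h3 h =>
    exfalso
    change Step _ (.par (.owned o (winCode succ fail (.chan succ))) (.owned p .nil)) _ _ _ at h
    cases h with
    | parL _ _ h =>
      obtain ⟨_, _, _, h, -⟩ := h.owned_inp_inv
      cases h
    | parR _ _ h => exact h.owned_nil_inv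
  | @new _ _ b R _ _ M' h1 h2 h3 h4 h =>
    change Step _ (.par (.owned o (winCode succ fail (.chan succ))) (.owned p .nil)) _ _ _ at h
    cases h with
    | parL _ _ h =>
      obtain ⟨_, _, _, rfl, rfl, -⟩ := h.owned_inp_inv
      refine ⟨?_, _, _, _, rfl⟩
      have hs : succ ≠ b := by
        rintro rfl
        simp [Sys.fn, Proc.fn, winCode, succCode, Ident.names, Ident.shift] at h1
      simp [paid, Sys.nu, Sys.map, Proc.map, succCode, Ident.bind, Ident.shift, Proc.inst,
        Ident.inst, hs]
    | parR _ _ h => exact h.owned_nil_inv.elim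
    | commL _ _ h => exact h.owned_nil_inv.elim
    | commR _ _ h => exact h.owned_nil_inv.elim

theorem Step.paid_win [Infinite Chan] (hf : Θ.res fail = some ⟨0, 0⟩) (ho : (Θ.funds o).isSome) :
    Step Θ (paid o p k (winCode succ fail (.chan succ))) (.inp o none fail fail o) Θ
      (paid o p k (succCode succ (.chan succ))) := by
  obtain ⟨b, hb, hbd⟩ := Θ.exists_fresh {fail, succ}
  simp only [Finset.mem_insert, Finset.mem_singleton, not_or] at hb
  have hres : (Θ.extend b ⟨k, 0⟩).res fail = some ⟨0, 0⟩ :=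
    (CostEnv.extend_res_of_ne _ _ (Ne.symm hb.1)).trans hf
  have h := Step.new (Γ := Θ) (Γ' := Θ) (b := b) (R := ⟨k, 0⟩) (l := .inp o none fail fail o)
    (M := .par (.owned o (winCode succ fail (.chan succ))) (.owned p .nil))
    (M' := .par (.owned o (succCode succ (.chan succ))) (.owned p .nil))
    (by simp [Sys.fn, Proc.fn, winCode, succCode, Ident.names, Ident.shift, hb]) hbd hbd
    (by simp [Label.names, hb])
    (Step.parL _ (by simp [Label.bn, bindings]) (Step.inp _ (CostEnv.charge_free hres ho ho)
      (by simp [CostEnv.dom, hres])))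
  simpa [paid, Sys.nu, Sys.map, Proc.map, succCode, Ident.bind, Ne.symm hb.2] using h

theorem Step.paid_succ_inv (h : Step Θ (paid o p k (succCode succ (.chan succ))) l E X) :
    ∃ p', l = .out o none succ succ p' := by
  cases h with
  | @opening _ _ _ _ a b R _ _ h1 h2 h3 h =>
    exfalso
    change Step _ (.par (.owned o (succCode succ (.chan succ))) (.owned p .nil)) _ _ _ at h
    cases h with
    | parL _ _ h =>
      obtain ⟨_, h, -⟩ := h.owned_out_inv
      cases h
      exact h3 rfl
    | parR _ _ h => exact h.owned_nil_inv
  | @new _ _ b R _ _ M' h1 h2 h3 h4 h =>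
    change Step _ (.par (.owned o (succCode succ (.chan succ))) (.owned p .nil)) _ _ _ at h
    cases h with
    | parL _ _ h =>
      obtain ⟨_, rfl, -⟩ := h.owned_out_inv
      exact ⟨_, rfl⟩
    | parR _ _ h => exact h.owned_nil_inv.elim
    | commL _ _ h => exact h.owned_nil_inv.elim
    | commR _ _ h => exact h.owned_nil_inv.elim

/-- The states of the test after the payment. -/
def Settled (succ fail : Chan) (o p : Own) (k : ℕ) (T : Sys Chan Own 0) : Prop :=
  T = pending fail o (paid o p k (winCode succ fail (.chan succ))) ∨
    T = .par (.owned o .nil) (paid o p k (succCode succ (.chan succ)))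

theorem secluded_settled : Secluded succ fail (Settled succ fail o p k) := by
  rintro _ Θ l Θ' X (rfl | rfl) hf h
  · rcases h.pending_inv hf with ⟨p, rfl⟩ | ⟨U', rfl, hU⟩ | ⟨U', rfl, rfl, rfl, p, hU⟩
    · refine ⟨by simp, ?_⟩
      rintro _ _ _ ⟨⟩
      exact Or.inr rfl
    · obtain ⟨-, _, _, _, rfl⟩ := hU.paid_win_inv
      refine ⟨by simp, ?_⟩
      rintro _ _ _ ⟨⟩
      exact Or.inr rfl
    · obtain ⟨rfl, -⟩ := hU.paid_win_inv
      exact ⟨fun _ => ⟨rfl, Or.inr rfl⟩, by simp [Label.core]⟩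
  · cases h with
    | parL _ _ h => exact h.owned_nil_inv.elim
    | parR _ _ h =>
      obtain ⟨_, rfl⟩ := h.paid_succ_inv
      refine ⟨by simp, ?_⟩
      rintro _ _ _ ⟨⟩
      exact Or.inl rfl
    | commL _ h _ => exact h.owned_nil_inv.elim
    | commR _ h _ => exact h.owned_nil_inv.elim

omit [DecidableEq Own] in
/-- The private resource of the payment is garbage once the payment has been made. -/
theorem struct_settled [Infinite Chan] :
    Struct (.par (.owned o .nil) (paid o p k (succCode succ (.chan succ))))
      (.owned o (.out (.chan succ) (.chan succ) .nil)) := by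
  obtain ⟨b, hb⟩ := Infinite.exists_notMem_finset ({succ} : Finset Chan)
  simp only [Finset.mem_singleton] at hb
  have e : paid o p k (succCode succ (.chan succ)) =
      Sys.nu b ⟨k, 0⟩ (.par (.owned o (succCode succ (.chan succ))) (.owned p .nil)) := by
    simp [paid, Sys.nu, Sys.map, Proc.map, succCode, Ident.bind, Ne.symm hb]
  have h1 : Struct (paid o p k (succCode succ (.chan succ)))
      (.owned o (succCode succ (.chan succ))) := by
    rw [e]
    refine (Struct.extr _ _ _ _ (by simp [Sys.fn, succCode, Proc.fn, Ident.names, hb])).trans ?_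
    refine (Struct.par (.refl _) ((Struct.nu b _ (.nil p)).trans ?_)).trans (.zero _)
    exact Struct.gc _
  exact (Struct.par (.nil o) h1).trans ((Struct.com _ _).trans (.zero _))

theorem AStep.ext_inv {Γ' : CostEnv Chan Own} {M' : Sys Chan Own 0} {z : ℤ}
    (h : AStep O (Γ, M) (.ext o k p) z (Γ', M')) : M' = M ∧ Γ.Transfer o k p Γ' := by
  generalize hμ : ALabel.ext o k p = μ at h
  cases h with
  | ext _ _ _ h =>
    cases hμ
    exact ⟨rfl, h⟩
  | _ => cases hμ

theorem isTest_ext [Infinite Chan] (ho : o ∈ O) (hp : p ∈ O) (hnd : [succ, fail, req].Nodup) :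
    IsTest O (.ext o k p) succ fail req F (pending fail o (payment succ fail o p k)) o
      (Settled succ fail o p k) (fun _ => False) where
  owner := ho
  failing := failing_pending _
  frozen := ⟨Or.inl (by
    have : succ ≠ fail := by simp at hnd; tauto
    simp [failCode, Proc.fn, Ident.names, this]), Or.inr ⟨rfl, by simp [Proc.Stuck]⟩,
    Or.inl (by simp [Proc.fn, Ident.names])⟩
  good_secluded := secluded_settled
  bad_secluded := fun _ _ _ _ _ h => h.elim
  good T h := by
    rcases h with rfl | rfl
    · exact Or.inr (failing_pending _)
    · exact Or.inl struct_settled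
  bad _ h := h.elim
  sound {Γ M E X} ha h := by
    have hf := (CostEnv.res_testResources (Γ := Γ) hnd).2
    have hfM := ha.notMem_fn (c := fail) (by simp)
    rcases h with ⟨T', rfl, h⟩ | ⟨u, t, a, b, p, M', T', hE, rfl, ⟨h1, h2⟩ | ⟨h1, h2⟩⟩
    · have hfo := h.funds_isSome o
      rcases h.pending_inv hf with ⟨p, h⟩ | ⟨U, rfl, hU⟩ | ⟨U, -, -, -, p, h⟩
      · cases h
      · obtain ⟨-, rfl, x, y, hx, hy, hk, hm, hr⟩ := hU.payment_inv
        refine ⟨by rw [hfo, hx]; rfl, Or.inl ⟨[], M, _, _, rfl, rfl, Or.inl rfl,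
          AStep.ext M ho hp ⟨x, y, by simpa using hx, by simpa using hy, hk,
            CostEnv.ext_fields rfl ?_ ?_⟩⟩⟩
        · simpa using hm
        · simpa using hr
      · cases h.payment_inv.1
    · exfalso
      rcases h2.pending_inv hf with ⟨p, h⟩ | ⟨U, rfl, h⟩ | ⟨U, h, -⟩
      · cases h
        exact hfM (h1.charge rfl).1
      · cases h.payment_inv.1
      · cases h
    · exfalso
      rcases h2.pending_inv hf with ⟨p, h⟩ | ⟨U, rfl, h⟩ | ⟨U, h, -⟩
      · cases h
      · cases h.payment_inv.1
      · cases h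
  complete {Γ M Γ' M' z} ha h := by
    obtain ⟨rfl, x, y, hx, hy, hk, rfl⟩ := h.ext_inv
    have hfo : (Γ.funds o).isSome := by simp [hx]
    have hf := (CostEnv.res_testResources (Γ := Γ) hnd).2
    refine ⟨[], pending fail o (paid o p k (winCode succ fail (.chan succ))),
      .par (.owned o .nil) (paid o p k (succCode succ (.chan succ))), rfl, rfl, hfo,
      Step.parR _ (by simp [Label.bn]) (Step.parR _ (by simp [Label.bn])
        (Step.payment (x := x) (y := y) (by simpa using hx) (by simpa using hy) hk
          (CostEnv.extendAll_res_eq _ rfl) (by simp) (by simp))),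
      .single (Step.withdraw ?_ ?_ (Step.paid_win ?_ ?_)), struct_settled, ?_⟩
    · exact (CostEnv.res_testResources hnd).2
    · simpa [CostEnv.extendAll_funds, CostEnv.withFunds, CostEnv.moveFunds_isSome] using hfo
    · exact (CostEnv.res_testResources hnd).2
    · simpa [CostEnv.extendAll_funds, CostEnv.withFunds, CostEnv.moveFunds_isSome] using hfo
    · have : fail ≠ succ := by simp at hnd; tauto
      simp [paid, Sys.fn, succCode, Proc.fn, Ident.names, this]

/-! ### Definability -/

/-- An action that no admissible system performs is defined by the test that does nothing. -/
theorem definable_of_impossible [Infinite Chan] (hnd : [succ, fail, req].Nodup)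
    (himp : ∀ (Γ : CostEnv Chan Own) (M : Sys Chan Own 0) z D,
      Admissible μ succ fail req F Γ M → ¬ AStep O (Γ, M) μ z D)
    {Γ : CostEnv Chan Own} {M : Sys Chan Own 0} (ha : Admissible μ succ fail req F Γ M) :
    (∀ w D, ¬ Weak .tau (AStep O) (Γ, M) μ w D) ∧
    ∀ E X w, Weak .tau (AStep O) (Γ.extendAll (testResources succ fail req), .par M .zero) .tau w
      (E, X) → ¬ BarbOut E X succ := by
  constructor
  · intro w D h
    obtain ⟨-, C, D, z, h1, h2, -⟩ := weak_iff.1 h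
    obtain ⟨hr, hc, -⟩ := tau_star_invariant h1
    exact himp _ _ z D (ha.congr hr (hc ha.config)) h2
  · intro E X w h
    obtain ⟨-, C, D, z, h1, h2, h3⟩ := weak_iff.1 h
    have h := (h1.tail (aStep_tau_iff.1 h2).1).trans h3
    have key : ∀ D : CostEnv Chan Own × Sys Chan Own 0, Relation.ReflTransGen Tau
        (Γ.extendAll (testResources succ fail req), .par M .zero) D → succ ∉ D.2.fn := by
      intro D h
      induction h with
      | refl => simpa [Sys.fn] using ha.notMem_fn (c := succ) (by simp)
      | tail _ h ih => exact fun hs => ih (h.fn_subset_of_tau hs)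
    refine not_barbOut_of_notMem ?_ (key _ h)
    have := (tau_star_invariant h).1
    simp only at this
    rw [CostEnv.dom_congr this]
    simp [CostEnv.dom, (CostEnv.res_testResources hnd).1]

end

section

variable {Chan : Type u} {Own : Type v} [DecidableEq Chan] [DecidableEq Own] [Infinite Chan]
  {O : Set Own} {μ : ALabel Chan Own}

/-- Names of `F` that clash with the test resources or the bound names of `μ` do not matter, as no
admissible environment contains them. -/
def relevantNames (μ : ALabel Chan Own) (succ fail req : Chan) (F : Finset Chan) : Finset Chan :=
  F.filter fun c => c ∉ [succ, fail, req] ∧ c ∉ μ.bn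

/-- For a label `μ` to be definable it suffices to have a test for `μ`, or to know that no
admissible system performs `μ`, with `F` free of the names that admissible environments exclude
anyway. -/
theorem definable_of_isTest_or_impossible
    (h : ∀ succ fail req : Chan, [succ, fail, req].Nodup → (∀ r ∈ μ.bn, r ∉ [succ, fail, req]) →
      ∀ F : Finset Chan, (∀ c ∈ F, c ∉ [succ, fail, req] ∧ c ∉ μ.bn) →
      (∃ T o Good Bad, IsTest O μ succ fail req F T o Good Bad ∧ T.owners ⊆ O ∧
        ∀ c ∈ T.fn, c ∈ F ∨ c ∈ [succ, fail, req]) ∨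
      ∃ _ : Own, ∀ (Γ : CostEnv Chan Own) (M : Sys Chan Own 0) z D,
        Admissible μ succ fail req F Γ M → ¬ AStep O (Γ, M) μ z D) :
    Definable O μ := by
  intro succ fail req hnd hbn F
  have hadm : ∀ (Γ : CostEnv Chan Own) (M : Sys Chan Own 0), IsConfig Γ M →
      Γ.dom ⊆ (F : Set Chan) → Γ.Fresh (testResources succ fail req) → (∀ r ∈ μ.bn, r ∉ Γ.dom) →
      Admissible μ succ fail req (relevantNames μ succ fail req F) Γ M := by
    intro Γ M h1 h2 h3 h4
    refine ⟨h1, fun c hc => ?_, h3, h4⟩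
    simp only [relevantNames, Finset.coe_filter, Set.mem_ofPred_eq]
    exact ⟨h2 hc, fun h => (CostEnv.fresh_testResources_iff.1 h3).2 c h hc, fun h => h4 c h hc⟩
  rcases h succ fail req hnd hbn (relevantNames μ succ fail req F)
    (fun c hc => (Finset.mem_filter.1 hc).2) with ⟨T, o, Good, Bad, ht, hT, hfn⟩ | ⟨o, himp⟩
  · refine ⟨T, o, hT, fun c hc => ?_, fun Γ M h1 h2 h3 h4 =>
      ⟨fun Δ rs N w hrs hΔ hw => ⟨ht.owner, ?_⟩, fun E X w hw hs hf => ⟨ht.owner, ?_⟩⟩⟩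
    · rcases hfn c hc with hc | hc
      · exact Or.inl (Finset.mem_filter.1 hc).1
      · exact Or.inr (Or.inr hc)
    · exact ht.success_of_weak (hadm Γ M h1 h2 h3 h4) hbn hrs hΔ hw
    · exact ht.weak_of_success (hadm Γ M h1 h2 h3 h4) hbn hw hs hf
  · refine ⟨.zero, o, by simp [Sys.owners], by simp [Sys.fn], fun Γ M h1 h2 h3 h4 => ?_⟩
    obtain ⟨hi, hii⟩ := definable_of_impossible hnd himp (hadm Γ M h1 h2 h3 h4)
    exact ⟨fun Δ rs N w _ _ hw => (hi _ _ hw).elim, fun E X w hw hs _ => (hii _ _ _ hw hs).elim⟩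

/-- An input is impossible if its owner is not in `O` or one of its free names is not in `F`. -/
theorem definable_inp (o : Own) (t : Option ResType) (a b : Chan) : Definable O (.inp o t a b) := by
  refine definable_of_isTest_or_impossible fun succ fail req hnd hbn F hF => ?_
  by_cases hp : o ∈ O ∧ a ∈ F ∧ (t = none → b ∈ F)
  · obtain ⟨ho, ha, hb⟩ := hp
    have ⟨hat, hab⟩ := hF a ha
    have has : a ≠ succ := by rintro rfl; simp at hat
    have haf : a ≠ fail := by rintro rfl; simp at hat
    left
    cases t with
    | none =>
      refine ⟨_, _, _, _, isTest_inp_free ho hnd has (hF b (hb rfl)).1, ?_, ?_⟩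
      · simp [inpTest, pending, Sys.owners, ho]
      · simp [inpTest, pending, Sys.fn, failCode, winCode, succCode, Proc.fn, Ident.names,
          Ident.shift, ha, hb]
    | some R =>
      have hbt : b ∉ [succ, fail, req] := hbn b (by simp [ALabel.bn, bindings])
      refine ⟨_, _, _, _, isTest_inp_bound ho hnd has haf ?_ hbt, ?_, ?_⟩
      · rintro rfl
        simp [ALabel.bn, bindings] at hab
      · simp [inpNewTest, pending, Sys.owners, ho]
      · simp [inpNewTest, pending, Sys.fn, failCode, fn_winCode_var, Proc.fn, Ident.names, ha]
  · refine Or.inr ⟨o, fun Γ M z D had h => hp ?_⟩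
    cases h with
    | inp ho h =>
      refine ⟨ho, had.dom_subset (h.charge rfl).2.mem_dom, ?_⟩
      rintro rfl
      exact had.dom_subset (h.value_mem_dom rfl)

/-- An output is impossible if its owner is not in `O` or one of its free names is not in `F`. -/
theorem definable_out (β : Bool) (a b : Chan) (o : Own) : Definable O (.out β a b o) := by
  refine definable_of_isTest_or_impossible fun succ fail req hnd hbn F hF => ?_
  by_cases hp : o ∈ O ∧ a ∈ F ∧ (β = false → b ∈ F)
  · obtain ⟨ho, ha, hb⟩ := hp
    have haf : a ≠ fail := by
      rintro rfl
      simpa using (hF a ha).1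
    left
    cases β with
    | false =>
      refine ⟨_, _, _, _, isTest_out_free ho hnd haf, ?_, ?_⟩
      · simp [outTest, pending, Sys.owners, ho]
      · simp [outTest, pending, Sys.fn, failCode, fn_matchCode, Proc.fn, Ident.names, ha, hb]
    | true =>
      have hbt : b ∉ [succ, fail, req] := hbn b (by simp [ALabel.bn])
      refine ⟨_, _, _, _, isTest_out_bound ho hnd haf hbt ?_, ?_, ?_⟩
      · exact fun h => (hF b h).2 (by simp [ALabel.bn])
      · simp [outTest, pending, Sys.owners, ho]
      · intro c hc
        simp only [outTest, pending, Sys.fn, failCode, Proc.fn, Ident.names, Finset.mem_union,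
          Finset.mem_singleton, Finset.notMem_empty, fn_freshCode, Finset.mem_toList] at hc
        simp only [List.mem_cons, List.not_mem_nil]
        rcases hc with hc | rfl | hc
        · tauto
        · exact Or.inl ha
        · tauto
  · refine Or.inr ⟨o, fun Γ M z D had h => hp ?_⟩
    cases h with
    | out ho h =>
      refine ⟨ho, had.dom_subset (h.charge rfl).2.mem_dom, ?_⟩
      intro e
      rename_i t
      cases t with
      | none => exact had.dom_subset (had.config _ (h.value_mem_fn rfl))
      | some R => cases e

theorem definable_ext (o : Own) (k : ℕ) (p : Own) :
    Definable O (.ext o k p : ALabel Chan Own) := by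
  refine definable_of_isTest_or_impossible fun succ fail req hnd _ F _ => ?_
  by_cases hop : o ∈ O ∧ p ∈ O
  · refine Or.inl ⟨_, _, _, _, isTest_ext hop.1 hop.2 hnd, ?_, ?_⟩
    · simp [pending, payment, Sys.owners, Set.insert_subset_iff, hop]
    · simp [pending, payment, Sys.fn, failCode, winCode, succCode, Proc.fn, Ident.names,
        Ident.shift]
  · refine Or.inr ⟨o, fun Γ M z D _ h => hop ?_⟩
    cases h with
    | ext _ ho hp _ => exact ⟨ho, hp⟩

end

end Picost

theorem mainTheorem3 {Chan : Type*} {Own : Type*} [DecidableEq Chan] [DecidableEq Own]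
    [Infinite Chan] (O : Set Own) (μ : ALabel Chan Own) (hμ : μ ≠ .tau) :
    Definable O μ := by
  cases μ with
  | tau => exact (hμ rfl).elim
  | inp o t a b => exact definable_inp o t a b
  | out β a b o => exact definable_out β a b o
  | ext o k p => exact definable_ext o k p
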